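/- For an integer polynomial $P$ let $H(P)$ be the maximum modulus of its coefficients, and for an algebraic number $\alpha$ let $H(\alpha)=H(P)$, where $P\in\mathbb{Z}[T]$ is its minimal polynomial with coprime coefficients. Let $\xi$ be a real number. All suprema below are over real $w$ and are taken in $[-\infty,\infty]$. - For $n\ge 0$, $\widehat w_n(\xi)$ is the supremum of $w$ such that, for all sufficiently large real $X$, there is an integer polynomial $P$ of degree at most $n$ with $H(P)\le X$ and $0<|P(\xi)|\le X^{-w}$. - For $n\ge 1$, $w^{int}_{=n}(\xi)$ is the supremum of $w$ such that $0<|P(\xi)|\le H(P)^{-w}$ for infinitely many irreducible monic integer polynomials $P$ of degree exactly $n$. - For $n\ge 1$, $w^{\ast int}_{=n}(\xi)$ is the supremum of $w$ such that $0<|\xi-\alpha|\le H(\alpha)^{-w-1}$ for infinitely many real algebraic integers $\alpha$ of degree exactly $n$. **Theorem.** Let $1\le m\le n$ be integers and let $\xi$ be a transcendental real number with $$\min\{w^{int}_{=m}(\xi),\widehat w_{n-1}(\xi)\}>2n-7 .$$ Then $$w^{\ast int}_{=n}(\xi)\ \ge\ \tfrac32\min\{w^{int}_{=m}(\xi),\widehat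 w_{n-1}(\xi)\}-n+\tfrac12$$ and $$w^{int}_{=n}(\xi)\ \ge\ \min\{w^{int}_{=m}(\xi),\widehat w_{n-1}(\xi)\}.$$ In particular, if $n\ge 2$, then $$w^{int}_{=n}(\xi)\ \ge\ \min\{w^{int}_{=n-1}(\xi),\,n-1\}.$$ -/

import Mathlib

open Polynomial Filter

noncomputable section

/-- The naive height `H(P)`: the maximum modulus of the coefficients of `P`. -/
def naiveHeight (P : ℤ[X]) : ℝ :=
  P.supNorm

/-- The supremum, in `[-∞, ∞]`, of a set of real exponents. -/
def supExponent (S : Set ℝ) : EReal :=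
  ⨆ w ∈ S, (w : EReal)

/-- The uniform exponent `ŵ_n(ξ)`: the supremum of the real `w` such that, for all large `X`, some
integer polynomial `P` of degree at most `n` satisfies `H(P) ≤ X` and `0 < |P(ξ)| ≤ X ^ (-w)`. -/
def uniformExponent (n : ℕ) (ξ : ℝ) : EReal :=
  supExponent {w : ℝ | ∀ᶠ X : ℝ in atTop, ∃ P : ℤ[X],
    P.natDegree ≤ n ∧ naiveHeight P ≤ X ∧
      0 < |aeval ξ P| ∧ |aeval ξ P| ≤ X ^ (-w)}

/-- The exponent `w^{int}_{=n}(ξ)`: the supremum of the real `w` such that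
`0 < |P(ξ)| ≤ H(P) ^ (-w)` for infinitely many irreducible monic integer polynomials `P`
of degree exactly `n`. -/
def intExponent (n : ℕ) (ξ : ℝ) : EReal :=
  supExponent {w : ℝ | {P : ℤ[X] | Irreducible P ∧ P.Monic ∧ P.natDegree = n ∧
    0 < |aeval ξ P| ∧ |aeval ξ P| ≤ naiveHeight P ^ (-w)}.Infinite}

/-- The exponent `w^{*int}_{=n}(ξ)`: the supremum of the real `w` such that
`0 < |ξ - α| ≤ H(α) ^ (-w - 1)` for infinitely many real algebraic integers `α` of degree
exactly `n`. The minimal polynomial over `ℤ` of an algebraic integer is monic, so it is the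
primitive one, and its degree is the degree of `α`. -/
def starIntExponent (n : ℕ) (ξ : ℝ) : EReal :=
  supExponent {w : ℝ | {α : ℝ | IsIntegral ℤ α ∧ (minpoly ℤ α).natDegree = n ∧
    0 < |ξ - α| ∧ |ξ - α| ≤ naiveHeight (minpoly ℤ α) ^ (-w - 1)}.Infinite}

end

/-! Let `W` be the minimum of the two exponents and `0 < V ≤ W`. Replace `m` by the least degree
whose exponent reaches `V`; then all smaller degrees have exponent below some `u < V`. Take an
irreducible monic `Q` of degree `m` and large height `H`, small at `ξ`, and let `U` be a product of
`n - m` distinct factors `X - x`, `x` an integer. The uniform exponent gives `P` of degree below `n`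
and height at most `H ^ (1 - 2ε)`, also small at `ξ`. For primes `p ≤ H ^ ε` the polynomials `R_p =
U Q + p P` are monic of degree `n`, have height comparable to `H`, and are almost as small at `ξ` as
`H ^ (-V)`.

Few of them are reducible. Since evaluation and Mahler measure are multiplicative, a reducible `R_p`
has an irreducible factor `A` that is small relative to its own measure
(`exists_irreducible_factor_small`). If `deg A < m`, then `A` lies in a finite set fixed in advance,
and each such `A` divides at most one `R_p`. Otherwise the cofactor `B` has degree at most `n - m`,
and `B(x)` divides `p P(x)` at the roots `x` of `U`. The divisor bound and interpolation leave `H ^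
o(1)` shapes for `B`, each serving at most `2n` primes (`card_primes_with_factor_le`). Chebyshev's
bound supplies more primes than this, so two of the `R_p` are irreducible
(`exists_smallIrreducible_pair`). One of them suffices for `w^{int}`.

For `w^{*int}` with `W > n - 1`, compare the two polynomials `R` and `S`. Their resultant is a
nonzero integer, while its logarithm is at most `2n log H + O(1)` minus the sum of `min (u i) (v
j)`, where `u` and `v` measure the logarithmic closeness of the roots to `ξ`. Nonreal roots come in
conjugate pairs equidistant from `ξ`. If no real root lies within `H ^ (-d)`, `min_le_sum_sum_min`
makes the double sum too large whenever `d < 3/2 (V + 1) - n` and the exponent used is close enough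
to `V` (`exists_close_real_root`).

If `W ≤ n - 1`, then `2n - 7 < W` forces `n ≤ 5`, and the claimed bound is at most `n/2 - 1`. It is
enough that `w^{*int}` is at least `1` for `2 ≤ n ≤ 4` and at least `2` for `n = 5`; this comes from
Eisenstein polynomials built on coprime minimal polynomials of degree at most `1` or `2`
(`exists_irreducible_monic_near`). The case `n = 1` is computed directly, and Dirichlet's theorem
gives the last claim. -/

/-! ### Naive height and Mahler measure -/

theorem abs_coeff_le_naiveHeight (P : ℤ[X]) (i : ℕ) : |(P.coeff i : ℝ)| ≤ naiveHeight P := by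
  have := P.le_supNorm i
  rwa [Int.norm_eq_abs] at this

theorem naiveHeight_le_of_coeff {P : ℤ[X]} {c : ℝ} (h : ∀ i, |(P.coeff i : ℝ)| ≤ c) :
    naiveHeight P ≤ c := by
  obtain ⟨i, hi⟩ := P.exists_eq_supNorm
  rw [naiveHeight, hi, Int.norm_eq_abs]
  exact h i

theorem naiveHeight_nonneg (P : ℤ[X]) : 0 ≤ naiveHeight P := P.supNorm_nonneg

theorem one_le_naiveHeight {P : ℤ[X]} (hP : P ≠ 0) : 1 ≤ naiveHeight P := by
  refine le_trans ?_ (abs_coeff_le_naiveHeight P P.natDegree)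
  have : P.coeff P.natDegree ≠ 0 := by simpa using hP
  exact_mod_cast Int.one_le_abs this

theorem naiveHeight_add_le (P Q : ℤ[X]) :
    naiveHeight (P + Q) ≤ naiveHeight P + naiveHeight Q := by
  refine naiveHeight_le_of_coeff fun i ↦ ?_
  rw [coeff_add, Int.cast_add]
  exact (abs_add_le _ _).trans
    (add_le_add (abs_coeff_le_naiveHeight P i) (abs_coeff_le_naiveHeight Q i))

theorem naiveHeight_C_mul_le (k : ℤ) (P : ℤ[X]) :
    naiveHeight (C k * P) ≤ |(k : ℝ)| * naiveHeight P := by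
  refine naiveHeight_le_of_coeff fun i ↦ ?_
  rw [coeff_C_mul, Int.cast_mul, abs_mul]
  exact mul_le_mul_of_nonneg_left (abs_coeff_le_naiveHeight P i) (abs_nonneg _)

theorem naiveHeight_neg (P : ℤ[X]) : naiveHeight (-P) = naiveHeight P := by
  refine le_antisymm (naiveHeight_le_of_coeff fun i ↦ ?_) (naiveHeight_le_of_coeff fun i ↦ ?_)
  · simpa using abs_coeff_le_naiveHeight P i
  · simpa using abs_coeff_le_naiveHeight (-P) i

theorem abs_aeval_le {P : ℤ[X]} {n : ℕ} (hn : P.natDegree ≤ n) (x : ℝ) :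
    |aeval x P| ≤ (n + 1) * (max 1 |x|) ^ n * naiveHeight P := by
  rw [aeval_eq_sum_range' (Nat.lt_succ_of_le hn)]
  refine (Finset.abs_sum_le_sum_abs _ _).trans ?_
  have : ∀ i ∈ Finset.range n.succ, |P.coeff i • x ^ i| ≤ (max 1 |x|) ^ n * naiveHeight P := by
    intro i hi
    rw [zsmul_eq_mul, abs_mul, abs_pow, mul_comm]
    refine mul_le_mul ?_ (abs_coeff_le_naiveHeight P i) (abs_nonneg _) (by positivity)
    calc |x| ^ i ≤ (max 1 |x|) ^ i := by gcongr; exact le_max_right _ _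
      _ ≤ _ := pow_le_pow_right₀ (le_max_left _ _) (Nat.lt_succ_iff.mp (Finset.mem_range.mp hi))
  refine (Finset.sum_le_sum this).trans_eq ?_
  simp [mul_assoc]

/-- The Mahler measure of an integer polynomial. -/
noncomputable def intMahler (P : ℤ[X]) : ℝ := P.mapMahlerMeasure (Int.castRingHom ℂ)

theorem intMahler_mul (P Q : ℤ[X]) : intMahler (P * Q) = intMahler P * intMahler Q :=
  mapMahlerMeasure_mul _ _ _

theorem one_le_intMahler {P : ℤ[X]} (hP : P ≠ 0) : 1 ≤ intMahler P :=
  one_le_mahlerMeasure_of_ne_zero hP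

theorem supNorm_map_intCast (P : ℤ[X]) :
    (P.map (Int.castRingHom ℂ)).supNorm = naiveHeight P := by
  rw [naiveHeight, supNorm_eq_iSup, supNorm_eq_iSup]
  simp [Int.norm_eq_abs]

theorem intMahler_le {P : ℤ[X]} {n : ℕ} (hn : P.natDegree ≤ n) :
    intMahler P ≤ (n + 1) * naiveHeight P := by
  have h := mahlerMeasure_le_sqrt_natDegree_add_one_mul_supNorm (P.map (Int.castRingHom ℂ))
  rw [supNorm_map_intCast, natDegree_map_eq_of_injective (RingHom.injective_int _)] at h
  refine h.trans (mul_le_mul_of_nonneg_right ?_ (naiveHeight_nonneg P))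
  have h1 : (P.natDegree : ℝ) ≤ n := by exact_mod_cast hn
  rw [Real.sqrt_le_left (by positivity)]
  nlinarith

theorem naiveHeight_le_mahler {P : ℤ[X]} {n : ℕ} (hn : P.natDegree ≤ n) :
    naiveHeight P ≤ 2 ^ n * intMahler P := by
  have h := supNorm_le_choose_natDegree_div_two_mul_mahlerMeasure (P.map (Int.castRingHom ℂ))
  rw [supNorm_map_intCast, natDegree_map_eq_of_injective (RingHom.injective_int _)] at h
  refine h.trans (mul_le_mul_of_nonneg_right ?_ (mapMahlerMeasure_nonneg _ _))
  have h1 : (P.natDegree).choose (P.natDegree / 2) ≤ 2 ^ n :=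
    (Nat.choose_le_two_pow _ _).trans (Nat.pow_le_pow_right (by norm_num) hn)
  exact_mod_cast h1

/-- Comparison constant between the height of a product and the product of the heights. -/
noncomputable def heightConst (n : ℕ) : ℝ := 4 ^ n * (n + 1) ^ 2

theorem one_le_heightConst (n : ℕ) : 1 ≤ heightConst n := by
  have h1 : (1 : ℝ) ≤ 4 ^ n := one_le_pow₀ (by norm_num)
  have h2 : (1 : ℝ) ≤ (n + 1) ^ 2 := one_le_pow₀ (by simp)
  unfold heightConst
  nlinarith

/-- Gelfond's inequality: the Mahler measure is multiplicative and agrees with the height up to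
factors depending only on the degree. -/
theorem naiveHeight_mul_naiveHeight_le {P Q : ℤ[X]} {n : ℕ} (h0 : P * Q ≠ 0)
    (hn : (P * Q).natDegree ≤ n) :
    naiveHeight P * naiveHeight Q ≤ heightConst n * naiveHeight (P * Q) := by
  have hP := left_ne_zero_of_mul h0
  have hQ := right_ne_zero_of_mul h0
  have hd := natDegree_mul hP hQ
  have h1 : naiveHeight P ≤ 2 ^ n * intMahler P := naiveHeight_le_mahler (by omega)
  have h2 : naiveHeight Q ≤ 2 ^ n * intMahler Q := naiveHeight_le_mahler (by omega)
  have h3 := intMahler_le hn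
  rw [intMahler_mul] at h3
  have h4 : (4 : ℝ) ^ n = 2 ^ n * 2 ^ n := by rw [← mul_pow]; norm_num
  have h5 : (n + 1 : ℝ) ≤ (n + 1) ^ 2 := by nlinarith [(Nat.cast_nonneg n : (0 : ℝ) ≤ n)]
  calc _ ≤ (2 ^ n * intMahler P) * (2 ^ n * intMahler Q) :=
        mul_le_mul h1 h2 (naiveHeight_nonneg _) ((naiveHeight_nonneg _).trans h1)
    _ = 4 ^ n * (intMahler P * intMahler Q) := by rw [h4]; ring
    _ ≤ 4 ^ n * ((n + 1) ^ 2 * naiveHeight (P * Q)) := by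
        refine mul_le_mul_of_nonneg_left ?_ (by positivity)
        exact h3.trans (mul_le_mul_of_nonneg_right h5 (naiveHeight_nonneg _))
    _ = _ := by rw [heightConst]; ring

theorem naiveHeight_mul_le {P Q : ℤ[X]} {n : ℕ} (h0 : P * Q ≠ 0)
    (hn : (P * Q).natDegree ≤ n) :
    naiveHeight (P * Q) ≤ heightConst n * (naiveHeight P * naiveHeight Q) := by
  have hP := left_ne_zero_of_mul h0
  have hQ := right_ne_zero_of_mul h0
  have hd := natDegree_mul hP hQ
  have h1 : intMahler P ≤ (n + 1) * naiveHeight P := intMahler_le (by omega)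
  have h2 : intMahler Q ≤ (n + 1) * naiveHeight Q := intMahler_le (by omega)
  have h3 := naiveHeight_le_mahler hn
  rw [intMahler_mul] at h3
  have h4 : (2 : ℝ) ^ n ≤ 4 ^ n := by gcongr; norm_num
  calc _ ≤ 2 ^ n * (intMahler P * intMahler Q) := h3
    _ ≤ 4 ^ n * (((n + 1) * naiveHeight P) * ((n + 1) * naiveHeight Q)) := by
        have := one_le_intMahler hP
        have := one_le_intMahler hQ
        have := naiveHeight_nonneg P
        gcongr
    _ = _ := by rw [heightConst]; ring

theorem naiveHeight_le_of_dvd {P Q : ℤ[X]} {n : ℕ} (h : P ∣ Q) (h0 : Q ≠ 0)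
    (hn : Q.natDegree ≤ n) : naiveHeight P ≤ heightConst n * naiveHeight Q := by
  obtain ⟨R, rfl⟩ := h
  refine le_trans ?_ (naiveHeight_mul_naiveHeight_le h0 hn)
  exact le_mul_of_one_le_right (naiveHeight_nonneg _) (one_le_naiveHeight (right_ne_zero_of_mul h0))

theorem finite_naiveHeight_le (n : ℕ) (B : ℝ) :
    {P : ℤ[X] | P.natDegree ≤ n ∧ naiveHeight P ≤ B}.Finite := by
  refine (finite_mahlerMeasure_le n (Real.toNNReal ((n + 1) * B))).subset ?_
  rintro P ⟨h1, h2⟩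
  refine ⟨h1, ?_⟩
  refine (intMahler_le h1).trans (le_trans ?_ (Real.le_coe_toNNReal _))
  gcongr

theorem aeval_ne_zero_of_transcendental {ξ : ℝ} (hξ : Transcendental ℚ ξ) {P : ℤ[X]} (hP : P ≠ 0) :
    aeval ξ P ≠ 0 := by
  have h : Transcendental ℤ ξ := fun h ↦ hξ (h.extendScalars (RingHom.injective_int _))
  exact fun h0 ↦ h ⟨P, hP, h0⟩

/-! ### The exponents as suprema; small irreducible factors -/

theorem exists_mem_of_lt_supExponent {S : Set ℝ} {x : EReal} (h : x < supExponent S) :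
    ∃ w ∈ S, x < (w : EReal) := by
  simpa [supExponent, lt_iSup_iff] using h

theorem coe_le_supExponent {S : Set ℝ} {w : ℝ} (hw : w ∈ S) : (w : EReal) ≤ supExponent S :=
  le_iSup₂ (f := fun (w : ℝ) (_ : w ∈ S) ↦ (w : EReal)) w hw

theorem coe_le_supExponent_of_forall_lt {S : Set ℝ} {V : ℝ} (h : ∀ w < V, w ∈ S) :
    (V : EReal) ≤ supExponent S := by
  by_contra hlt
  obtain ⟨w, hw1, hw2⟩ := EReal.lt_iff_exists_real_btwn.mp (not_le.mp hlt)
  exact absurd (coe_le_supExponent (h w (EReal.coe_lt_coe_iff.mp hw2))) (not_le.mpr hw1)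

/-- A positive function on a finite set has a positive minimum. Infinitude is thus always obtained
from arbitrarily good approximations, with no need to track heights. -/
theorem infinite_of_forall_exists_lt {α : Type*} {S : Set α} {f : α → ℝ}
    (hpos : ∀ a ∈ S, 0 < f a) (h : ∀ ε > 0, ∃ a ∈ S, f a < ε) : S.Infinite := by
  intro hfin
  obtain ⟨a, ha, -⟩ := h 1 one_pos
  obtain ⟨b, hb, hmin⟩ := Set.exists_min_image S f hfin ⟨a, ha⟩
  obtain ⟨c, hc, hlt⟩ := h (f b) (hpos b hb)
  exact absurd (hmin c hc) (not_le.mpr hlt)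

theorem coe_le_intExponent {n : ℕ} {ξ V : ℝ}
    (h : ∀ w < V, ∀ ε > 0, ∃ R : ℤ[X], Irreducible R ∧ R.Monic ∧ R.natDegree = n ∧
      0 < |aeval ξ R| ∧ |aeval ξ R| ≤ naiveHeight R ^ (-w) ∧ |aeval ξ R| < ε) :
    (V : EReal) ≤ intExponent n ξ := by
  refine coe_le_supExponent_of_forall_lt fun w hw ↦ ?_
  refine infinite_of_forall_exists_lt (f := fun R : ℤ[X] ↦ |aeval ξ R|) (fun R hR ↦ hR.2.2.2.1) ?_
  intro ε hε
  obtain ⟨R, h1, h2, h3, h4, h5, h6⟩ := h w hw ε hε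
  exact ⟨R, ⟨h1, h2, h3, h4, h5⟩, h6⟩

theorem coe_le_starIntExponent {n : ℕ} {ξ V : ℝ}
    (h : ∀ w < V, ∀ ε > 0, ∃ α : ℝ, IsIntegral ℤ α ∧ (minpoly ℤ α).natDegree = n ∧
      0 < |ξ - α| ∧ |ξ - α| ≤ naiveHeight (minpoly ℤ α) ^ (-w - 1) ∧ |ξ - α| < ε) :
    (V : EReal) ≤ starIntExponent n ξ := by
  refine coe_le_supExponent_of_forall_lt fun w hw ↦ ?_
  refine infinite_of_forall_exists_lt (f := fun α : ℝ ↦ |ξ - α|) (fun R hR ↦ hR.2.2.1) ?_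
  intro ε hε
  obtain ⟨R, h1, h2, h3, h4, h5⟩ := h w hw ε hε
  exact ⟨R, ⟨h1, h2, h3, h4⟩, h5⟩

theorem exists_of_coe_le_intExponent {n : ℕ} {ξ V w : ℝ} (h : (V : EReal) ≤ intExponent n ξ)
    (hw : w < V) (B : ℝ) : ∃ Q : ℤ[X], Irreducible Q ∧ Q.Monic ∧ Q.natDegree = n ∧
      B < naiveHeight Q ∧ |aeval ξ Q| ≤ naiveHeight Q ^ (-w) := by
  obtain ⟨v, hv, hwv⟩ :=
    exists_mem_of_lt_supExponent ((EReal.coe_lt_coe_iff.mpr hw).trans_le h)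
  obtain ⟨Q, ⟨h1, h2, h3, h4, h5⟩, hQ⟩ := Set.Infinite.exists_notMem_finite hv
    (finite_naiveHeight_le n B)
  refine ⟨Q, h1, h2, h3, ?_, h5.trans ?_⟩
  · by_contra hle
    exact hQ ⟨h3.le, not_lt.mp hle⟩
  · have := EReal.coe_lt_coe_iff.mp hwv
    exact Real.rpow_le_rpow_of_exponent_le (one_le_naiveHeight h2.ne_zero) (by linarith)

theorem eventually_of_coe_le_uniformExponent {n : ℕ} {ξ V w : ℝ}
    (h : (V : EReal) ≤ uniformExponent n ξ) (hw : w < V) :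
    ∀ᶠ X : ℝ in atTop, ∃ P : ℤ[X], P.natDegree ≤ n ∧ naiveHeight P ≤ X ∧
      0 < |aeval ξ P| ∧ |aeval ξ P| ≤ X ^ (-w) := by
  obtain ⟨v, hv, hwv⟩ :=
    exists_mem_of_lt_supExponent ((EReal.coe_lt_coe_iff.mpr hw).trans_le h)
  filter_upwards [hv, eventually_ge_atTop 1] with X hX h1
  obtain ⟨P, hP1, hP2, hP3, hP4⟩ := hX
  refine ⟨P, hP1, hP2, hP3, hP4.trans ?_⟩
  have := EReal.coe_lt_coe_iff.mp hwv
  exact Real.rpow_le_rpow_of_exponent_le h1 (by linarith)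

/-- Height and Mahler measure differ by a constant factor, which the gap between `w` and an
intermediate `v` absorbs at large height; bounded height leaves finitely many polynomials anyway. -/
theorem finite_of_intExponent_lt {n : ℕ} {ξ w : ℝ} (hw0 : 0 ≤ w) (h : intExponent n ξ < w) :
    {A : ℤ[X] | Irreducible A ∧ A.Monic ∧ A.natDegree = n ∧ 0 < |aeval ξ A| ∧
      |aeval ξ A| ≤ intMahler A ^ (-w)}.Finite := by
  obtain ⟨v, hv1, hv2⟩ := EReal.lt_iff_exists_real_btwn.mp h
  have hvw : v < w := EReal.coe_lt_coe_iff.mp hv2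
  have hfin : {P : ℤ[X] | Irreducible P ∧ P.Monic ∧ P.natDegree = n ∧
      0 < |aeval ξ P| ∧ |aeval ξ P| ≤ naiveHeight P ^ (-v)}.Finite := by
    by_contra hinf
    exact absurd (coe_le_supExponent (S := {w : ℝ | {P : ℤ[X] | Irreducible P ∧ P.Monic ∧
      P.natDegree = n ∧ 0 < |aeval ξ P| ∧ |aeval ξ P| ≤ naiveHeight P ^ (-w)}.Infinite})
      (w := v) hinf) (not_le.mpr hv1)
  obtain ⟨B, hB⟩ := ((tendsto_rpow_atTop (sub_pos.mpr hvw)).eventually_ge_atTop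
    (((2 : ℝ) ^ n) ^ w)).exists_forall_of_atTop
  refine (hfin.union (finite_naiveHeight_le n B)).subset ?_
  rintro A ⟨h1, h2, h3, h4, h5⟩
  by_cases hA : naiveHeight A ≤ B
  · exact Or.inr ⟨h3.le, hA⟩
  refine Or.inl ⟨h1, h2, h3, h4, h5.trans ?_⟩
  have hH := one_le_naiveHeight h2.ne_zero
  have hM := one_le_intMahler h2.ne_zero
  have h6 := hB _ (not_le.mp hA).le
  have h7 : naiveHeight A ^ w ≤ ((2 : ℝ) ^ n) ^ w * intMahler A ^ w := by
    rw [← Real.mul_rpow (by positivity) (by linarith)]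
    exact Real.rpow_le_rpow (by linarith) (naiveHeight_le_mahler h3.le) hw0
  have h8 : naiveHeight A ^ v ≤ intMahler A ^ w := by
    have hc : 0 < ((2 : ℝ) ^ n) ^ w := by positivity
    refine le_of_mul_le_mul_left ?_ hc
    calc ((2 : ℝ) ^ n) ^ w * naiveHeight A ^ v ≤ naiveHeight A ^ (w - v) * naiveHeight A ^ v := by
          gcongr
      _ = naiveHeight A ^ w := by rw [← Real.rpow_add (by linarith)]; ring_nf
      _ ≤ _ := h7
  rw [Real.rpow_neg (by linarith), Real.rpow_neg (by linarith)]
  exact inv_anti₀ (by positivity) h8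

/-- Both sides of the inequality are multiplicative, so in any factorisation at least one factor
inherits it. With the naive height a constant would be lost at each splitting. -/
theorem exists_irreducible_factor_small {ξ w : ℝ} {R : ℤ[X]} (hR : R.Monic) (h1 : R ≠ 1)
    (h : |aeval ξ R| ≤ intMahler R ^ (-w)) :
    ∃ A : ℤ[X], Irreducible A ∧ A.Monic ∧ A ∣ R ∧ |aeval ξ A| ≤ intMahler A ^ (-w) := by
  induction hd : R.natDegree using Nat.strong_induction_on generalizing R with
  | _ d ih =>
    by_cases hirr : Irreducible R
    · exact ⟨R, hirr, hR, dvd_rfl, h⟩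
    rw [hR.irreducible_iff_natDegree] at hirr
    push Not at hirr
    obtain ⟨f, g, hf, hg, rfl, hf0, hg0⟩ := hirr h1
    have hdeg := hf.natDegree_mul hg
    have hMf := one_le_intMahler hf.ne_zero
    have hMg := one_le_intMahler hg.ne_zero
    rw [map_mul, abs_mul, intMahler_mul, Real.mul_rpow (by linarith) (by linarith)] at h
    have hor : |aeval ξ f| ≤ intMahler f ^ (-w) ∨ |aeval ξ g| ≤ intMahler g ^ (-w) := by
      by_contra hcon
      push Not at hcon
      have := mul_lt_mul'' hcon.1 hcon.2 (by positivity) (by positivity)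
      linarith
    rcases hor with hs | hs
    · obtain ⟨A, hA1, hA2, hA3, hA4⟩ := ih f.natDegree (by omega) hf
        (by rintro rfl; simp at hf0) hs rfl
      exact ⟨A, hA1, hA2, hA3.mul_right _, hA4⟩
    · obtain ⟨A, hA1, hA2, hA3, hA4⟩ := ih g.natDegree (by omega) hg
        (by rintro rfl; simp at hg0) hs rfl
      exact ⟨A, hA1, hA2, hA3.mul_left _, hA4⟩

/-! ### Divisor bound and prime counting -/

/-- Argue prime by prime. If `p ≥ 2 ^ (1 / ε)` then `p ^ ε ≥ 2`, and `a + 1 ≤ 2 ^ a` needs no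
constant. Each of the fewer than `N` smaller primes costs a factor `K = 1 + 1 / (ε log 2)`. -/
theorem exists_card_divisors_le_rpow {ε : ℝ} (hε : 0 < ε) :
    ∃ K : ℝ, 1 ≤ K ∧ ∀ n : ℕ, n ≠ 0 → (n.divisors.card : ℝ) ≤ K * (n : ℝ) ^ ε := by
  obtain ⟨N, hN⟩ := exists_nat_ge ((2 : ℝ) ^ (1 / ε))
  set x := ε * Real.log 2 with hx
  have hx0 : 0 < x := mul_pos hε (Real.log_pos (by norm_num))
  set K : ℝ := 1 + 1 / x
  have hK : 1 ≤ K := by simp only [K, le_add_iff_nonneg_right]; positivity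
  refine ⟨K ^ N, one_le_pow₀ hK, fun n hn ↦ ?_⟩
  have key : ∀ p ∈ n.primeFactors, ((n.factorization p + 1 : ℕ) : ℝ) ≤
      (if p < N then K else 1) * ((p : ℝ) ^ n.factorization p) ^ ε := by
    intro p hp
    have hp2 : (2 : ℝ) ≤ p := by exact_mod_cast (Nat.prime_of_mem_primeFactors hp).two_le
    set a := n.factorization p
    have e1 : ((p : ℝ) ^ a) ^ ε = ((p : ℝ) ^ ε) ^ a := by
      rw [← Real.rpow_natCast, ← Real.rpow_natCast, ← Real.rpow_mul (by positivity),
        ← Real.rpow_mul (by positivity), mul_comm]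
    split_ifs with h
    · have h2 : 1 + a * x ≤ ((p : ℝ) ^ a) ^ ε := by
        calc 1 + a * x ≤ Real.exp (a * x) := by linarith [Real.add_one_le_exp (a * x)]
          _ = ((2 : ℝ) ^ ε) ^ a := by
            rw [Real.rpow_def_of_pos (by norm_num), ← Real.exp_nat_mul, hx]
            ring_nf
          _ ≤ ((p : ℝ) ^ ε) ^ a := by gcongr
          _ = _ := e1.symm
      calc ((a + 1 : ℕ) : ℝ) ≤ K * (1 + a * x) := by
            have : K * (1 + a * x) = 1 + a * x + 1 / x + a := by
              simp only [K]; field_simp; ring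
            rw [this]
            push_cast
            have : 0 ≤ a * x + 1 / x := by positivity
            linarith
        _ ≤ _ := by gcongr
    · have h3 : (2 : ℝ) ≤ (p : ℝ) ^ ε := by
        have : (2 : ℝ) = ((2 : ℝ) ^ (1 / ε)) ^ ε := by
          rw [← Real.rpow_mul (by norm_num), one_div_mul_cancel hε.ne', Real.rpow_one]
        rw [this]
        refine Real.rpow_le_rpow (by positivity) (hN.trans ?_) hε.le
        exact_mod_cast not_lt.mp h
      rw [one_mul, e1]
      calc ((a + 1 : ℕ) : ℝ) ≤ (2 : ℝ) ^ a := by exact_mod_cast Nat.lt_two_pow_self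
        _ ≤ _ := by gcongr
  rw [Nat.card_divisors hn, Nat.cast_prod]
  refine (Finset.prod_le_prod (fun _ _ ↦ by positivity) key).trans ?_
  rw [Finset.prod_mul_distrib]
  have h1 : ∏ p ∈ n.primeFactors, (((p : ℝ) ^ n.factorization p) ^ ε) = (n : ℝ) ^ ε := by
    rw [Real.finsetProd_rpow _ _ (fun _ _ ↦ by positivity)]
    congr 1
    conv_rhs => rw [← Nat.prod_factorization_pow_eq_self hn]
    simp [Finsupp.prod]
  rw [h1]
  refine mul_le_mul_of_nonneg_right ?_ (by positivity)
  rw [← Finset.prod_filter, Finset.prod_const]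
  refine pow_le_pow_right₀ hK ?_
  calc _ ≤ (Finset.range N).card :=
        Finset.card_le_card fun p hp ↦ by simpa using (Finset.mem_filter.mp hp).2
    _ = N := Finset.card_range N

theorem eventually_rpow_half_le_primeCounting :
    ∀ᶠ x : ℝ in atTop, x ^ (1 / 2 : ℝ) ≤ Nat.primeCounting ⌊x⌋₊ := by
  have h := (isLittleO_log_rpow_atTop (show (0 : ℝ) < 1 / 2 by norm_num)).bound
    (show (0 : ℝ) < 1 / 8 by norm_num)
  filter_upwards [h, eventually_ge_atTop 100] with x hx hx1
  refine le_trans ?_ (Chebyshev.pi_ge' (show (1 : ℝ) < x by linarith))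
  have hlog : 0 < Real.log x := Real.log_pos (by linarith)
  rw [Real.norm_of_nonneg hlog.le, Real.norm_of_nonneg (by positivity)] at hx
  rw [le_div_iff₀ hlog]
  have hs : x ^ (1 / 2 : ℝ) * x ^ (1 / 2 : ℝ) = x := by
    rw [← Real.rpow_add (by linarith)]; norm_num
  have hs1 : 1 ≤ x ^ (1 / 2 : ℝ) := Real.one_le_rpow (by linarith) (by norm_num)
  have h2 : Real.log (x + 2) ≤ 2 * Real.log x := by
    rw [← Real.log_rpow (by linarith) 2]
    refine Real.log_le_log (by linarith) ?_
    norm_num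
    nlinarith
  have h3 := Real.log_two_gt_d9
  nlinarith

/-! ### Reducible members of the pencil F + p P -/

/-- The polynomials `B₀ + y B₁` which divide `F + y P` are pairwise coprime divisors of
`B₁ F - B₀ P`. -/
theorem card_dvd_pencil_le {F P B₀ B₁ : ℚ[X]} {n b : ℕ} (hF : F.natDegree = n)
    (hP : P.natDegree ≤ n) (hFP : IsCoprime F P) (hB₀ : B₀.Monic) (hb : B₀.natDegree = b)
    (hb0 : 0 < b) (hbn : b < n) (hB₁ : B₁.natDegree < b) (s : Finset ℚ)
    (hs : ∀ y ∈ s, B₀ + C y * B₁ ∣ F + C y * P) : s.card ≤ 2 * n := by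
  have hdeg : ∀ y : ℚ, (C y * B₁).degree < B₀.degree := by
    intro y
    refine degree_lt_degree ((natDegree_C_mul_le _ _).trans_lt ?_)
    rwa [hb]
  have hnat : ∀ y : ℚ, (B₀ + C y * B₁).natDegree = b := fun y ↦ by
    rw [natDegree_add_eq_left_of_degree_lt (hdeg y), hb]
  -- Otherwise `F`, being coprime to `P`, would divide the nonzero `B₀` of smaller degree.
  have hG : B₁ * F - B₀ * P ≠ 0 := by
    intro h
    have h1 : F ∣ B₀ * P := ⟨B₁, by rw [← sub_eq_zero.mp h, mul_comm]⟩
    have h2 := natDegree_le_of_dvd (hFP.dvd_of_dvd_mul_right h1) hB₀.ne_zero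
    omega
  have hdvd : ∏ y ∈ s, (B₀ + C y * B₁) ∣ B₁ * F - B₀ * P := by
    refine Finset.prod_dvd_of_coprime ?_ ?_
    · intro y hy z hz hyz
      have hyz' : IsUnit (C (y - z)) := isUnit_C.mpr (sub_ne_zero.mpr hyz).isUnit
      refine isCoprime_of_dvd _ _ ?_ ?_
      · intro h
        have := hnat y
        rw [show B₀ + C y * B₁ = 0 from h.1, natDegree_zero] at this
        omega
      · intro z' hz' hz0 hzy hzz
        have hy1 : z' ∣ F + C y * P := hzy.trans (hs y hy)
        have hz1 : z' ∣ F + C z * P := hzz.trans (hs z hz)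
        have h1 : z' ∣ C (y - z) * P := by
          have := dvd_sub hy1 hz1
          rwa [show F + C y * P - (F + C z * P) = C (y - z) * P by rw [C_sub]; ring] at this
        have h2 : z' ∣ P := (hyz'.dvd_mul_left).mp h1
        have h3 : z' ∣ F := (dvd_add_left (h2.mul_left _)).mp hy1
        exact hz' (hFP.isUnit_of_dvd' h3 h2)
    · intro y hy
      have h1 : B₁ * F - B₀ * P = B₁ * (F + C y * P) - (B₀ + C y * B₁) * P := by ring
      rw [h1]
      exact dvd_sub ((hs y hy).mul_left _) (dvd_mul_right _ _)
  have h1 := natDegree_le_of_dvd hdvd hG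
  rw [natDegree_prod _ _ (fun y _ h ↦ by have := hnat y; rw [h] at this; simp at this; omega),
    Finset.sum_congr rfl (fun y _ ↦ hnat y)] at h1
  have h2 : (B₁ * F - B₀ * P).natDegree ≤ b + n := by
    refine (natDegree_sub_le _ _).trans (max_le ?_ ?_)
    · exact natDegree_mul_le.trans (by omega)
    · exact natDegree_mul_le.trans (by omega)
  -- Degrees give `s.card * b ≤ b + n`, and `1 ≤ b < n` turns this into `s.card ≤ 2 * n`.
  rw [Finset.sum_const, smul_eq_mul] at h1
  nlinarith

theorem dvd_prime_mul_cases {p : ℕ} (hp : p.Prime) {a c : ℤ} (h : a ∣ p * c) :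
    a ∣ c ∨ ∃ a', a = p * a' ∧ a' ∣ c := by
  by_cases hpa : (p : ℤ) ∣ a
  · obtain ⟨a', rfl⟩ := hpa
    exact Or.inr ⟨a', rfl, Int.dvd_of_mul_dvd_mul_left (by exact_mod_cast hp.ne_zero) h⟩
  · refine Or.inl (IsCoprime.dvd_of_dvd_mul_left ?_ h)
    exact ((Nat.prime_iff_prime_int.mp hp).coprime_iff_not_dvd.mpr hpa).symm

/-- Signed divisors of an integer. -/
def signedDivisors (c : ℤ) : Finset ℤ :=
  c.natAbs.divisors.image (fun d : ℕ ↦ (d : ℤ)) ∪ c.natAbs.divisors.image (fun d : ℕ ↦ -(d : ℤ))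

theorem mem_signedDivisors {a c : ℤ} (hc : c ≠ 0) (h : a ∣ c) : a ∈ signedDivisors c := by
  have h1 : a.natAbs ∈ c.natAbs.divisors :=
    Nat.mem_divisors.mpr ⟨Int.natAbs_dvd_natAbs.mpr h, by simpa using hc⟩
  rw [signedDivisors, Finset.mem_union, Finset.mem_image, Finset.mem_image]
  rcases Int.natAbs_eq a with h2 | h2
  · exact Or.inl ⟨_, h1, h2.symm⟩
  · exact Or.inr ⟨_, h1, h2.symm⟩

theorem card_signedDivisors_le (c : ℤ) :
    (signedDivisors c).card ≤ 2 * c.natAbs.divisors.card := by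
  refine (Finset.card_union_le _ _).trans ?_
  rw [two_mul]
  exact add_le_add Finset.card_image_le Finset.card_image_le

theorem monic_eq_prod_add_interpolate {B : ℚ[X]} (hB : B.Monic) (t : Finset ℚ)
    (hb : B.natDegree = t.card) :
    B = ∏ x ∈ t, (X - C x) + Lagrange.interpolate t id (fun x ↦ B.eval x) := by
  have hprod : (∏ x ∈ t, (X - C x)).Monic := monic_prod_of_monic _ _ fun x _ ↦ monic_X_sub_C x
  have h1 : B - ∏ x ∈ t, (X - C x) = Lagrange.interpolate t id (fun x ↦ B.eval x) := by
    refine Lagrange.eq_interpolate_of_eval_eq _ Function.injective_id.injOn ?_ ?_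
    · refine (degree_sub_lt_left ?_ hB.ne_zero ?_).trans_eq ?_
      · rw [degree_eq_natDegree hB.ne_zero, degree_prod, hb]
        simp
      · rw [hB.leadingCoeff, hprod.leadingCoeff]
      · rw [degree_eq_natDegree hB.ne_zero, hb]
    · intro x hx
      simp [eval_prod, Finset.prod_eq_zero hx]
  rw [← h1]
  ring

/-- If the monic polynomial `F` has the `b` integer roots `t`, then few of the polynomials
`F + p P` with `p` prime have a monic factor of degree `b`. -/
theorem card_primes_with_factor_le {F P : ℤ[X]} {n b : ℕ} (hF : F.Monic)
    (hFn : F.natDegree = n) (hP : P.natDegree ≤ n)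
    (hFP : IsCoprime (F.map (Int.castRingHom ℚ)) (P.map (Int.castRingHom ℚ)))
    (hb0 : 0 < b) (hbn : b < n) (t : Finset ℤ) (ht : t.card = b) (htF : ∀ x ∈ t, F.eval x = 0)
    (s : Finset ℕ) (hsp : ∀ p ∈ s, p.Prime)
    (hs : ∀ p ∈ s, ∃ B : ℤ[X], B.Monic ∧ B.natDegree = b ∧ B ∣ F + C (p : ℤ) * P) :
    s.card ≤ 2 * n * ∏ x ∈ t, (4 * (P.eval x).natAbs.divisors.card) := by
  classical
  have hP0 : ∀ x ∈ t, P.eval x ≠ 0 := by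
    intro x hx h0
    obtain ⟨u, v, huv⟩ := hFP
    have := congrArg (eval (x : ℚ)) huv
    simp [eval_intCast_map, htF x hx, h0] at this
  choose! B hBm hBd hBdvd using hs
  -- As `F` vanishes at `x`, the value `B(x)` divides `p P(x)`: it is `d` or `p d` with `d ∣ P(x)`.
  -- The divisor and the Boolean flag range over a set independent of `p`.
  have hkey : ∀ p ∈ s, ∀ x ∈ t, ∃ k : ℤ × Bool, k.1 ∈ signedDivisors (P.eval x) ∧
      (B p).eval x = if k.2 then (p : ℤ) * k.1 else k.1 := by
    intro p hp x hx
    have h1 : (B p).eval x ∣ (p : ℤ) * P.eval x := by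
      have := eval_dvd (x := x) (hBdvd p hp)
      simpa [htF x hx] using this
    rcases dvd_prime_mul_cases (hsp p hp) h1 with h2 | ⟨a, h2, h3⟩
    · exact ⟨(_, false), mem_signedDivisors (hP0 x hx) h2, by simp⟩
    · exact ⟨(a, true), mem_signedDivisors (hP0 x hx) h3, by simpa using h2⟩
  choose! k hk1 hk2 using hkey
  let T : Finset (∀ x ∈ t, ℤ × Bool) :=
    t.pi fun x ↦ signedDivisors (P.eval x) ×ˢ (Finset.univ : Finset Bool)
  let f : ℕ → ∀ x ∈ t, ℤ × Bool := fun p x _ ↦ k p x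
  have hmaps : ∀ p ∈ s, f p ∈ T := by
    intro p hp
    simp only [T, Finset.mem_pi, Finset.mem_product, Finset.mem_univ, and_true]
    exact fun x hx ↦ hk1 p hp x hx
  have hfib : ∀ c ∈ T, (s.filter fun p ↦ f p = c).card ≤ 2 * n := by
    intro c _
    rcases (s.filter fun p ↦ f p = c).eq_empty_or_nonempty with h0 | ⟨p₀, hp₀⟩
    · simp [h0]
    let t' : Finset ℚ := t.map ⟨fun x : ℤ ↦ (x : ℚ), Int.cast_injective⟩
    have ht' : t'.card = b := by simp [t', ht]
    -- Fix the divisors and flags. Values without the factor `p` go to `v₀`, the others to `v₁`, so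
    -- interpolation writes every `B p` as `B₀ + p B₁` with `B₀`, `B₁` independent of `p`. The floor
    -- merely recovers an integer node from its rational image.
    let v₀ : ℚ → ℚ := fun x ↦ if (k p₀ ⌊x⌋).2 then 0 else ((k p₀ ⌊x⌋).1 : ℚ)
    let v₁ : ℚ → ℚ := fun x ↦ if (k p₀ ⌊x⌋).2 then ((k p₀ ⌊x⌋).1 : ℚ) else 0
    have hint : ∀ v : ℚ → ℚ, (Lagrange.interpolate t' id v).degree < b := fun v ↦ by
      rw [← ht']
      exact Lagrange.degree_interpolate_lt _ Function.injective_id.injOn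
    have hprod : (∏ x ∈ t', (X - C x) : ℚ[X]).Monic := monic_prod_of_monic _ _ fun x _ ↦ monic_X_sub_C x
    have hprodd : (∏ x ∈ t', (X - C x) : ℚ[X]).degree = (b : WithBot ℕ) := by rw [degree_prod]; simp [ht']
    have hcard : (s.filter fun p ↦ f p = c).card =
        ((s.filter fun p ↦ f p = c).image (fun p : ℕ ↦ (p : ℚ))).card :=
      (Finset.card_image_of_injective _ Nat.cast_injective).symm
    rw [hcard]
    refine card_dvd_pencil_le (F := F.map (Int.castRingHom ℚ)) (P := P.map (Int.castRingHom ℚ))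
      (B₀ := ∏ x ∈ t', (X - C x) + Lagrange.interpolate t' id v₀)
      (B₁ := Lagrange.interpolate t' id v₁) (b := b) ?_ ?_ hFP ?_ ?_ hb0 hbn ?_ _ ?_
    · rw [hF.natDegree_map, hFn]
    · exact natDegree_map_le.trans hP
    · exact hprod.add_of_left (by rw [hprodd]; exact hint _)
    · rw [natDegree_add_eq_left_of_degree_lt (by rw [hprodd]; exact hint _)]
      exact natDegree_eq_of_degree_eq_some hprodd
    · by_cases h0 : Lagrange.interpolate t' id v₁ = 0
      · simpa [h0] using hb0
      · exact (natDegree_lt_iff_degree_lt h0).mpr (hint _)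
    · intro y hy
      obtain ⟨p, hp, rfl⟩ := Finset.mem_image.mp hy
      rw [Finset.mem_filter] at hp hp₀
      have hkp : ∀ x ∈ t, k p x = k p₀ x := fun x hx ↦ by
        have := congrFun (congrFun (hp.2.trans hp₀.2.symm) x) hx
        exact this
      have hBp : (B p).map (Int.castRingHom ℚ) =
          ∏ x ∈ t', (X - C x) + Lagrange.interpolate t' id v₀ +
            C (p : ℚ) * Lagrange.interpolate t' id v₁ := by
        rw [monic_eq_prod_add_interpolate ((hBm p hp.1).map (Int.castRingHom ℚ)) t'
          (by rw [(hBm p hp.1).natDegree_map, hBd p hp.1, ht']), ← smul_eq_C_mul, ← map_smul,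
          add_assoc, ← map_add]
        congr 1
        refine Lagrange.interpolate_eq_of_values_eq_on _ _ fun x hx ↦ ?_
        obtain ⟨z, hz, rfl⟩ := Finset.mem_map.mp hx
        simp only [Function.Embedding.coeFn_mk, Pi.add_apply, Pi.smul_apply, smul_eq_mul, v₀, v₁,
          Int.floor_intCast]
        rw [eval_intCast_map, Int.cast_id, hk2 p hp.1 z hz, hkp z hz]
        split_ifs <;> simp
      have hmap := Polynomial.map_dvd (Int.castRingHom ℚ) (hBdvd p hp.1)
      rw [hBp] at hmap
      simpa using hmap
  refine (Finset.card_le_mul_card_image_of_maps_to hmaps (2 * n) hfib).trans ?_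
  refine Nat.mul_le_mul_left _ ?_
  rw [Finset.card_pi]
  refine Finset.prod_le_prod' fun x _ ↦ ?_
  rw [Finset.card_product, Finset.card_univ, Fintype.card_bool]
  have := card_signedDivisors_le (P.eval x)
  omega

theorem isCoprime_map_prod_mul {Q P : ℤ[X]} (hQ : Irreducible Q) (hQm : Q.Monic)
    (hQP : ¬ Q ∣ P) (t : Finset ℤ) (ht : ∀ x ∈ t, P.eval x ≠ 0) :
    IsCoprime (((∏ x ∈ t, (X - C x)) * Q).map (Int.castRingHom ℚ))
      (P.map (Int.castRingHom ℚ)) := by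
  rw [Polynomial.map_mul, Polynomial.map_prod]
  refine IsCoprime.mul_left (IsCoprime.prod_left fun x hx ↦ ?_) ?_
  · rw [Polynomial.map_sub, map_X, map_C]
    refine (irreducible_X_sub_C _).coprime_iff_not_dvd.mpr fun h ↦ ?_
    rw [dvd_iff_isRoot, IsRoot.def] at h
    refine ht x hx ?_
    have h2 := eval_intCast_map (Int.castRingHom ℚ) P x
    simp only [eq_intCast, Int.cast_id] at h2 h
    rw [h] at h2
    exact_mod_cast h2.symm
  · refine ((IsPrimitive.Int.irreducible_iff_irreducible_map_cast hQm.isPrimitive).mp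
      hQ).coprime_iff_not_dvd.mpr fun h ↦ hQP ?_
    exact (map_dvd_map _ (RingHom.injective_int _) hQm).mp h

/-- A polynomial dividing two members of the pencil divides both `F` and `P`, hence is constant; so
each element of `𝒜` spoils at most one prime. A factor of degree at least `m` is replaced by its
cofactor, of degree `b` between `1` and `n - m`, which is determined by its values at `b` of the
points of `t`. -/
theorem card_reducible_primes_le {F P : ℤ[X]} {n m : ℕ} (hF : F.Monic)
    (hFn : F.natDegree = n) (hP : P.natDegree ≤ n)
    (hFP : IsCoprime (F.map (Int.castRingHom ℚ)) (P.map (Int.castRingHom ℚ)))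
    (hm : 1 ≤ m) (t : Finset ℤ) (ht : t.card = n - m) (htF : ∀ x ∈ t, F.eval x = 0)
    (htP : ∀ x ∈ t, P.eval x ≠ 0) (hPn : P.natDegree < n)
    (𝒜 : Finset ℤ[X]) (s : Finset ℕ) (hsp : ∀ p ∈ s, p.Prime)
    (hs : ∀ p ∈ s, ∃ A : ℤ[X], A.Monic ∧ A ∣ F + C (p : ℤ) * P ∧ 0 < A.natDegree ∧
      A.natDegree < n ∧ (A ∈ 𝒜 ∨ m ≤ A.natDegree)) :
    s.card ≤ 𝒜.card + n * (2 * n * ∏ x ∈ t, (4 * (P.eval x).natAbs.divisors.card)) := by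
  classical
  have hdegC : ∀ p : ℕ, (C (p : ℤ) * P).natDegree < F.natDegree := fun p ↦
    (natDegree_C_mul_le _ _).trans_lt (by omega)
  set s₁ := s.filter fun p : ℕ ↦ ∃ A ∈ 𝒜, A.Monic ∧ 0 < A.natDegree ∧ A ∣ F + C (p : ℤ) * P
  set s₂ : ℕ → Finset ℕ := fun b ↦ s.filter fun p : ℕ ↦
    ∃ B : ℤ[X], B.Monic ∧ B.natDegree = b ∧ B ∣ F + C (p : ℤ) * P
  have hsub : s ⊆ s₁ ∪ (Finset.Icc 1 (n - m)).biUnion s₂ := by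
    intro p hp
    obtain ⟨A, hA1, hA2, hA3, hA4, hA5⟩ := hs p hp
    rw [Finset.mem_union]
    rcases hA5 with h | h
    · exact Or.inl (Finset.mem_filter.mpr ⟨hp, A, h, hA1, hA3, hA2⟩)
    · right
      obtain ⟨B, hB⟩ := hA2
      have hRm : (F + C (p : ℤ) * P).Monic := hF.add_of_left (degree_lt_degree (hdegC p))
      have hRd : (F + C (p : ℤ) * P).natDegree = n := by
        rw [natDegree_add_eq_left_of_natDegree_lt (hdegC p), hFn]
      have hBm : B.Monic := hA1.of_mul_monic_left (hB ▸ hRm)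
      have hd := hA1.natDegree_mul hBm
      rw [← hB, hRd] at hd
      refine Finset.mem_biUnion.mpr ⟨B.natDegree, Finset.mem_Icc.mpr (by omega), ?_⟩
      exact Finset.mem_filter.mpr ⟨hp, B, hBm, rfl, ⟨A, by rw [hB, mul_comm]⟩⟩
  have h₁ : s₁.card ≤ 𝒜.card := by
    have hch : ∀ p ∈ s₁, ∃ A ∈ 𝒜, A.Monic ∧ 0 < A.natDegree ∧ A ∣ F + C (p : ℤ) * P :=
      fun p hp ↦ (Finset.mem_filter.mp hp).2
    choose! A hA1 hA2 hA3 hA4 using hch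
    refine Finset.card_le_card_of_injOn A (fun p hp ↦ hA1 p hp) ?_
    intro p hp q hq hpq
    by_contra hne
    have hp4 := hA4 p hp
    have hq4 := hA4 q hq
    rw [← hpq] at hq4
    have hp5 := Polynomial.map_dvd (Int.castRingHom ℚ) hp4
    have hq5 := Polynomial.map_dvd (Int.castRingHom ℚ) hq4
    simp only [Polynomial.map_add, Polynomial.map_mul, map_C] at hp5 hq5
    have hu : IsUnit (C ((Int.castRingHom ℚ) (p : ℤ) - (Int.castRingHom ℚ) (q : ℤ))) := by
      refine isUnit_C.mpr (IsUnit.mk0 _ (sub_ne_zero.mpr ?_))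
      simpa using hne
    have h6 : (A p).map (Int.castRingHom ℚ) ∣
        C ((Int.castRingHom ℚ) (p : ℤ) - (Int.castRingHom ℚ) (q : ℤ)) *
          P.map (Int.castRingHom ℚ) := by
      have := dvd_sub hp5 hq5
      rw [C_sub]
      convert this using 1
      ring
    have h7 := hu.dvd_mul_left.mp h6
    have h8 := (dvd_add_left (h7.mul_left _)).mp hp5
    have h9 := natDegree_eq_zero_of_isUnit (hFP.isUnit_of_dvd' h8 h7)
    rw [(hA2 p hp).natDegree_map] at h9
    have := hA3 p hp
    omega
  have h1le : ∀ x ∈ t, 1 ≤ 4 * (P.eval x).natAbs.divisors.card := by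
    intro x hx
    have : 0 < (P.eval x).natAbs.divisors.card :=
      Finset.card_pos.mpr ⟨1, by simpa using htP x hx⟩
    omega
  have h₂ : ∀ b ∈ Finset.Icc 1 (n - m), (s₂ b).card ≤
      2 * n * ∏ x ∈ t, (4 * (P.eval x).natAbs.divisors.card) := by
    intro b hb
    rw [Finset.mem_Icc] at hb
    obtain ⟨t', ht', hcard⟩ := Finset.exists_subset_card_eq (show b ≤ t.card by omega)
    refine (card_primes_with_factor_le hF hFn hP hFP (by omega) (by omega) t' hcard
      (fun x hx ↦ htF x (ht' hx)) (s₂ b) (fun p hp ↦ hsp p (Finset.mem_filter.mp hp).1)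
      (fun p hp ↦ (Finset.mem_filter.mp hp).2)).trans ?_
    exact Nat.mul_le_mul_left _ (Finset.prod_le_prod_of_subset_of_one_le' ht'
      fun x hx _ ↦ h1le x hx)
  calc s.card ≤ s₁.card + ((Finset.Icc 1 (n - m)).biUnion s₂).card :=
        (Finset.card_le_card hsub).trans (Finset.card_union_le _ _)
    _ ≤ 𝒜.card + (Finset.Icc 1 (n - m)).card *
          (2 * n * ∏ x ∈ t, (4 * (P.eval x).natAbs.divisors.card)) :=
        add_le_add h₁ (Finset.card_biUnion_le_card_mul _ _ _ h₂)
    _ ≤ _ := by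
        gcongr
        simp

theorem exists_two_irreducible {F P : ℤ[X]} {n m : ℕ} {ξ u : ℝ} (hF : F.Monic)
    (hFn : F.natDegree = n) (hPn : P.natDegree < n)
    (hFP : IsCoprime (F.map (Int.castRingHom ℚ)) (P.map (Int.castRingHom ℚ)))
    (hm : 1 ≤ m) (t : Finset ℤ) (ht : t.card = n - m) (htF : ∀ x ∈ t, F.eval x = 0)
    (htP : ∀ x ∈ t, P.eval x ≠ 0) (𝒜 : Finset ℤ[X])
    (h𝒜 : ∀ A : ℤ[X], Irreducible A → A.Monic → A.natDegree < m →
      |aeval ξ A| ≤ intMahler A ^ (-u) → A ∈ 𝒜) (Z : ℕ)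
    (hsmall : ∀ p : ℕ, p.Prime → p ≤ Z →
      |aeval ξ (F + C (p : ℤ) * P)| ≤ intMahler (F + C (p : ℤ) * P) ^ (-u))
    (hcount : 𝒜.card + n * (2 * n * ∏ x ∈ t, (4 * (P.eval x).natAbs.divisors.card)) + 2 ≤
      Nat.primeCounting Z) :
    ∃ p q : ℕ, p ≤ Z ∧ q ≤ Z ∧ p.Prime ∧ q.Prime ∧ p ≠ q ∧
      Irreducible (F + C (p : ℤ) * P) ∧ Irreducible (F + C (q : ℤ) * P) := by
  classical
  set S := Nat.primesLE Z
  have hS : ∀ p ∈ S, p ≤ Z ∧ p.Prime := fun p hp ↦ by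
    simpa [S, Nat.mem_primesLE] using hp
  have hcard : S.card = Nat.primeCounting Z := by simp [S]
  have hbad := card_reducible_primes_le hF hFn hPn.le hFP hm t ht htF htP hPn 𝒜
    (S.filter fun p : ℕ ↦ ¬ Irreducible (F + C (p : ℤ) * P))
    (fun p hp ↦ (hS p (Finset.mem_filter.mp hp).1).2) (by
      intro p hp
      obtain ⟨hpS, hred⟩ := Finset.mem_filter.mp hp
      have hdeg : (C (p : ℤ) * P).natDegree < F.natDegree :=
        (natDegree_C_mul_le _ _).trans_lt (by omega)
      have hRm : (F + C (p : ℤ) * P).Monic := hF.add_of_left (degree_lt_degree hdeg)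
      have hRd : (F + C (p : ℤ) * P).natDegree = n := by
        rw [natDegree_add_eq_left_of_natDegree_lt hdeg, hFn]
      obtain ⟨A, hA1, hA2, hA3, hA4⟩ := exists_irreducible_factor_small hRm
        (by intro h; rw [h, natDegree_one] at hRd; omega)
        (hsmall p (hS p hpS).2 (hS p hpS).1)
      have hA0 : 0 < A.natDegree := by
        by_contra h0
        have := hA2.natDegree_eq_zero.mp (by omega)
        exact hA1.not_isUnit (this ▸ isUnit_one)
      refine ⟨A, hA2, hA3, hA0, ?_, ?_⟩
      · refine lt_of_le_of_ne (hRd ▸ natDegree_le_of_dvd hA3 hRm.ne_zero) fun h ↦ hred ?_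
        obtain ⟨B, hB⟩ := hA3
        have hBm : B.Monic := hA2.of_mul_monic_left (hB ▸ hRm)
        have hd := hA2.natDegree_mul hBm
        rw [← hB, hRd] at hd
        have := hBm.natDegree_eq_zero.mp (by omega)
        rw [hB, this, mul_one]
        exact hA1
      · by_cases h : A.natDegree < m
        · exact Or.inl (h𝒜 A hA1 hA2 h hA4)
        · exact Or.inr (not_lt.mp h))
  have hsum := Finset.card_filter_add_card_filter_not (s := S)
    (fun p : ℕ ↦ Irreducible (F + C (p : ℤ) * P))
  have hgood : 1 < (S.filter fun p : ℕ ↦ Irreducible (F + C (p : ℤ) * P)).card := by omega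
  obtain ⟨p, hp, q, hq, hpq⟩ := Finset.one_lt_card.mp hgood
  rw [Finset.mem_filter] at hp hq
  exact ⟨p, q, (hS p hp.1).1, (hS q hq.1).1, (hS p hp.1).2, (hS q hq.1).2, hpq, hp.2, hq.2⟩

/-! ### Two irreducible polynomials small at ξ -/

/-- The choice of parameters: primes up to `H ^ ε` must be too small to spoil the size at `ξ`, yet
numerous enough to outnumber the exceptions. -/
theorem exists_rpow_bounds {w₁ u : ℝ} (hu : 0 ≤ u) (huw : u < w₁) {n : ℕ} (hn : 0 < n)
    (K₁ K₂ K₃ K₄ N : ℝ) (hK₃ : 1 ≤ K₃) (hK₄ : 1 ≤ K₄) :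
    ∃ ε : ℝ, 0 < ε ∧ 2 * ε < 1 ∧ ∃ K : ℝ, 1 ≤ K ∧
      (∀ k : ℕ, k ≠ 0 → (k.divisors.card : ℝ) ≤ K * (k : ℝ) ^ (ε / (4 * n))) ∧
      ∀ᶠ H : ℝ in atTop, K₁ ≤ H ^ ε ∧
        K₂ * H ^ (-w₁) + H ^ ε * (H ^ (1 - 2 * ε)) ^ (-w₁) ≤ (K₄ * H) ^ (-u) ∧
        N + n * (2 * n * (4 * (K * (K₃ * H) ^ (ε / (4 * n)))) ^ n) + 2 ≤
          Nat.primeCounting ⌊H ^ ε⌋₊ := by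
  have hw₁ : 0 < w₁ := hu.trans_lt huw
  -- Half of the gap `w₁ - u` pays for the loss in `H ^ ε * (H ^ (1 - 2 * ε)) ^ (-w₁) = H ^ (-w₁ +
  -- η)`, the other half for the constants.
  set η := (w₁ - u) / 2 with hη
  have hη0 : 0 < η := by rw [hη]; linarith
  set ε := η / (1 + 2 * w₁) with hε
  have hε0 : 0 < ε := by positivity
  have hεη : ε * (1 + 2 * w₁) = η := by rw [hε]; field_simp
  have hn' : (0 : ℝ) < n := by exact_mod_cast hn
  -- With this `δ` a product of `n` divisor counts is `O(H ^ (ε / 4))`, against at least `H ^ (ε /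
  -- 2)` primes.
  set δ := ε / (4 * n) with hδ
  have hδ0 : 0 < δ := by positivity
  have hδn : δ * n = ε / 4 := by rw [hδ]; field_simp
  obtain ⟨K, hK1, hK⟩ := exists_card_divisors_le_rpow hδ0
  refine ⟨ε, hε0, by nlinarith, K, hK1, hK, ?_⟩
  set c : ℝ := n * (2 * n * (4 * (K * K₃ ^ δ)) ^ n)
  have hc : 0 ≤ c := by positivity
  filter_upwards [(tendsto_rpow_atTop hε0).eventually_ge_atTop K₁, eventually_ge_atTop 1,
    (tendsto_rpow_atTop hη0).eventually_ge_atTop ((|K₂| + 1) * K₄ ^ u),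
    (tendsto_rpow_atTop (show 0 < ε / 4 by positivity)).eventually_ge_atTop (|N| + 2 + c),
    (tendsto_rpow_atTop hε0).eventually eventually_rpow_half_le_primeCounting]
    with H h1 h2 h3 h4 h5
  have hH : 0 < H := by linarith
  refine ⟨h1, ?_, ?_⟩
  · have e1 : H ^ ε * (H ^ (1 - 2 * ε)) ^ (-w₁) = H ^ (-w₁ + η) := by
      rw [← Real.rpow_mul hH.le, ← Real.rpow_add hH]
      congr 1
      rw [← hεη]; ring
    have e2 : H ^ (-w₁) ≤ H ^ (-w₁ + η) :=
      Real.rpow_le_rpow_of_exponent_le h2 (by linarith)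
    have e3 : H ^ (-w₁ + η) * H ^ η = H ^ (-u) := by
      rw [← Real.rpow_add hH]
      congr 1
      rw [hη]; ring
    have e4 : (K₄ * H) ^ (-u) * K₄ ^ u = H ^ (-u) := by
      rw [Real.mul_rpow (by linarith) hH.le, mul_right_comm, ← Real.rpow_add (by linarith)]
      simp
    have hp : 0 < K₄ ^ u := by positivity
    have hp2 : 0 < H ^ (-w₁ + η) := by positivity
    rw [e1]
    refine le_of_mul_le_mul_right ?_ hp
    rw [e4, ← e3]
    calc (K₂ * H ^ (-w₁) + H ^ (-w₁ + η)) * K₄ ^ u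
        ≤ (|K₂| * H ^ (-w₁ + η) + H ^ (-w₁ + η)) * K₄ ^ u := by
          gcongr
          exact le_abs_self _
      _ = H ^ (-w₁ + η) * ((|K₂| + 1) * K₄ ^ u) := by ring
      _ ≤ _ := by gcongr
  · have e1 : (H ^ ε) ^ (1 / 2 : ℝ) = H ^ (ε / 4) * H ^ (ε / 4) := by
      rw [← Real.rpow_mul hH.le, ← Real.rpow_add hH]
      congr 1; ring
    have e2 : (n : ℝ) * (2 * n * (4 * (K * (K₃ * H) ^ δ)) ^ n) = c * H ^ (ε / 4) := by
      rw [Real.mul_rpow (by linarith) hH.le, ← hδn, Real.rpow_mul_natCast hH.le]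
      simp only [c, mul_pow]
      ring
    rw [e2]
    refine le_trans ?_ h5
    rw [e1]
    have := le_abs_self N
    nlinarith [abs_nonneg N]

/-- Irreducible monic integer polynomials of degree `n` and height comparable to `H` which are
small at `ξ`. -/
def SmallIrreducible (n : ℕ) (ξ w C H : ℝ) (R : ℤ[X]) : Prop :=
  Irreducible R ∧ R.Monic ∧ R.natDegree = n ∧ H ≤ naiveHeight R ∧ naiveHeight R ≤ C * H ∧
    |aeval ξ R| ≤ H ^ (-w)

/-- Finitely many strict inequalities leave a common gap. A single `u < V` then makes the set of
exceptional factors of degree below `m` finite before `H` is chosen. -/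
theorem exists_real_btwn_intExponents {ξ V w : ℝ} (hw : w < V) (k : ℕ)
    (h : ∀ i < k, 1 ≤ i → intExponent i ξ < V) :
    ∃ u : ℝ, w < u ∧ u < V ∧ ∀ i < k, 1 ≤ i → intExponent i ξ < u := by
  induction k with
  | zero =>
    obtain ⟨u, h1, h2⟩ := exists_between hw
    exact ⟨u, h1, h2, by simp⟩
  | succ k ih =>
    obtain ⟨u, h1, h2, h3⟩ := ih fun i hi ↦ h i (by omega)
    by_cases hk : 1 ≤ k
    · obtain ⟨v, hv1, hv2⟩ := EReal.lt_iff_exists_real_btwn.mp (h k (by omega) hk)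
      refine ⟨max u v, lt_max_of_lt_left h1, max_lt h2 (EReal.coe_lt_coe_iff.mp hv2), ?_⟩
      intro i hi hi1
      rcases Nat.lt_succ_iff_lt_or_eq.mp hi with h4 | rfl
      · exact (h3 i h4 hi1).trans_le (EReal.coe_le_coe_iff.mpr (le_max_left _ _))
      · exact hv1.trans_le (EReal.coe_le_coe_iff.mpr (le_max_right _ _))
    · exact ⟨u, h1, h2, fun i hi hi1 ↦ h3 i (by omega) hi1⟩

/-- The nodes come from a fixed set of `2n` integers, of which `P` kills fewer than `n`; this keeps
the height of the product of the `X - x` bounded independently of `P`. -/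
theorem exists_finset_eval_ne_zero {P : ℤ[X]} (hP0 : P ≠ 0) {n k : ℕ} (hP : P.natDegree < n)
    (hk : k ≤ n) : ∃ t : Finset ℤ, t ⊆ (Finset.range (2 * n)).map Nat.castEmbedding ∧
      t.card = k ∧ ∀ x ∈ t, P.eval x ≠ 0 := by
  classical
  set T : Finset ℤ := (Finset.range (2 * n)).map Nat.castEmbedding
  have hT : T.card = 2 * n := by simp [T]
  have h1 : (T.filter fun x ↦ P.eval x = 0).card ≤ P.natDegree := by
    refine le_trans (Finset.card_le_card (t := P.roots.toFinset) fun x hx ↦ ?_)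
      ((Multiset.toFinset_card_le _).trans (card_roots' P))
    simpa [hP0] using (Finset.mem_filter.mp hx).2
  have h2 := Finset.card_filter_add_card_filter_not (s := T) (fun x ↦ P.eval x = 0)
  obtain ⟨t, ht, htc⟩ := Finset.exists_subset_card_eq
    (s := T.filter fun x ↦ ¬ P.eval x = 0) (n := k) (by omega)
  exact ⟨t, ht.trans (Finset.filter_subset _ _), htc, fun x hx ↦ (Finset.mem_filter.mp (ht hx)).2⟩

theorem finite_small_irreducible {ξ u : ℝ} (hξ : Transcendental ℚ ξ) (hu : 0 ≤ u) {m : ℕ}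
    (h : ∀ i < m, 1 ≤ i → intExponent i ξ < u) :
    {A : ℤ[X] | Irreducible A ∧ A.Monic ∧ A.natDegree < m ∧
      |aeval ξ A| ≤ intMahler A ^ (-u)}.Finite := by
  refine (Set.Finite.biUnion (Set.finite_Ico 1 m) fun i hi ↦
    finite_of_intExponent_lt hu (h i hi.2 hi.1)).subset ?_
  rintro A ⟨h1, h2, h3, h4⟩
  have h0 : A.natDegree ≠ 0 := fun h0 ↦
    h1.not_isUnit ((h2.natDegree_eq_zero.mp h0) ▸ isUnit_one)
  simp only [Set.mem_iUnion]
  exact ⟨A.natDegree, ⟨by omega, h3⟩, h1, h2, rfl,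
    abs_pos.mpr (aeval_ne_zero_of_transcendental hξ h2.ne_zero), h4⟩

-- The pencil argument in full, with `F = U Q`. The constant `C` does not depend on `H`, and two
-- polynomials of the same scale are produced because the resultant argument needs a pair.
set_option maxHeartbeats 1000000 in
theorem exists_smallIrreducible_pair {m n : ℕ} (hm : 1 ≤ m) (hmn : m ≤ n) {ξ : ℝ}
    (hξ : Transcendental ℚ ξ) {V : ℝ} (hV : 0 < V) (h₁ : (V : EReal) ≤ intExponent m ξ)
    (h₂ : (V : EReal) ≤ uniformExponent (n - 1) ξ) {w : ℝ} (hw : w < V) :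
    ∃ C : ℝ, 1 ≤ C ∧ ∀ B : ℝ, ∃ H : ℝ, B ≤ H ∧ 1 ≤ H ∧ ∃ R S : ℤ[X], R ≠ S ∧
      SmallIrreducible n ξ w C H R ∧ SmallIrreducible n ξ w C H S := by
  classical
  -- Pass to the least degree whose exponent reaches `V`; only then are the small irreducible
  -- polynomials of degree below `m` finite in number.
  wlog hmin : ∀ i < m, 1 ≤ i → intExponent i ξ < V generalizing m
  · have hex : ∃ k, 1 ≤ k ∧ (V : EReal) ≤ intExponent k ξ := ⟨m, hm, h₁⟩
    refine this (Nat.find_spec hex).1 ((Nat.find_min' hex ⟨hm, h₁⟩).trans hmn)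
      (Nat.find_spec hex).2 fun i hi hi1 ↦ ?_
    by_contra hcon
    exact Nat.find_min hex hi ⟨hi1, not_lt.mp hcon⟩
  obtain ⟨u, hu1, huV, hu2⟩ := exists_real_btwn_intExponents (max_lt hV hw) m hmin
  have hu0 : 0 < u := (le_max_left _ _).trans_lt hu1
  have hwu : w < u := (le_max_right _ _).trans_lt hu1
  obtain ⟨w₁, huw₁, hw₁V⟩ := exists_between huV
  have hn : 0 < n := by omega
  set 𝒜 := (finite_small_irreducible hξ hu0.le hu2).toFinset
  set T : Finset ℤ := (Finset.range (2 * n)).map Nat.castEmbedding with hT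
  obtain ⟨KU, hKU⟩ := (T.powerset.image fun t ↦ naiveHeight (∏ x ∈ t, (X - C x))).exists_le
  have hKU' : ∀ t ⊆ T, naiveHeight (∏ x ∈ t, (X - C x)) ≤ KU := fun t ht ↦
    hKU _ (Finset.mem_image_of_mem _ (Finset.mem_powerset.mpr ht))
  have hKU1 : 1 ≤ KU := (one_le_naiveHeight (by simp)).trans (hKU' ∅ (Finset.empty_subset _))
  set K₁ := heightConst n with hK₁
  have hK₁1 : 1 ≤ K₁ := one_le_heightConst n
  set K₂ : ℝ := (n + 1) * (max 1 |ξ|) ^ n * KU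
  set K₃ : ℝ := (n + 1) * (2 * n) ^ n with hK₃
  have hn1 : (1 : ℝ) ≤ n := by exact_mod_cast hn
  have hK₃1 : 1 ≤ K₃ := by
    have : (1 : ℝ) ≤ (2 * n) ^ n := one_le_pow₀ (by linarith)
    rw [hK₃]; nlinarith
  have hKK : 1 ≤ K₁ * KU := by nlinarith
  set K₄ : ℝ := (n + 1) * (K₁ * KU + 1)
  have hK₄1 : 1 ≤ K₄ := by simp only [K₄]; nlinarith
  obtain ⟨ε, hε0, hε1, K, hK1, hK, hev⟩ :=
    exists_rpow_bounds hu0.le huw₁ hn (2 * K₁) K₂ K₃ K₄ 𝒜.card hK₃1 hK₄1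
  -- At height `H ^ (1 - 2 * ε)` the multiple `p P` still has height at most `H ^ (1 - ε)`,
  -- negligible against `H`.
  have hXtop := (tendsto_rpow_atTop (show 0 < 1 - 2 * ε by linarith)).eventually
    (eventually_of_coe_le_uniformExponent h₂ hw₁V)
  refine ⟨2 * K₁ * (K₁ * KU + 1), by nlinarith, fun B ↦ ?_⟩
  obtain ⟨B₀, hB₀⟩ := ((hev.and hXtop).and
    (eventually_ge_atTop (max 1 (2 * K₁ * max 1 B)))).exists_forall_of_atTop
  obtain ⟨Q, hQirr, hQm, hQd, hQH, hQξ⟩ := exists_of_coe_le_intExponent h₁ hw₁V B₀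
  obtain ⟨⟨⟨hb1, hb2, hb3⟩, P, hPd, hPH, hP0, hPξ⟩, hb4⟩ := hB₀ _ hQH.le
  set H := naiveHeight Q with hH
  have hH1 : 1 ≤ H := (le_max_left _ _).trans hb4
  have hHpos : 0 < H := by linarith
  have hK₁0 : 0 < K₁ := by linarith
  have hHle : ∀ s : ℝ, s ≤ 1 → H ^ s ≤ H := fun s hs ↦ by
    simpa using Real.rpow_le_rpow_of_exponent_le hH1 hs
  have hPne : P ≠ 0 := by rintro rfl; simp at hP0
  have hPn : P.natDegree < n := by omega
  obtain ⟨t, htT, htc, htP⟩ := exists_finset_eval_ne_zero hPne hPn (Nat.sub_le n m)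
  set U : ℤ[X] := ∏ x ∈ t, (X - C x) with hU
  have hUm : U.Monic := monic_prod_of_monic _ _ fun x _ ↦ monic_X_sub_C x
  have hUd : U.natDegree = n - m := by
    rw [hU, natDegree_prod_of_monic _ _ fun x _ ↦ monic_X_sub_C x]
    simp only [natDegree_X_sub_C]
    simp [htc]
  have hFm : (U * Q).Monic := hUm.mul hQm
  have hFd : (U * Q).natDegree = n := by rw [hUm.natDegree_mul hQm, hUd, hQd]; omega
  have hHεpos : 0 < H ^ ε := by positivity
  have hXε : H ^ ε * H ^ (1 - 2 * ε) = H ^ (1 - ε) := by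
    rw [← Real.rpow_add hHpos]; ring_nf
  have hXε' : H ^ (1 - ε) * H ^ ε = H := by
    rw [← Real.rpow_add hHpos]; simp
  have hX1 : H ^ (1 - 2 * ε) ≤ H ^ (1 - ε) :=
    Real.rpow_le_rpow_of_exponent_le hH1 (by linarith)
  have hX2 : 2 * K₁ * H ^ (1 - ε) ≤ H := by
    calc 2 * K₁ * H ^ (1 - ε) ≤ H ^ ε * H ^ (1 - ε) := by gcongr
      _ = H := by rw [mul_comm, hXε']
  -- A multiple of `Q` has height at least `H / K₁`, more than `P` can have.
  have hQP : ¬ Q ∣ P := by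
    intro hdvd
    have h3 := naiveHeight_le_of_dvd hdvd hPne hPn.le
    have h4 : 0 < K₁ * H ^ (1 - ε) := by positivity
    have h5 : K₁ * naiveHeight P ≤ K₁ * H ^ (1 - ε) := by
      gcongr; exact hPH.trans hX1
    linarith
  have hcop := isCoprime_map_prod_mul hQirr hQm hQP t htP
  have hFH1 : naiveHeight (U * Q) ≤ K₁ * KU * H := by
    refine (naiveHeight_mul_le hFm.ne_zero hFd.le).trans ?_
    rw [mul_assoc]
    gcongr
    exact hKU' t htT
  have hFH2 : H ≤ K₁ * naiveHeight (U * Q) :=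
    naiveHeight_le_of_dvd (dvd_mul_left _ _) hFm.ne_zero hFd.le
  have hUξ : |aeval ξ U| ≤ K₂ := by
    refine (abs_aeval_le (n := n) (by omega) ξ).trans ?_
    simp only [K₂]
    gcongr
    exact hKU' t htT
  have hdeg : ∀ p : ℤ, (C p * P).natDegree < (U * Q).natDegree := fun p ↦
    (natDegree_C_mul_le _ _).trans_lt (by omega)
  have hRm : ∀ p : ℤ, (U * Q + C p * P).Monic := fun p ↦
    hFm.add_of_left (degree_lt_degree (hdeg p))
  have hRd : ∀ p : ℤ, (U * Q + C p * P).natDegree = n := fun p ↦ by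
    rw [natDegree_add_eq_left_of_natDegree_lt (hdeg p), hFd]
  have hpP : ∀ p : ℕ, p ≤ ⌊H ^ ε⌋₊ → naiveHeight (C (p : ℤ) * P) ≤ H ^ (1 - ε) := by
    intro p hp
    have hpH : (p : ℝ) ≤ H ^ ε := (Nat.le_floor_iff hHεpos.le).mp hp
    refine (naiveHeight_C_mul_le _ _).trans ?_
    rw [← hXε]
    have := naiveHeight_nonneg P
    simp only [Int.cast_natCast, Nat.abs_cast]
    gcongr
  have hR1 : ∀ p : ℕ, p ≤ ⌊H ^ ε⌋₊ →
      naiveHeight (U * Q + C (p : ℤ) * P) ≤ (K₁ * KU + 1) * H := by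
    intro p hp
    have h3 := naiveHeight_add_le (U * Q) (C (p : ℤ) * P)
    have h4 := hpP p hp
    have h5 := hHle (1 - ε) (by linarith)
    rw [add_mul, one_mul]
    linarith
  have hR2 : ∀ p : ℕ, p ≤ ⌊H ^ ε⌋₊ →
      H / (2 * K₁) ≤ naiveHeight (U * Q + C (p : ℤ) * P) := by
    intro p hp
    have h3 := naiveHeight_add_le (U * Q + C (p : ℤ) * P) (-(C (p : ℤ) * P))
    rw [naiveHeight_neg, add_neg_cancel_right] at h3
    have h4 := hpP p hp
    rw [div_le_iff₀ (by positivity)]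
    have h5 := mul_le_mul_of_nonneg_left (h3.trans (add_le_add_right h4 _)) hK₁0.le
    rw [mul_add] at h5
    linarith
  have hR3 : ∀ p : ℕ, p ≤ ⌊H ^ ε⌋₊ →
      |aeval ξ (U * Q + C (p : ℤ) * P)| ≤ (K₄ * H) ^ (-u) := by
    intro p hp
    have hpH : (p : ℝ) ≤ H ^ ε := (Nat.le_floor_iff hHεpos.le).mp hp
    refine le_trans ?_ hb2
    rw [map_add, map_mul, map_mul]
    refine (abs_add_le _ _).trans (add_le_add ?_ ?_)
    · rw [abs_mul]
      gcongr
    · rw [abs_mul]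
      gcongr
      simpa using hpH
  have hsmall : ∀ p : ℕ, p.Prime → p ≤ ⌊H ^ ε⌋₊ → |aeval ξ (U * Q + C (p : ℤ) * P)| ≤
      intMahler (U * Q + C (p : ℤ) * P) ^ (-u) := by
    intro p _ hp
    refine (hR3 p hp).trans ?_
    refine Real.rpow_le_rpow_of_nonpos (by linarith [one_le_intMahler (hRm p).ne_zero]) ?_
      (by linarith)
    refine (intMahler_le (hRd p).le).trans ?_
    rw [mul_assoc]
    have := hR1 p hp
    gcongr
  have hdiv : ∀ x ∈ t, ((4 * (P.eval x).natAbs.divisors.card : ℕ) : ℝ) ≤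
      4 * (K * (K₃ * H) ^ (ε / (4 * n))) := by
    intro x hx
    obtain ⟨y, hy, rfl⟩ := Finset.mem_map.mp (htT hx)
    have h3 : |aeval (y : ℝ) P| ≤ K₃ * H := by
      refine (abs_aeval_le hPn.le _).trans ?_
      have hy2 : (y : ℝ) ≤ 2 * n := by exact_mod_cast (Finset.mem_range.mp hy).le
      have h4 : naiveHeight P ≤ H := hPH.trans (hHle _ (by linarith))
      have h5 : max 1 |(y : ℝ)| ≤ 2 * n := by
        rw [Nat.abs_cast]
        exact max_le (by linarith) hy2
      rw [hK₃]
      gcongr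
      exact naiveHeight_nonneg P
    have h6 : aeval (y : ℝ) P = ((P.eval (y : ℤ) : ℤ) : ℝ) := by
      rw [aeval_def, eval₂_eq_eval_map, algebraMap_int_eq]
      simp
    have h7 : (((P.eval (y : ℤ)).natAbs : ℕ) : ℝ) ≤ K₃ * H := by
      rw [Nat.cast_natAbs, Int.cast_abs, ← h6]
      exact h3
    have h8 := hK (P.eval (y : ℤ)).natAbs (by simpa using htP _ hx)
    push_cast
    simp only [Nat.castEmbedding_apply]
    refine mul_le_mul_of_nonneg_left (h8.trans ?_) (by norm_num)
    gcongr
  have hcount : 𝒜.card + n * (2 * n * ∏ x ∈ t, (4 * (P.eval x).natAbs.divisors.card)) + 2 ≤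
      Nat.primeCounting ⌊H ^ ε⌋₊ := by
    have hY : 1 ≤ 4 * (K * (K₃ * H) ^ (ε / (4 * n))) := by
      have : 1 ≤ (K₃ * H) ^ (ε / (4 * n)) := Real.one_le_rpow (by nlinarith) (by positivity)
      nlinarith
    have h3 : ((∏ x ∈ t, (4 * (P.eval x).natAbs.divisors.card) : ℕ) : ℝ) ≤
        (4 * (K * (K₃ * H) ^ (ε / (4 * n)))) ^ n := by
      rw [Nat.cast_prod]
      refine (Finset.prod_le_prod (fun _ _ ↦ by positivity) hdiv).trans ?_
      rw [Finset.prod_const]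
      exact pow_le_pow_right₀ hY (by omega)
    have h4 : (𝒜.card : ℝ) + n * (2 * n *
        ((∏ x ∈ t, (4 * (P.eval x).natAbs.divisors.card) : ℕ) : ℝ)) + 2 ≤
        Nat.primeCounting ⌊H ^ ε⌋₊ := by
      refine le_trans ?_ hb3
      gcongr
    exact_mod_cast h4
  obtain ⟨p, q, hpZ, hqZ, -, -, hpq, hpi, hqi⟩ := exists_two_irreducible hFm hFd hPn hcop hm t htc
    (fun x hx ↦ by rw [eval_mul, hU, eval_prod, Finset.prod_eq_zero hx (by simp), zero_mul]) htP 𝒜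
    (fun A h3 h4 h5 h6 ↦ by simpa [𝒜] using ⟨h3, h4, h5, h6⟩) _ hsmall hcount
  -- The scale reported is `H / (2 * K₁)`, a lower bound for the heights of the chosen polynomials.
  have hBH : max 1 B ≤ H / (2 * K₁) := by
    rw [le_div_iff₀ (by positivity)]
    have := (le_max_right _ _).trans hb4
    linarith
  have hH'1 : 1 ≤ H / (2 * K₁) := (le_max_left _ _).trans hBH
  have hfin : ∀ p : ℕ, p ≤ ⌊H ^ ε⌋₊ → |aeval ξ (U * Q + C (p : ℤ) * P)| ≤
      (H / (2 * K₁)) ^ (-w) := by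
    intro p hp
    refine (hR3 p hp).trans ?_
    calc (K₄ * H) ^ (-u) ≤ (H / (2 * K₁)) ^ (-u) := by
          refine Real.rpow_le_rpow_of_nonpos (by linarith) ?_ (by linarith)
          rw [div_le_iff₀ (by positivity)]
          calc H = 1 * H * 1 := by ring
            _ ≤ K₄ * H * (2 * K₁) := by gcongr; linarith
      _ ≤ _ := Real.rpow_le_rpow_of_exponent_le hH'1 (by linarith)
  have hup : ∀ p : ℕ, p ≤ ⌊H ^ ε⌋₊ → naiveHeight (U * Q + C (p : ℤ) * P) ≤
      2 * K₁ * (K₁ * KU + 1) * (H / (2 * K₁)) := by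
    intro p hp
    have : 2 * K₁ * (K₁ * KU + 1) * (H / (2 * K₁)) = (K₁ * KU + 1) * H := by
      field_simp
    rw [this]
    exact hR1 p hp
  refine ⟨H / (2 * K₁), (le_max_right _ _).trans hBH, hH'1, U * Q + C (p : ℤ) * P,
    U * Q + C (q : ℤ) * P, ?_, ⟨hpi, hRm _, hRd _, hR2 p hpZ, hup p hpZ, hfin p hpZ⟩,
    ⟨hqi, hRm _, hRd _, hR2 q hqZ, hup q hqZ, hfin q hqZ⟩⟩
  intro heq
  have h3 := mul_right_cancel₀ hPne (add_left_cancel heq)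
  exact hpq (by exact_mod_cast C_injective h3)

/-! ### Close real roots through the resultant -/

theorem min_sum_le_sum_min {ι : Type*} (s : Finset ι) {x : ι → ℝ} {c : ℝ} (hc : 0 ≤ c)
    (hx : ∀ i ∈ s, 0 ≤ x i) : min c (∑ i ∈ s, x i) ≤ ∑ i ∈ s, min c (x i) := by
  have hnn : ∀ i ∈ s, 0 ≤ min c (x i) := fun i hi ↦ le_min hc (hx i hi)
  by_cases h : ∃ i ∈ s, c ≤ x i
  · obtain ⟨i, hi, hci⟩ := h
    calc min c (∑ i ∈ s, x i) ≤ c := min_le_left _ _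
      _ = min c (x i) := (min_eq_left hci).symm
      _ ≤ _ := Finset.single_le_sum hnn hi
  · push Not at h
    refine (min_le_right _ _).trans_eq (Finset.sum_congr rfl fun i hi ↦ ?_)
    exact (min_eq_right (h i hi).le).symm

/-- By symmetry let the largest `u` be at most the largest `v`. A column with `v j ≥ max u`
contributes all of `∑ u ≥ σ`, so two such columns give `2σ`. If there is only one, the maximum of
`v` is not repeated, so both maxima are at most `D` and each family without its maximum still sums
to at least `σ - D`. Every other column contributes at least `v j + min c (v j)`, where `c` is the
sum of the remaining `u`; together these give `2 (σ - D)` more. -/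
theorem min_le_sum_sum_min {ι κ : Type} [Fintype ι] [Fintype κ] [Nonempty ι] [Nonempty κ]
    {u : ι → ℝ} {v : κ → ℝ} {σ D : ℝ} (hu : ∀ i, 0 ≤ u i) (hv : ∀ j, 0 ≤ v j)
    (hus : σ ≤ ∑ i, u i) (hvs : σ ≤ ∑ j, v j)
    (huD : ∀ i, u i ≤ D ∨ ∃ i', i' ≠ i ∧ u i' = u i)
    (hvD : ∀ j, v j ≤ D ∨ ∃ j', j' ≠ j ∧ v j' = v j) :
    min (2 * σ) (3 * σ - 2 * D) ≤ ∑ j, ∑ i, min (u i) (v j) := by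
  classical
  obtain ⟨i₀, hi₀⟩ := Finite.exists_max u
  obtain ⟨j₀, hj₀⟩ := Finite.exists_max v
  wlog hle : u i₀ ≤ v j₀ generalizing ι κ
  · rw [Finset.sum_comm]
    refine (this hv hu hvs hus hvD huD j₀ hj₀ i₀ hi₀ (not_le.mp hle).le).trans_eq ?_
    exact Finset.sum_congr rfl fun _ _ ↦ Finset.sum_congr rfl fun _ _ ↦ min_comm _ _
  have hcol : ∀ j, 0 ≤ ∑ i, min (u i) (v j) := fun j ↦
    Finset.sum_nonneg fun i _ ↦ le_min (hu i) (hv j)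
  have hbig : ∀ j, u i₀ ≤ v j → ∑ i, min (u i) (v j) = ∑ i, u i := fun j hj ↦
    Finset.sum_congr rfl fun i _ ↦ min_eq_left ((hi₀ i).trans hj)
  by_cases hdup : ∃ j₁, j₁ ≠ j₀ ∧ u i₀ ≤ v j₁
  · obtain ⟨j₁, hne, hj₁⟩ := hdup
    refine (min_le_left _ _).trans ?_
    have h1 : ∑ j ∈ {j₁, j₀}, ∑ i, min (u i) (v j) ≤ ∑ j, ∑ i, min (u i) (v j) :=
      Finset.sum_le_sum_of_subset_of_nonneg (Finset.subset_univ _) fun j _ _ ↦ hcol j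
    rw [Finset.sum_pair hne, hbig _ hj₁, hbig _ hle] at h1
    linarith
  · push Not at hdup
    refine (min_le_right _ _).trans ?_
    have hvj₀ : v j₀ ≤ D := by
      rcases hvD j₀ with h | ⟨j', hne, h⟩
      · exact h
      · exact absurd (h ▸ hdup j' hne) (not_lt.mpr hle)
    have hc : σ - D ≤ ∑ i ∈ Finset.univ.erase i₀, u i := by
      have := Finset.add_sum_erase Finset.univ u (Finset.mem_univ i₀)
      linarith
    have hb : σ - D ≤ ∑ j ∈ Finset.univ.erase j₀, v j := by
      have := Finset.add_sum_erase Finset.univ v (Finset.mem_univ j₀)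
      linarith
    set c := ∑ i ∈ Finset.univ.erase i₀, u i
    have hc0 : 0 ≤ c := Finset.sum_nonneg fun i _ ↦ hu i
    have hj : ∀ j ∈ Finset.univ.erase j₀, v j + min c (v j) ≤ ∑ i, min (u i) (v j) := by
      intro j hj
      have h1 := Finset.add_sum_erase Finset.univ (fun i ↦ min (u i) (v j)) (Finset.mem_univ i₀)
      have h2 := min_sum_le_sum_min (Finset.univ.erase i₀) (hv j) fun i _ ↦ hu i
      have h3 := min_eq_right (hdup j (Finset.ne_of_mem_erase hj)).le
      simp only [h3] at h1
      rw [min_comm] at h2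
      simp_rw [min_comm (v j)] at h2
      linarith
    have h4 := Finset.sum_le_sum hj
    rw [Finset.sum_add_distrib] at h4
    have h5 := min_sum_le_sum_min (Finset.univ.erase j₀) hc0 fun j _ ↦ hv j
    have h6 : σ - D ≤ min c (∑ j ∈ Finset.univ.erase j₀, v j) := le_min hc hb
    have h7 := Finset.add_sum_erase Finset.univ (fun j ↦ ∑ i, min (u i) (v j))
      (Finset.mem_univ j₀)
    simp only [hbig j₀ hle] at h7
    linarith

theorem exists_roots_enum {R : ℤ[X]} (hR : R.Monic) {n : ℕ} (hn : R.natDegree = n) :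
    ∃ r : Fin n → ℂ, (R.map (Int.castRingHom ℂ)).roots = Finset.univ.val.map r := by
  have hs := IsAlgClosed.splits (R.map (Int.castRingHom ℂ))
  have hc : (R.map (Int.castRingHom ℂ)).roots.toList.length = n := by
    rw [Multiset.length_toList, ← hs.natDegree_eq_card_roots, hR.natDegree_map, hn]
  subst hc
  refine ⟨fun i ↦ (R.map (Int.castRingHom ℂ)).roots.toList.get i, ?_⟩
  rw [Fin.univ_val_map, List.ofFn_get, Multiset.coe_toList]

theorem eval_eq_prod_of_roots {R : ℤ[X]} (hR : R.Monic) {n : ℕ} {r : Fin n → ℂ}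
    (hr : (R.map (Int.castRingHom ℂ)).roots = Finset.univ.val.map r) (x : ℝ) :
    |aeval x R| = ∏ i, ‖(x : ℂ) - r i‖ := by
  have hs := IsAlgClosed.splits (R.map (Int.castRingHom ℂ))
  have h1 := hs.eq_prod_roots_of_monic (hR.map _)
  rw [hr, Multiset.map_map] at h1
  have h2 : ((aeval x R : ℝ) : ℂ) = (R.map (Int.castRingHom ℂ)).eval (x : ℂ) := by
    rw [aeval_def, eval_map, ← Complex.ofRealHom_eq_coe, hom_eval₂]
    congr 1
  rw [← Real.norm_eq_abs, ← Complex.norm_real, h2, h1, eval_multiset_prod, Multiset.map_map]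
  change ‖∏ i, _‖ = _
  rw [norm_prod]
  simp

theorem intMahler_eq_prod_of_roots {R : ℤ[X]} (hR : R.Monic) {n : ℕ} {r : Fin n → ℂ}
    (hr : (R.map (Int.castRingHom ℂ)).roots = Finset.univ.val.map r) :
    intMahler R = ∏ i, max 1 ‖r i‖ := by
  rw [intMahler, mapMahlerMeasure, mahlerMeasure_eq_leadingCoeff_mul_prod_roots, hr,
    (hR.map _).leadingCoeff, Multiset.map_map]
  simp [Finset.prod]

/-- The double product is the absolute value of the resultant, a nonzero integer because distinct
monic irreducible polynomials are coprime over `ℚ`. -/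
theorem one_le_prod_prod_norm_sub {R S : ℤ[X]} (hR : R.Monic) (hS : S.Monic)
    (hRirr : Irreducible R) (hSirr : Irreducible S) (hRS : R ≠ S) {n : ℕ} {r s : Fin n → ℂ}
    (hr : (R.map (Int.castRingHom ℂ)).roots = Finset.univ.val.map r)
    (hs : (S.map (Int.castRingHom ℂ)).roots = Finset.univ.val.map s) :
    1 ≤ ∏ j, ∏ i, ‖r i - s j‖ := by
  have hcop : IsCoprime (R.map (Int.castRingHom ℚ)) (S.map (Int.castRingHom ℚ)) := by
    refine ((IsPrimitive.Int.irreducible_iff_irreducible_map_cast hR.isPrimitive).mp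
      hRirr).coprime_iff_not_dvd.mpr fun h ↦ hRS ?_
    have h1 := (map_dvd_map _ (RingHom.injective_int _) hR).mp h
    exact eq_of_monic_of_associated hR hS (hRirr.associated_of_dvd hSirr h1)
  have hne : resultant R S ≠ 0 := by
    intro h0
    have h1 := resultant_ne_zero _ _ hcop
    rw [hR.natDegree_map, hS.natDegree_map, resultant_map_map, h0] at h1
    simp at h1
  have h2 := resultant_eq_prod_roots_sub (R.map (Int.castRingHom ℂ)) (S.map (Int.castRingHom ℂ))
    (hR.map _) (hS.map _) (IsAlgClosed.splits _) (IsAlgClosed.splits _)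
  rw [hR.natDegree_map, hS.natDegree_map, resultant_map_map, hr, hs] at h2
  have h3 : ∏ j, ∏ i, (r i - s j) = ((resultant R S : ℤ) : ℂ) := by
    rw [Finset.prod_comm, ← eq_intCast (Int.castRingHom ℂ), h2]
    change _ = ((Multiset.product _ _).map _).prod
    rw [Multiset.product, Multiset.map_bind, Multiset.prod_bind, Multiset.map_map]
    simp only [Multiset.map_map, Function.comp_def]
    rfl
  calc (1 : ℝ) ≤ |((resultant R S : ℤ) : ℝ)| := by exact_mod_cast Int.one_le_abs hne
    _ = ‖∏ j, ∏ i, (r i - s j)‖ := by rw [h3, Complex.norm_intCast]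
    _ = _ := by simp_rw [norm_prod]

theorem exists_conj_root {R : ℤ[X]} (hR : R.Monic) {n : ℕ} {r : Fin n → ℂ}
    (hr : (R.map (Int.castRingHom ℂ)).roots = Finset.univ.val.map r) (i : Fin n) :
    ∃ i', r i' = (starRingEnd ℂ) (r i) := by
  have h0 : r i ∈ (R.map (Int.castRingHom ℂ)).roots := by
    rw [hr]; exact Multiset.mem_map_of_mem _ (Finset.mem_univ i)
  have h1 : (starRingEnd ℂ) (r i) ∈ (R.map (Int.castRingHom ℂ)).roots := by
    rw [mem_roots (hR.map _).ne_zero, IsRoot.def] at h0 ⊢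
    rw [eval_map] at h0 ⊢
    have h2 := congrArg (starRingEnd ℂ) h0
    rw [hom_eval₂, map_zero] at h2
    rwa [show (starRingEnd ℂ).comp (Int.castRingHom ℂ) = Int.castRingHom ℂ from
      RingHom.ext_int _ _] at h2
  rw [hr, Multiset.mem_map] at h1
  obtain ⟨i', -, h⟩ := h1
  exact ⟨i', h⟩

theorem aeval_eq_zero_of_root {R : ℤ[X]} {x : ℝ} (h : (x : ℂ) ∈ (R.map (Int.castRingHom ℂ)).roots) :
    aeval x R = 0 := by
  have h1 := (mem_roots'.mp h).2
  rw [IsRoot.def, eval_map] at h1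
  have h2 : ((aeval x R : ℝ) : ℂ) = 0 := by
    rw [aeval_def, ← Complex.ofRealHom_eq_coe, hom_eval₂, ← h1]
    congr 1
  exact_mod_cast h2

/-- Comparison of the product of the distances from `x` to the roots with the height. -/
theorem root_distance_bounds {R : ℤ[X]} {n : ℕ} {ξ w C H : ℝ} (hξ : Transcendental ℚ ξ)
    (hC : 1 ≤ C) (hH : 1 ≤ H) (hR : SmallIrreducible n ξ w C H R) {r : Fin n → ℂ}
    (hr : (R.map (Int.castRingHom ℂ)).roots = Finset.univ.val.map r) :
    (∀ i, 0 < ‖(ξ : ℂ) - r i‖) ∧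
    (w + 1) * Real.log H - n * (Real.log 2 + Real.log (1 + |ξ|)) ≤
      ∑ i, max 0 (-Real.log ‖(ξ : ℂ) - r i‖) ∧
    ∑ i, max 0 (Real.log ‖(ξ : ℂ) - r i‖) ≤
      Real.log H + (Real.log ((n + 1) * C) + n * Real.log (1 + |ξ|)) := by
  obtain ⟨-, hm, hd, h1, h2, h3⟩ := hR
  have hval := eval_eq_prod_of_roots hm hr ξ
  have hM := intMahler_eq_prod_of_roots hm hr
  have hne : 0 < |aeval ξ R| := abs_pos.mpr (aeval_ne_zero_of_transcendental hξ hm.ne_zero)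
  have hpos : ∀ i, 0 < ‖(ξ : ℂ) - r i‖ := by
    intro i
    refine lt_of_le_of_ne (norm_nonneg _) fun h ↦ hne.ne' ?_
    rw [hval]
    exact Finset.prod_eq_zero (Finset.mem_univ i) h.symm
  have hx : 1 ≤ 1 + |ξ| := by linarith [abs_nonneg ξ]
  have hHpos : 0 < H := by linarith
  have hlog1 : Real.log (intMahler R) ≤
      n * Real.log (1 + |ξ|) + ∑ i, max 0 (Real.log ‖(ξ : ℂ) - r i‖) := by
    rw [hM, Real.log_prod fun i _ ↦ by positivity]
    have : ∀ i ∈ Finset.univ, Real.log (max 1 ‖r i‖) ≤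
        Real.log (1 + |ξ|) + max 0 (Real.log ‖(ξ : ℂ) - r i‖) := by
      intro i _
      have e1 : max 0 (Real.log ‖(ξ : ℂ) - r i‖) = Real.log (max 1 ‖(ξ : ℂ) - r i‖) := by
        rw [← Real.posLog_eq_log_max_one (norm_nonneg _)]; rfl
      rw [e1, ← Real.log_mul (by positivity) (by positivity)]
      refine Real.log_le_log (by positivity) ?_
      have t1 : ‖r i‖ ≤ ‖(ξ : ℂ)‖ + ‖(ξ : ℂ) - r i‖ := by
        have := norm_sub_le (ξ : ℂ) ((ξ : ℂ) - r i)
        simpa using this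
      rw [Complex.norm_real, Real.norm_eq_abs] at t1
      have t2 := le_max_left 1 ‖(ξ : ℂ) - r i‖
      have t3 := le_max_right 1 ‖(ξ : ℂ) - r i‖
      refine max_le ?_ ?_ <;> nlinarith [abs_nonneg ξ]
    refine (Finset.sum_le_sum this).trans_eq ?_
    rw [Finset.sum_add_distrib]
    simp
  have hlog2 : ∑ i, max 0 (Real.log ‖(ξ : ℂ) - r i‖) ≤
      n * Real.log (1 + |ξ|) + Real.log (intMahler R) := by
    rw [hM, Real.log_prod fun i _ ↦ by positivity]
    have : ∀ i ∈ Finset.univ, max 0 (Real.log ‖(ξ : ℂ) - r i‖) ≤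
        Real.log (1 + |ξ|) + Real.log (max 1 ‖r i‖) := by
      intro i _
      have e1 : max 0 (Real.log ‖(ξ : ℂ) - r i‖) = Real.log (max 1 ‖(ξ : ℂ) - r i‖) := by
        rw [← Real.posLog_eq_log_max_one (norm_nonneg _)]; rfl
      rw [e1, ← Real.log_mul (by positivity) (by positivity)]
      refine Real.log_le_log (by positivity) ?_
      have t1 := norm_sub_le (ξ : ℂ) (r i)
      rw [Complex.norm_real, Real.norm_eq_abs] at t1
      have t2 := le_max_left 1 ‖r i‖
      have t3 := le_max_right 1 ‖r i‖
      refine max_le ?_ ?_ <;> nlinarith [abs_nonneg ξ]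
    refine (Finset.sum_le_sum this).trans_eq ?_
    rw [Finset.sum_add_distrib]
    simp
  have hsplit : ∑ i, max 0 (-Real.log ‖(ξ : ℂ) - r i‖) =
      ∑ i, max 0 (Real.log ‖(ξ : ℂ) - r i‖) - Real.log |aeval ξ R| := by
    rw [hval, Real.log_prod fun i _ ↦ (hpos i).ne', ← Finset.sum_sub_distrib]
    refine Finset.sum_congr rfl fun i _ ↦ ?_
    rcases le_total 0 (Real.log ‖(ξ : ℂ) - r i‖) with h | h
    · rw [max_eq_right h, max_eq_left (by linarith)]; ring
    · rw [max_eq_left h, max_eq_right (by linarith)]; ring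
  have hMH : Real.log H ≤ n * Real.log 2 + Real.log (intMahler R) := by
    rw [← Real.log_pow, ← Real.log_mul (by positivity)
      (by linarith [one_le_intMahler hm.ne_zero])]
    exact Real.log_le_log hHpos (h1.trans (naiveHeight_le_mahler hd.le))
  have hMH2 : Real.log (intMahler R) ≤ Real.log ((n + 1) * C) + Real.log H := by
    rw [← Real.log_mul (by positivity) (by positivity)]
    refine Real.log_le_log (by linarith [one_le_intMahler hm.ne_zero]) ?_
    refine (intMahler_le hd.le).trans ?_
    rw [mul_assoc]
    gcongr
  have hsm : Real.log |aeval ξ R| ≤ -w * Real.log H := by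
    rw [← Real.log_rpow hHpos]
    exact Real.log_le_log hne h3
  refine ⟨hpos, ?_, ?_⟩
  · rw [hsplit]
    linarith
  · linarith

/-- The distance between two points is at most twice the larger of their distances to `x`. Positive
and negative parts of the logarithms are kept apart, as the heights control the former and closeness
to `x` is the latter. -/
theorem log_norm_sub_le {x a b : ℂ} (hab : 0 < ‖a - b‖) (ha : 0 < ‖x - a‖) (hb : 0 < ‖x - b‖) :
    Real.log ‖a - b‖ ≤ Real.log 2 + max 0 (Real.log ‖x - a‖) + max 0 (Real.log ‖x - b‖) -
      min (max 0 (-Real.log ‖x - a‖)) (max 0 (-Real.log ‖x - b‖)) := by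
  wlog h : ‖x - b‖ ≤ ‖x - a‖ generalizing a b
  · have := this (a := b) (b := a) (by rwa [norm_sub_rev]) hb ha (not_le.mp h).le
    rw [norm_sub_rev, min_comm]
    linarith
  have h1 : ‖a - b‖ ≤ 2 * ‖x - a‖ := by
    have := norm_sub_le (x - b) (x - a)
    rw [sub_sub_sub_cancel_left] at this
    linarith
  have h2 := Real.log_le_log hab h1
  rw [Real.log_mul (by norm_num) ha.ne'] at h2
  have h3 := Real.log_le_log hb h
  have h4 : Real.log ‖x - a‖ = max 0 (Real.log ‖x - a‖) - max 0 (-Real.log ‖x - a‖) := by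
    rcases le_total 0 (Real.log ‖x - a‖) with h | h
    · rw [max_eq_right h, max_eq_left (by linarith)]; ring
    · rw [max_eq_left h, max_eq_right (by linarith)]; ring
  have h5 := min_le_left (max 0 (-Real.log ‖x - a‖)) (max 0 (-Real.log ‖x - b‖))
  have h6 := le_max_left 0 (Real.log ‖x - b‖)
  linarith

/-- A nonreal root shares its distance to the real point `ξ` with its conjugate; a real root is far
by assumption. This is the dichotomy required by `min_le_sum_sum_min`. -/
theorem neg_log_dist_le_or_exists {R : ℤ[X]} (hR : R.Monic) {n : ℕ} {ξ δ D : ℝ} (hD : 0 ≤ D)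
    (hδ : Real.exp (-D) = δ) {r : Fin n → ℂ}
    (hr : (R.map (Int.castRingHom ℂ)).roots = Finset.univ.val.map r)
    (hno : ∀ α : ℝ, aeval α R = 0 → δ < |ξ - α|) (i : Fin n) :
    max 0 (-Real.log ‖(ξ : ℂ) - r i‖) ≤ D ∨
      ∃ i', i' ≠ i ∧ max 0 (-Real.log ‖(ξ : ℂ) - r i'‖) = max 0 (-Real.log ‖(ξ : ℂ) - r i‖) := by
  obtain ⟨i', hi'⟩ := exists_conj_root hR hr i
  by_cases h : i' = i
  · left
    rw [h] at hi'
    obtain ⟨α, hα⟩ := Complex.conj_eq_iff_real.mp hi'.symm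
    have h0 : aeval α R = 0 := by
      refine aeval_eq_zero_of_root ?_
      rw [← hα, hr]
      exact Multiset.mem_map_of_mem _ (Finset.mem_univ i)
    have h1 := hno α h0
    rw [hα, ← Complex.ofReal_sub, Complex.norm_real, Real.norm_eq_abs]
    refine max_le hD ?_
    rw [← hδ] at h1
    have := Real.log_le_log (Real.exp_pos _) h1.le
    rw [Real.log_exp] at this
    linarith
  · refine Or.inr ⟨i', h, ?_⟩
    have : ‖(ξ : ℂ) - r i'‖ = ‖(ξ : ℂ) - r i‖ := by
      rw [hi', ← Complex.norm_conj]
      simp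
    rw [this]

/-- Put `L = log H`. Without a close real root, `min_le_sum_sum_min` with `σ = (w + 1) L - c₁` and
`D = d L` bounds the double sum of minima from below, while nonvanishing of the resultant bounds it
by `2 n L + c₃`. The hypotheses on `w` and `d` refute the two alternatives of the minimum
respectively. -/
theorem exists_close_real_root {n : ℕ} (hn : 1 ≤ n) {ξ w d C : ℝ} (hξ : Transcendental ℚ ξ)
    (hC : 1 ≤ C) (hw : (n : ℝ) - 1 < w) (hd0 : 0 ≤ d) (hd : 2 * d < 3 * (w + 1) - 2 * n) :
    ∃ H₀ : ℝ, ∀ H : ℝ, H₀ ≤ H → ∀ R S : ℤ[X], R ≠ S → SmallIrreducible n ξ w C H R →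
      SmallIrreducible n ξ w C H S →
      ∃ α : ℝ, |ξ - α| ≤ H ^ (-d) ∧ (aeval α R = 0 ∨ aeval α S = 0) := by
  set c₁ := n * (Real.log 2 + Real.log (1 + |ξ|)) with hc₁
  set c₂ := Real.log ((n + 1) * C) + n * Real.log (1 + |ξ|)
  set c₃ := n * (n * Real.log 2) + 2 * n * c₂
  -- The smaller excess of the coefficient of `L` in the two alternatives; `H₀` makes `κ * L` beat
  -- all the constants.
  set κ := min (2 * (w + 1) - 2 * n) (3 * (w + 1) - 2 * d - 2 * n) with hκ
  have hκ0 : 0 < κ := lt_min (by linarith) (by linarith)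
  have hc₁0 : 0 ≤ c₁ := by
    have := Real.log_nonneg (show 1 ≤ 1 + |ξ| by linarith [abs_nonneg ξ])
    have := Real.log_pos (show (1 : ℝ) < 2 by norm_num)
    positivity
  refine ⟨max 1 (Real.exp ((3 * c₁ + c₃ + 1) / κ)), fun H hH R S hRS hR hS ↦ ?_⟩
  have hH1 : 1 ≤ H := (le_max_left _ _).trans hH
  have hHpos : 0 < H := by linarith
  by_contra! hcon
  obtain ⟨r, hr⟩ := exists_roots_enum hR.2.1 hR.2.2.1
  obtain ⟨s, hs⟩ := exists_roots_enum hS.2.1 hS.2.2.1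
  obtain ⟨hr0, hr1, hr2⟩ := root_distance_bounds hξ hC hH1 hR hr
  obtain ⟨hs0, hs1, hs2⟩ := root_distance_bounds hξ hC hH1 hS hs
  set L := Real.log H with hL
  have hL0 : 0 ≤ L := Real.log_nonneg hH1
  have hδ : Real.exp (-(d * L)) = H ^ (-d) := by
    rw [Real.rpow_def_of_pos hHpos, hL]; ring_nf
  have hnoR : ∀ α : ℝ, aeval α R = 0 → H ^ (-d) < |ξ - α| := fun α hα ↦ by
    by_contra hle
    exact (hcon α (not_lt.mp hle)).1 hα
  have hnoS : ∀ α : ℝ, aeval α S = 0 → H ^ (-d) < |ξ - α| := fun α hα ↦ by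
    by_contra hle
    exact (hcon α (not_lt.mp hle)).2 hα
  have : Nonempty (Fin n) := ⟨⟨0, hn⟩⟩
  have hcomb := min_le_sum_sum_min (fun i ↦ le_max_left 0 (-Real.log ‖(ξ : ℂ) - r i‖))
    (fun j ↦ le_max_left 0 (-Real.log ‖(ξ : ℂ) - s j‖)) hr1 hs1
    (neg_log_dist_le_or_exists hR.2.1 (by positivity) hδ hr hnoR)
    (neg_log_dist_le_or_exists hS.2.1 (by positivity) hδ hs hnoS)
  have hres := one_le_prod_prod_norm_sub hR.2.1 hS.2.1 hR.1 hS.1 hRS hr hs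
  have hrs : ∀ i j, 0 < ‖r i - s j‖ := by
    intro i j
    refine lt_of_le_of_ne (norm_nonneg _) fun h ↦ ?_
    rw [Finset.prod_eq_zero (Finset.mem_univ j)
      (Finset.prod_eq_zero (Finset.mem_univ i) h.symm)] at hres
    norm_num at hres
  have hlog := Real.log_nonneg hres
  rw [Real.log_prod fun j _ ↦ (Finset.prod_pos fun i _ ↦ hrs i j).ne'] at hlog
  simp_rw [Real.log_prod fun i (_ : i ∈ Finset.univ) ↦ (hrs i _).ne'] at hlog
  have hle := hlog.trans (Finset.sum_le_sum fun j (_ : j ∈ Finset.univ) ↦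
    Finset.sum_le_sum fun i (_ : i ∈ Finset.univ) ↦ log_norm_sub_le (hrs i j) (hr0 i) (hs0 j))
  simp only [Finset.sum_sub_distrib, Finset.sum_add_distrib, Finset.sum_const, Finset.card_univ,
    Fintype.card_fin, nsmul_eq_mul, ← Finset.mul_sum] at hle
  have hnR : (n : ℝ) * ∑ i, max 0 (Real.log ‖(ξ : ℂ) - r i‖) ≤ n * (L + c₂) := by gcongr
  have hnS : (n : ℝ) * ∑ i, max 0 (Real.log ‖(ξ : ℂ) - s i‖) ≤ n * (L + c₂) := by gcongr
  have hLbig : 3 * c₁ + c₃ + 1 ≤ κ * L := by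
    have := Real.log_le_log (Real.exp_pos _) ((le_max_right _ _).trans hH)
    rw [Real.log_exp, div_le_iff₀ hκ0] at this
    linarith
  have hk1 : κ * L ≤ (2 * (w + 1) - 2 * n) * L := by
    gcongr; exact min_le_left _ _
  have hk2 : κ * L ≤ (3 * (w + 1) - 2 * d - 2 * n) * L := by
    gcongr; exact min_le_right _ _
  rcases min_le_iff.mp hcomb with h | h
  · simp only [c₃] at hLbig
    linarith
  · simp only [c₃] at hLbig
    linarith

/-! ### Dirichlet's theorem -/

/-- Dirichlet's theorem by the pigeonhole principle. -/
theorem exists_dirichlet_const (e : ℕ) (ξ : ℝ) : ∃ c : ℝ, 0 < c ∧ ∀ k : ℕ, 1 ≤ k →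
    ∃ P : ℤ[X], P ≠ 0 ∧ P.natDegree ≤ e ∧ naiveHeight P ≤ k ∧ |aeval ξ P| * (k : ℝ) ^ e ≤ c := by
  classical
  set c₀ : ℝ := (e + 1) * (max 1 |ξ|) ^ e with hc₀
  have hc₀0 : 0 < c₀ := by positivity
  set c := c₀ + 1 with hc
  refine ⟨2 * c, by positivity, fun k hk ↦ ?_⟩
  have hk0 : (0 : ℝ) < k := by exact_mod_cast hk
  let φ : (Fin (e + 1) → ℤ) → ℤ[X] := fun a ↦ ofFn (e + 1) a
  have hφd : ∀ a, (φ a).natDegree ≤ e := fun a ↦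
    Nat.lt_succ_iff.mp (ofFn_natDegree_lt (Nat.succ_le_succ (Nat.zero_le e)) a)
  have hφc : ∀ a (b : ℝ), 0 ≤ b → (∀ i, |(a i : ℝ)| ≤ b) → naiveHeight (φ a) ≤ b := by
    intro a b hb h
    refine naiveHeight_le_of_coeff fun i ↦ ?_
    by_cases hi : i < e + 1
    · rw [ofFn_coeff_eq_val_of_lt a hi]; exact h _
    · rw [ofFn_coeff_eq_zero_of_ge a (not_lt.mp hi)]; simpa using hb
  set s : Finset (Fin (e + 1) → ℤ) := Fintype.piFinset fun _ ↦ Finset.Icc 0 (k : ℤ)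
  have hs : ∀ a ∈ s, |aeval ξ (φ a)| < c * k := by
    intro a ha
    have h1 : naiveHeight (φ a) ≤ k := by
      refine hφc a k hk0.le fun i ↦ ?_
      have := Finset.mem_Icc.mp (Fintype.mem_piFinset.mp ha i)
      rw [abs_of_nonneg (by exact_mod_cast this.1)]
      exact_mod_cast this.2
    have h2 := abs_aeval_le (hφd a) ξ
    have h3 : c₀ * naiveHeight (φ a) ≤ c₀ * k := by gcongr
    rw [hc]
    linarith
  let N := k ^ (e + 1)
  have hN : (0 : ℝ) < N := by positivity
  -- The range of values is cut into `k ^ (e + 1)` intervals, fewer than the `(k + 1) ^ (e + 1)`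
  -- coefficient vectors.
  let box : (Fin (e + 1) → ℤ) → ℕ := fun a ↦ ⌊(aeval ξ (φ a) + c * k) / (2 * c * k) * N⌋₊
  have hpos : 0 < 2 * c * k := by positivity
  have hbox0 : ∀ a ∈ s, 0 ≤ (aeval ξ (φ a) + c * k) / (2 * c * k) * N := fun a ha ↦ by
    have := abs_lt.mp (hs a ha)
    have : 0 ≤ aeval ξ (φ a) + c * k := by linarith
    positivity
  have hmaps : ∀ a ∈ s, box a ∈ Finset.range N := by
    intro a ha
    rw [Finset.mem_range, Nat.floor_lt (hbox0 a ha)]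
    have := abs_lt.mp (hs a ha)
    have h1 : (aeval ξ (φ a) + c * k) / (2 * c * k) < 1 := by
      rw [div_lt_one hpos]; linarith
    nlinarith
  have hcard : (Finset.range N).card < s.card := by
    rw [Finset.card_range, Fintype.card_piFinset]
    simp only [Int.card_Icc, Finset.prod_const, Finset.card_univ, Fintype.card_fin, N]
    refine Nat.pow_lt_pow_left (by omega) (by omega)
  obtain ⟨a, ha, b, hb, hab, hboxeq⟩ := Finset.exists_ne_map_eq_of_card_lt_of_maps_to hcard hmaps
  have hsub : φ (a - b) = φ a - φ b := map_sub (ofFn (e + 1)) a b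
  refine ⟨φ (a - b), fun h0 ↦ hab ?_, hφd _, ?_, ?_⟩
  · rw [hsub, sub_eq_zero] at h0
    exact injective_ofFn (e + 1) h0
  · refine hφc _ k hk0.le fun i ↦ ?_
    have h1 := Finset.mem_Icc.mp (Fintype.mem_piFinset.mp ha i)
    have h2 := Finset.mem_Icc.mp (Fintype.mem_piFinset.mp hb i)
    rw [← Int.cast_abs]
    have : |(a - b) i| ≤ k := by
      rw [Pi.sub_apply, abs_le]; constructor <;> linarith
    exact_mod_cast this
  · have h1 := Nat.floor_le (hbox0 a ha)
    have h2 := Nat.lt_floor_add_one ((aeval ξ (φ a) + c * k) / (2 * c * k) * N)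
    have h3 := Nat.floor_le (hbox0 b hb)
    have h4 := Nat.lt_floor_add_one ((aeval ξ (φ b) + c * k) / (2 * c * k) * N)
    have h5 : (⌊(aeval ξ (φ a) + c * k) / (2 * c * k) * N⌋₊ : ℝ) =
        ⌊(aeval ξ (φ b) + c * k) / (2 * c * k) * N⌋₊ := by exact_mod_cast hboxeq
    have h6 : |(aeval ξ (φ a) - aeval ξ (φ b)) / (2 * c * k) * N| ≤ 1 := by
      have : (aeval ξ (φ a) - aeval ξ (φ b)) / (2 * c * k) * N =
        (aeval ξ (φ a) + c * k) / (2 * c * k) * N - (aeval ξ (φ b) + c * k) / (2 * c * k) * N := by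
        ring
      rw [this, abs_le]
      constructor <;> linarith
    rw [abs_mul, abs_div, abs_of_pos hpos, abs_of_pos hN, div_mul_eq_mul_div,
      div_le_one hpos] at h6
    rw [hsub, map_sub]
    have h7 : (N : ℝ) = (k : ℝ) ^ e * k := by simp only [N]; push_cast; ring
    rw [h7] at h6
    refine le_of_mul_le_mul_right ?_ hk0
    linarith

theorem coe_le_uniformExponent (e : ℕ) {ξ : ℝ} (hξ : Transcendental ℚ ξ) :
    ((e : ℝ) : EReal) ≤ uniformExponent e ξ := by
  obtain ⟨c, hc0, hc⟩ := exists_dirichlet_const e ξ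
  refine coe_le_supExponent_of_forall_lt fun w hw ↦ ?_
  filter_upwards [eventually_ge_atTop 2, (tendsto_rpow_atTop
    (sub_pos.mpr hw)).eventually_ge_atTop (c * 2 ^ e)] with X hX hX2
  have hX0 : 0 < X := by linarith
  obtain ⟨P, hP0, hPd, hPH, hPξ⟩ := hc ⌊X⌋₊ (Nat.le_floor (by push_cast; linarith))
  refine ⟨P, hPd, hPH.trans (Nat.floor_le hX0.le),
    abs_pos.mpr (aeval_ne_zero_of_transcendental hξ hP0), ?_⟩
  have h1 : X / 2 ≤ ⌊X⌋₊ := by linarith [Nat.lt_floor_add_one X]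
  have h2 : |aeval ξ P| * (X / 2) ^ e ≤ c := le_trans (by gcongr) hPξ
  rw [div_pow, mul_div_assoc', div_le_iff₀ (by positivity)] at h2
  rw [Real.rpow_neg hX0.le, ← one_div, le_div_iff₀ (by positivity)]
  have h3 : 0 < X ^ ((e : ℝ) - w) := by positivity
  refine le_of_mul_le_mul_right ?_ h3
  rw [mul_assoc, ← Real.rpow_add hX0, one_mul]
  simp only [add_sub_cancel, Real.rpow_natCast]
  linarith

/-! ### Minimal polynomials of degree at most two -/

/-- `A` minimises `|P(ξ)|` among the nonzero integer polynomials of degree at most `e` and height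
at most `k`. -/
def IsMinimalPoly (e : ℕ) (ξ : ℝ) (k : ℕ) (A : ℤ[X]) : Prop :=
  A ≠ 0 ∧ A.natDegree ≤ e ∧ naiveHeight A ≤ k ∧
    ∀ B : ℤ[X], B ≠ 0 → B.natDegree ≤ e → naiveHeight B ≤ k → |aeval ξ A| ≤ |aeval ξ B|

theorem exists_isMinimalPoly (e : ℕ) (ξ : ℝ) {k : ℕ} (hk : 1 ≤ k) :
    ∃ A, IsMinimalPoly e ξ k A := by
  have hfin : {P : ℤ[X] | P ≠ 0 ∧ P.natDegree ≤ e ∧ naiveHeight P ≤ k}.Finite :=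
    (finite_naiveHeight_le e k).subset fun P hP ↦ hP.2
  have h1 : naiveHeight (1 : ℤ[X]) ≤ k := by
    have hk' : (1 : ℝ) ≤ k := by exact_mod_cast hk
    refine naiveHeight_le_of_coeff fun i ↦ ?_
    rw [coeff_one]
    split_ifs
    · simpa using hk'
    · simp
  obtain ⟨A, hA, hmin⟩ := Set.exists_min_image _ (fun P : ℤ[X] ↦ |aeval ξ P|) hfin
    ⟨1, one_ne_zero, by simp, h1⟩
  exact ⟨A, hA.1, hA.2.1, hA.2.2, fun B h1 h2 h3 ↦ hmin B ⟨h1, h2, h3⟩⟩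

/-- `A` and `B` are consecutive minimal polynomials. -/
def IsMinimalPair (e : ℕ) (ξ : ℝ) (k : ℕ) (A B : ℤ[X]) : Prop :=
  IsMinimalPoly e ξ k A ∧ IsMinimalPoly e ξ (k + 1) B ∧ |aeval ξ B| < |aeval ξ A|

theorem IsMinimalPoly.exists_next {e : ℕ} (he : 1 ≤ e) {ξ : ℝ} (hξ : Transcendental ℚ ξ)
    {k : ℕ} {A : ℤ[X]} (hA : IsMinimalPoly e ξ k A) :
    ∃ l, k ≤ l ∧ ∃ B, IsMinimalPair e ξ l A B := by
  classical
  have hA0 : 0 < |aeval ξ A| := abs_pos.mpr (aeval_ne_zero_of_transcendental hξ hA.1)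
  have hex : ∃ l : ℕ, ∃ B : ℤ[X], B ≠ 0 ∧ B.natDegree ≤ e ∧ naiveHeight B ≤ l ∧
      |aeval ξ B| < |aeval ξ A| := by
    obtain ⟨c, hc0, hc⟩ := exists_dirichlet_const e ξ
    obtain ⟨l, hl⟩ := exists_nat_gt (c / |aeval ξ A|)
    have hl1 : (1 : ℝ) ≤ (l + 1 : ℕ) := by push_cast; linarith [(Nat.cast_nonneg l : (0 : ℝ) ≤ l)]
    obtain ⟨B, hB0, hBd, hBH, hBξ⟩ := hc (l + 1) (by omega)
    refine ⟨l + 1, B, hB0, hBd, hBH, ?_⟩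
    by_contra hle
    rw [div_lt_iff₀ hA0] at hl
    have h1 : ((l + 1 : ℕ) : ℝ) ≤ ((l + 1 : ℕ) : ℝ) ^ e := le_self_pow₀ hl1 (by omega)
    have h2 : |aeval ξ A| * ((l + 1 : ℕ) : ℝ) ≤ |aeval ξ B| * ((l + 1 : ℕ) : ℝ) ^ e := by
      have := not_lt.mp hle
      gcongr
    push_cast at h2 hBξ
    nlinarith
  obtain ⟨B₀, hB₀0, hB₀d, hB₀H, hB₀ξ⟩ := Nat.find_spec hex
  set l := Nat.find hex
  have hkl : k < l := by
    by_contra hle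
    have h1 : (l : ℝ) ≤ k := by exact_mod_cast not_lt.mp hle
    exact absurd (hA.2.2.2 B₀ hB₀0 hB₀d (hB₀H.trans h1)) (not_le.mpr hB₀ξ)
  obtain ⟨B, hB⟩ := exists_isMinimalPoly e ξ (show 1 ≤ l by omega)
  have hl : l - 1 + 1 = l := by omega
  -- Here `l` is the first height bound admitting a better polynomial, so `A` is still minimal at `l
  -- - 1`.
  refine ⟨l - 1, by omega, B, ⟨hA.1, hA.2.1, hA.2.2.1.trans ?_, fun D h1 h2 h3 ↦ ?_⟩, ?_, ?_⟩
  · exact_mod_cast (by omega : k ≤ l - 1)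
  · by_contra hlt
    exact Nat.find_min hex (show l - 1 < l by omega) ⟨D, h1, h2, h3, not_le.mp hlt⟩
  · rw [hl]; exact hB
  · exact (hB.2.2.2 B₀ hB₀0 hB₀d hB₀H).trans_lt hB₀ξ

theorem one_le_of_linear_det_ne_zero {P Q : ℤ[X]} (hP : P.natDegree ≤ 1) (hQ : Q.natDegree ≤ 1)
    (h : P.coeff 1 * Q.coeff 0 - P.coeff 0 * Q.coeff 1 ≠ 0) (ξ : ℝ) :
    1 ≤ naiveHeight P * |aeval ξ Q| + naiveHeight Q * |aeval ξ P| := by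
  have hP' : aeval ξ P = P.coeff 0 + P.coeff 1 * ξ := by
    rw [aeval_eq_sum_range' (Nat.lt_succ_of_le hP)]; simp [Finset.sum_range_succ]
  have hQ' : aeval ξ Q = Q.coeff 0 + Q.coeff 1 * ξ := by
    rw [aeval_eq_sum_range' (Nat.lt_succ_of_le hQ)]; simp [Finset.sum_range_succ]
  have h1 : (1 : ℝ) ≤ |((P.coeff 1 * Q.coeff 0 - P.coeff 0 * Q.coeff 1 : ℤ) : ℝ)| := by
    exact_mod_cast Int.one_le_abs h
  have h2 : ((P.coeff 1 * Q.coeff 0 - P.coeff 0 * Q.coeff 1 : ℤ) : ℝ) =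
      P.coeff 1 * aeval ξ Q - Q.coeff 1 * aeval ξ P := by
    rw [hP', hQ']; push_cast; ring
  rw [h2] at h1
  refine (h1.trans (abs_sub _ _)).trans ?_
  rw [abs_mul, abs_mul]
  gcongr
  · exact abs_coeff_le_naiveHeight P 1
  · exact abs_coeff_le_naiveHeight Q 1

theorem C_mul_eq_of_linear_det_eq_zero {P Q : ℤ[X]} (hP : P.natDegree ≤ 1) (hQ : Q.natDegree ≤ 1)
    (h : P.coeff 1 * Q.coeff 0 - P.coeff 0 * Q.coeff 1 = 0) :
    C (P.coeff 1) * Q = C (Q.coeff 1) * P := by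
  ext i
  rw [coeff_C_mul, coeff_C_mul]
  rcases i with _ | _ | i
  · linarith
  · ring
  · rw [coeff_eq_zero_of_natDegree_lt (show Q.natDegree < i + 1 + 1 by omega),
      coeff_eq_zero_of_natDegree_lt (show P.natDegree < i + 1 + 1 by omega)]
    simp

theorem naiveHeight_C_mul (k : ℤ) (P : ℤ[X]) :
    naiveHeight (C k * P) = |(k : ℝ)| * naiveHeight P := by
  refine le_antisymm (naiveHeight_C_mul_le k P) ?_
  obtain ⟨i, hi⟩ := P.exists_eq_supNorm
  have := abs_coeff_le_naiveHeight (C k * P) i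
  rw [coeff_C_mul, Int.cast_mul, abs_mul] at this
  rwa [naiveHeight, hi, Int.norm_eq_abs]

theorem linear_det_ne_zero_of_isRelPrime {P Q : ℤ[X]} (hP : P.natDegree ≤ 1)
    (hQ : Q.natDegree ≤ 1) (hPQ : IsRelPrime P Q) (h : ¬ (P.natDegree = 0 ∧ Q.natDegree = 0)) :
    P.coeff 1 * Q.coeff 0 - P.coeff 0 * Q.coeff 1 ≠ 0 := by
  intro h0
  have key : ∀ {P Q : ℤ[X]}, P.natDegree ≤ 1 → IsRelPrime P Q →
      C (P.coeff 1) * Q = C (Q.coeff 1) * P → P.natDegree = 0 := by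
    intro P Q hP hPQ heq
    by_contra hne
    have h1 : P.natDegree = 1 := by omega
    have h2 : P.coeff 1 ≠ 0 := by
      rw [← h1, coeff_natDegree, leadingCoeff_ne_zero]
      rintro rfl
      simp at h1
    have h3 : P ∣ C (P.coeff 1) * Q := ⟨C (Q.coeff 1), by rw [heq, mul_comm]⟩
    have h4 := natDegree_le_of_dvd (hPQ.dvd_of_dvd_mul_right h3) (C_ne_zero.mpr h2)
    rw [natDegree_C] at h4
    omega
  have heq := C_mul_eq_of_linear_det_eq_zero hP hQ h0
  exact h ⟨key hP hPQ heq, key hQ hPQ.symm heq.symm⟩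

theorem abs_aeval_C_mul (ξ : ℝ) (a : ℤ) (P : ℤ[X]) :
    |aeval ξ (C a * P)| = |(a : ℝ)| * |aeval ξ P| := by
  simp [abs_mul]

theorem one_le_abs_intCast {a : ℤ} (h : a ≠ 0) : 1 ≤ |(a : ℝ)| := by
  exact_mod_cast Int.one_le_abs h

/-- If `A` and `B` were integer multiples of the same `L`, then `L` would compete with `A` at height
`k`, giving `|A(ξ)| ≤ |L(ξ)| ≤ |B(ξ)|`. -/
theorem IsMinimalPair.not_both_const {e k : ℕ} {ξ : ℝ} {A B L A' B' : ℤ[X]}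
    (h : IsMinimalPair e ξ k A B) (hA : L * A' = A) (hB : L * B' = B) :
    ¬ (A'.natDegree = 0 ∧ B'.natDegree = 0) := by
  rintro ⟨hA', hB'⟩
  rw [natDegree_eq_zero] at hA' hB'
  obtain ⟨a, rfl⟩ := hA'
  obtain ⟨b, rfl⟩ := hB'
  obtain ⟨⟨hA0, hAd, hAH, hAmin⟩, ⟨hB0, -⟩, hlt⟩ := h
  rw [mul_comm] at hA hB
  subst hA hB
  have ha : a ≠ 0 := by rintro rfl; simp at hA0
  have hb : b ≠ 0 := by rintro rfl; simp at hB0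
  have hL0 : L ≠ 0 := by rintro rfl; simp at hA0
  rw [natDegree_C_mul ha] at hAd
  have h1 : naiveHeight L ≤ k := by
    rw [naiveHeight_C_mul] at hAH
    refine le_trans ?_ hAH
    exact le_mul_of_one_le_left (naiveHeight_nonneg _) (one_le_abs_intCast ha)
  have h2 := hAmin L hL0 hAd h1
  rw [abs_aeval_C_mul ξ b] at hlt
  have h3 : |aeval ξ L| ≤ |(b : ℝ)| * |aeval ξ L| :=
    le_mul_of_one_le_left (abs_nonneg _) (one_le_abs_intCast hb)
  linarith

theorem exists_minimal_bound (e : ℕ) (ξ : ℝ) : ∃ c : ℝ, 0 < c ∧ ∀ k : ℕ, 1 ≤ k → ∀ A,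
    IsMinimalPoly e ξ k A → |aeval ξ A| * (k : ℝ) ^ e ≤ c := by
  obtain ⟨c, hc0, hc⟩ := exists_dirichlet_const e ξ
  refine ⟨c, hc0, fun k hk A hA ↦ ?_⟩
  obtain ⟨P, h1, h2, h3, h4⟩ := hc k hk
  exact (mul_le_mul_of_nonneg_right (hA.2.2.2 P h1 h2 h3) (by positivity)).trans h4

/-- The linear cofactors have nonzero determinant, so `1 ≤ H(A') |B'(ξ)| + H(B') |A'(ξ)|`.
Multiplying by `|L(ξ)| H(L) k` reassembles `A` and `B`, and Dirichlet's bound on `|A(ξ)| k ^ 2`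
finishes. -/
theorem exists_common_factor_bound {ξ : ℝ} : ∃ c : ℝ, 0 < c ∧
    ∀ k : ℕ, 1 ≤ k → ∀ A B L A' B' : ℤ[X], IsMinimalPair 2 ξ k A B → L * A' = A → L * B' = B →
      IsRelPrime A' B' → L.natDegree ≠ 0 →
      L.natDegree = 1 ∧ |aeval ξ L| * naiveHeight L * k ≤ c := by
  obtain ⟨c, hc0, hc⟩ := exists_minimal_bound 2 ξ
  have hK1 := one_le_heightConst 2
  refine ⟨3 * heightConst 2 * c, by positivity, ?_⟩
  intro k hk A B L A' B' hAB hA hB hrel hL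
  have hnc := hAB.not_both_const hA hB
  have hmin := hc k hk A hAB.1
  obtain ⟨⟨hA0, hAd, hAH, -⟩, ⟨hB0, hBd, hBH, -⟩, hlt⟩ := hAB
  rw [← hA] at hA0 hAd
  rw [← hB] at hB0 hBd
  have hdA := natDegree_mul (left_ne_zero_of_mul hA0) (right_ne_zero_of_mul hA0)
  have hdB := natDegree_mul (left_ne_zero_of_mul hB0) (right_ne_zero_of_mul hB0)
  have hA'1 : A'.natDegree ≤ 1 := by omega
  have hB'1 : B'.natDegree ≤ 1 := by omega
  refine ⟨by omega, ?_⟩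
  have hdet := linear_det_ne_zero_of_isRelPrime hA'1 hB'1 hrel hnc
  have h1 := one_le_of_linear_det_ne_zero hA'1 hB'1 hdet ξ
  have h2 := naiveHeight_mul_naiveHeight_le hA0 hAd
  have h3 := naiveHeight_mul_naiveHeight_le hB0 hBd
  rw [hA] at h2
  rw [hB] at h3
  have hAξ : |aeval ξ L| * |aeval ξ A'| = |aeval ξ A| := by rw [← hA, map_mul, abs_mul]
  have hBξ : |aeval ξ L| * |aeval ξ B'| = |aeval ξ B| := by rw [← hB, map_mul, abs_mul]
  have hk1 : (1 : ℝ) ≤ k := by exact_mod_cast hk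
  push_cast at hBH
  have hH := naiveHeight_nonneg L
  have hLk : 0 ≤ |aeval ξ L| * naiveHeight L * k := by positivity
  have h4 : naiveHeight L * naiveHeight A' ≤ heightConst 2 * k := h2.trans (by gcongr)
  have h5 : naiveHeight L * naiveHeight B' ≤ heightConst 2 * (2 * k) := h3.trans (by
    gcongr; linarith)
  calc |aeval ξ L| * naiveHeight L * k
      ≤ |aeval ξ L| * naiveHeight L * k *
        (naiveHeight A' * |aeval ξ B'| + naiveHeight B' * |aeval ξ A'|) :=
        le_mul_of_one_le_right hLk h1
    _ = ((naiveHeight L * naiveHeight A') * (|aeval ξ L| * |aeval ξ B'|) +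
          (naiveHeight L * naiveHeight B') * (|aeval ξ L| * |aeval ξ A'|)) * k := by ring
    _ ≤ ((heightConst 2 * k) * |aeval ξ A| + (heightConst 2 * (2 * k)) * |aeval ξ A|) * k := by
        rw [hAξ, hBξ]
        gcongr
    _ = 3 * heightConst 2 * (|aeval ξ A| * (k : ℝ) ^ 2) := by ring
    _ ≤ _ := by gcongr

theorem exists_height_gt {ξ : ℝ} (hξ : Transcendental ℚ ξ) {c : ℝ} (h : ℝ) :
    ∃ K : ℕ, ∀ k : ℕ, K ≤ k → ∀ L : ℤ[X], L ≠ 0 → L.natDegree ≤ 1 →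
      |aeval ξ L| * naiveHeight L * k ≤ c → h < naiveHeight L := by
  have hfin : {P : ℤ[X] | P ≠ 0 ∧ P.natDegree ≤ 1 ∧ naiveHeight P ≤ h}.Finite :=
    (finite_naiveHeight_le 1 h).subset fun P hP ↦ hP.2
  rcases Set.eq_empty_or_nonempty {P : ℤ[X] | P ≠ 0 ∧ P.natDegree ≤ 1 ∧ naiveHeight P ≤ h}
    with h0 | hne
  · refine ⟨0, fun k _ L hL hLd _ ↦ ?_⟩
    by_contra hle
    exact (h0 ▸ (⟨hL, hLd, not_lt.mp hle⟩ :
      L ∈ {P : ℤ[X] | P ≠ 0 ∧ P.natDegree ≤ 1 ∧ naiveHeight P ≤ h}) : L ∈ (∅ : Set ℤ[X]))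
  obtain ⟨A, hA, hmin⟩ := Set.exists_min_image _ (fun P : ℤ[X] ↦ |aeval ξ P|) hfin hne
  have hA0 : 0 < |aeval ξ A| := abs_pos.mpr (aeval_ne_zero_of_transcendental hξ hA.1)
  obtain ⟨K, hK⟩ := exists_nat_gt (c / |aeval ξ A|)
  refine ⟨K, fun k hk L hL hLd hLc ↦ ?_⟩
  by_contra hle
  have h1 := hmin L ⟨hL, hLd, not_lt.mp hle⟩
  have h2 : (K : ℝ) ≤ k := by exact_mod_cast hk
  rw [div_lt_iff₀ hA0] at hK
  have h3 : |aeval ξ A| * 1 * K ≤ |aeval ξ L| * naiveHeight L * k := by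
    have := one_le_naiveHeight hL
    gcongr
  linarith

theorem aeval_mul_naiveHeight_eq {P Q : ℤ[X]} (hP : P.natDegree = 1) (hQ : Q.natDegree = 1)
    (h : P.coeff 1 * Q.coeff 0 - P.coeff 0 * Q.coeff 1 = 0) (ξ : ℝ) :
    |aeval ξ Q| * naiveHeight P = |aeval ξ P| * naiveHeight Q := by
  have heq := C_mul_eq_of_linear_det_eq_zero hP.le hQ.le h
  have h1 : P.coeff 1 ≠ 0 := by
    rw [← hP, coeff_natDegree, leadingCoeff_ne_zero]
    rintro rfl
    simp at hP
  have h2 : Q.coeff 1 ≠ 0 := by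
    rw [← hQ, coeff_natDegree, leadingCoeff_ne_zero]
    rintro rfl
    simp at hQ
  have h3 := congrArg naiveHeight heq
  have h4 := congrArg (fun R : ℤ[X] ↦ |aeval ξ R|) heq
  simp only [abs_aeval_C_mul] at h4
  rw [naiveHeight_C_mul, naiveHeight_C_mul] at h3
  have hp := one_le_abs_intCast h1
  have hq := one_le_abs_intCast h2
  have h5 : |(P.coeff 1 : ℝ)| * |(Q.coeff 1 : ℝ)| ≠ 0 := by positivity
  refine mul_left_cancel₀ h5 ?_
  calc _ = (|(P.coeff 1 : ℝ)| * |aeval ξ Q|) * (|(Q.coeff 1 : ℝ)| * naiveHeight P) := by ring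
    _ = _ := by rw [h4, ← h3]; ring

/-- For `e = 1` a nonconstant common factor would leave constant cofactors. For `e = 2`, suppose all
late pairs share a linear factor. Factors `L` and `M` from successive pairs both divide the middle
polynomial, and the bounds on `|L(ξ)|` and `|M(ξ)|` force them to be proportional. Hence `|L(ξ)| /
H(L)` never changes, although `|L(ξ)| H(L) k ≤ c` drives it to zero. -/
theorem exists_coprime_minimalPair {e : ℕ} (he : e = 1 ∨ e = 2) {ξ : ℝ}
    (hξ : Transcendental ℚ ξ) (K : ℕ) : ∃ k, K ≤ k ∧ ∃ A B L A' B' : ℤ[X],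
      IsMinimalPair e ξ k A B ∧ L * A' = A ∧ L * B' = B ∧ IsRelPrime A' B' ∧
        L.natDegree = 0 := by
  rcases he with rfl | rfl
  · obtain ⟨A, hA⟩ := exists_isMinimalPoly 1 ξ (show 1 ≤ max K 1 from le_max_right _ _)
    obtain ⟨k, hk, B, hAB⟩ := hA.exists_next le_rfl hξ
    obtain ⟨A', B', L, hrel, hLA, hLB⟩ :=
      UniqueFactorizationMonoid.exists_reduced_factors A hA.1 B
    refine ⟨k, (le_max_left _ _).trans hk, A, B, L, A', B', hAB, hLA, hLB, hrel, ?_⟩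
    have hnc := hAB.not_both_const hLA hLB
    obtain ⟨⟨hA0, hAd, -⟩, ⟨hB0, hBd, -⟩, -⟩ := hAB
    rw [← hLA] at hA0 hAd
    rw [← hLB] at hB0 hBd
    have hdA := natDegree_mul (left_ne_zero_of_mul hA0) (right_ne_zero_of_mul hA0)
    have hdB := natDegree_mul (left_ne_zero_of_mul hB0) (right_ne_zero_of_mul hB0)
    omega
  · by_contra! hcon
    obtain ⟨c, hc0, hc⟩ := exists_common_factor_bound (ξ := ξ)
    set κ := heightConst 2
    have hκ : 1 ≤ κ := one_le_heightConst 2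
    -- Heights above `8 * κ * c` push each of the two determinant terms below `1 / 4`.
    obtain ⟨K₁, hK₁⟩ := exists_height_gt hξ (c := c) (8 * κ * c)
    have hred : ∀ k, max (max K K₁) 1 ≤ k → ∀ A B, IsMinimalPair 2 ξ k A B →
        ∃ L : ℤ[X], L ∣ A ∧ L ∣ B ∧ L.natDegree = 1 ∧ |aeval ξ L| * naiveHeight L * k ≤ c := by
      intro k hk A B hAB
      obtain ⟨A', B', L, hrel, hLA, hLB⟩ :=
        UniqueFactorizationMonoid.exists_reduced_factors A hAB.1.1 B
      have hL := hcon k (by omega) A B L A' B' hAB hLA hLB hrel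
      obtain ⟨h1, h2⟩ := hc k (by omega) A B L A' B' hAB hLA hLB hrel hL
      exact ⟨L, ⟨A', hLA.symm⟩, ⟨B', hLB.symm⟩, h1, h2⟩
    obtain ⟨A₀, hA₀⟩ := exists_isMinimalPoly 2 ξ
      (show 1 ≤ max (max K K₁) 1 from le_max_right _ _)
    obtain ⟨k₀, hk₀, B₀, hAB₀⟩ := hA₀.exists_next (by norm_num) hξ
    obtain ⟨L₀, hLA₀, hLB₀, hL₀d, hL₀c⟩ := hred k₀ hk₀ A₀ B₀ hAB₀
    have hL₀ : L₀ ≠ 0 := by rintro rfl; simp at hL₀d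
    have hind : ∀ j : ℕ, ∃ k, k₀ + j ≤ k ∧ ∃ A B L : ℤ[X], IsMinimalPair 2 ξ k A B ∧ L ∣ A ∧
        L ∣ B ∧ L.natDegree = 1 ∧ |aeval ξ L| * naiveHeight L * k ≤ c ∧
        |aeval ξ L| * naiveHeight L₀ = |aeval ξ L₀| * naiveHeight L := by
      intro j
      induction j with
      | zero => exact ⟨k₀, le_rfl, A₀, B₀, L₀, hAB₀, hLA₀, hLB₀, hL₀d, hL₀c, rfl⟩
      | succ j ih =>
        obtain ⟨k, hk, A, B, L, hAB, hLA, hLB, hLd, hLc, hLρ⟩ := ih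
        obtain ⟨l, hl, D, hBD⟩ := hAB.2.1.exists_next (by norm_num) hξ
        obtain ⟨M, hMB, hMD, hMd, hMc⟩ := hred l (by omega) B D hBD
        refine ⟨l, by omega, B, D, M, hBD, hMB, hMD, hMd, hMc, ?_⟩
        have hL0 : L ≠ 0 := by rintro rfl; simp at hLd
        have hM0 : M ≠ 0 := by rintro rfl; simp at hMd
        have hHL := one_le_naiveHeight hL0
        have hHM := one_le_naiveHeight hM0
        by_cases hdet : L.coeff 1 * M.coeff 0 - L.coeff 0 * M.coeff 1 = 0
        · have h1 := aeval_mul_naiveHeight_eq hLd hMd hdet ξ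
          refine mul_right_cancel₀ (show naiveHeight L ≠ 0 by positivity) ?_
          calc _ = (|aeval ξ M| * naiveHeight L) * naiveHeight L₀ := by ring
            _ = (|aeval ξ L| * naiveHeight L₀) * naiveHeight M := by rw [h1]; ring
            _ = _ := by rw [hLρ]; ring
        · exfalso
          have h1 := one_le_of_linear_det_ne_zero hLd.le hMd.le hdet ξ
          obtain ⟨hB0, hBd, hBH, -⟩ := hAB.2.1
          have hLB' := naiveHeight_le_of_dvd hLB hB0 hBd
          have hMB' := naiveHeight_le_of_dvd hMB hB0 hBd
          have hkl : ((k + 1 : ℕ) : ℝ) ≤ l := by exact_mod_cast hl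
          have hk1 : (1 : ℝ) ≤ k := by exact_mod_cast (by omega : 1 ≤ k)
          have hL8 := hK₁ k (by omega) L hL0 hLd.le hLc
          have hM8 := hK₁ l (by omega) M hM0 hMd.le hMc
          have e1 : naiveHeight L ≤ κ * l := hLB'.trans (by gcongr; linarith)
          have e2 : naiveHeight M ≤ κ * (2 * k) := hMB'.trans (by
            gcongr; push_cast at hBH; linarith)
          have e3 : naiveHeight L * |aeval ξ M| * naiveHeight M ≤ κ * c := by
            calc _ ≤ κ * l * |aeval ξ M| * naiveHeight M := by gcongr
              _ = κ * (|aeval ξ M| * naiveHeight M * l) := by ring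
              _ ≤ _ := by gcongr
          have e4 : naiveHeight M * |aeval ξ L| * naiveHeight L ≤ 2 * κ * c := by
            calc _ ≤ κ * (2 * k) * |aeval ξ L| * naiveHeight L := by gcongr
              _ = 2 * κ * (|aeval ξ L| * naiveHeight L * k) := by ring
              _ ≤ _ := by gcongr
          have hκc : 0 < κ * c := by positivity
          have e5 : naiveHeight L * |aeval ξ M| ≤ 1 / 4 := by
            by_contra hlt
            have := mul_lt_mul'' (not_le.mp hlt) hM8 (by norm_num) (by positivity)
            linarith
          have e6 : naiveHeight M * |aeval ξ L| ≤ 1 / 4 := by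
            by_contra hlt
            have := mul_lt_mul'' (not_le.mp hlt) hL8 (by norm_num) (by positivity)
            linarith
          linarith
    have hpos : 0 < |aeval ξ L₀| := abs_pos.mpr (aeval_ne_zero_of_transcendental hξ hL₀)
    have hH₀ := one_le_naiveHeight hL₀
    obtain ⟨j, hj⟩ := exists_nat_gt (c * naiveHeight L₀ / |aeval ξ L₀|)
    obtain ⟨k, hk, A, B, L, -, -, -, hLd, hLc, hLρ⟩ := hind j
    have hL0 : L ≠ 0 := by rintro rfl; simp at hLd
    have hHL := one_le_naiveHeight hL0
    rw [div_lt_iff₀ hpos] at hj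
    have hjk : (j : ℝ) ≤ k := by exact_mod_cast (by omega : j ≤ k)
    have h1 : |aeval ξ L₀| * (1 * 1) * j ≤ c * naiveHeight L₀ := by
      calc |aeval ξ L₀| * (1 * 1) * j
          ≤ |aeval ξ L₀| * (naiveHeight L * naiveHeight L) * k := by gcongr
        _ = (|aeval ξ L| * naiveHeight L * k) * naiveHeight L₀ := by
            linear_combination (-naiveHeight L * k) * hLρ
        _ ≤ _ := by gcongr
    linarith

/-- Coprimality gives the independence once one of the two polynomials has degree exactly `e`; the
pair is swapped if necessary. -/
theorem exists_independent_pair {e : ℕ} (he : e = 1 ∨ e = 2) {ξ : ℝ}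
    (hξ : Transcendental ℚ ξ) : ∃ c : ℝ, 0 < c ∧ ∀ K : ℕ, ∃ Y : ℕ, K ≤ Y ∧ ∃ A B : ℤ[X],
      A.natDegree = e ∧ B.natDegree ≤ e ∧ naiveHeight A ≤ Y ∧ naiveHeight B ≤ Y ∧
      |aeval ξ A| * (Y : ℝ) ^ e ≤ c ∧ |aeval ξ B| * (Y : ℝ) ^ e ≤ c ∧
      ∀ f g : ℤ[X], f * A + g * B = 0 → g.natDegree < e → g = 0 := by
  obtain ⟨c, hc0, hc⟩ := exists_minimal_bound e ξ
  refine ⟨2 ^ e * c, by positivity, fun K ↦ ?_⟩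
  obtain ⟨N, hN⟩ := exists_nat_gt (8 * c)
  obtain ⟨k, hk, A, B, L, A', B', hAB, hA, hB, hrel, hL⟩ :=
    exists_coprime_minimalPair he hξ (max (max K N) 1)
  have hnc := hAB.not_both_const hA hB
  have hmin := hc k (by omega) A hAB.1
  obtain ⟨⟨hA0, hAd, hAH, -⟩, ⟨hB0, hBd, hBH, -⟩, hlt⟩ := hAB
  have hL0 : L ≠ 0 := by rintro rfl; simp at hA; exact hA0 hA.symm
  have hA'0 : A' ≠ 0 := by rintro rfl; simp at hA; exact hA0 hA.symm
  have hB'0 : B' ≠ 0 := by rintro rfl; simp at hB; exact hB0 hB.symm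
  have hdA : A.natDegree = A'.natDegree := by rw [← hA, natDegree_mul hL0 hA'0, hL, zero_add]
  have hdB : B.natDegree = B'.natDegree := by rw [← hB, natDegree_mul hL0 hB'0, hL, zero_add]
  have hk1 : (1 : ℝ) ≤ k := by exact_mod_cast (by omega : 1 ≤ k)
  have hAH' : naiveHeight A ≤ ((k + 1 : ℕ) : ℝ) := hAH.trans (by push_cast; linarith)
  have hAξ : |aeval ξ A| * ((k + 1 : ℕ) : ℝ) ^ e ≤ 2 ^ e * c := by
    calc |aeval ξ A| * ((k + 1 : ℕ) : ℝ) ^ e ≤ |aeval ξ A| * (2 * k) ^ e := by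
          gcongr; push_cast; linarith
      _ = 2 ^ e * (|aeval ξ A| * (k : ℝ) ^ e) := by rw [mul_pow]; ring
      _ ≤ _ := by gcongr
  have hBξ : |aeval ξ B| * ((k + 1 : ℕ) : ℝ) ^ e ≤ 2 ^ e * c := le_trans (by gcongr) hAξ
  have hindep : ∀ {P Q P' Q' : ℤ[X]}, L * P' = P → L * Q' = Q → IsRelPrime P' Q' →
      P.natDegree = P'.natDegree → P.natDegree = e →
      ∀ f g : ℤ[X], f * P + g * Q = 0 → g.natDegree < e → g = 0 := by
    intro P Q P' Q' hP hQ hr hd he f g hfg hg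
    have h1 : f * P' + g * Q' = 0 := by
      refine mul_left_cancel₀ hL0 ?_
      rw [mul_zero, ← hfg, ← hP, ← hQ]; ring
    have h2 : P' ∣ g * Q' := ⟨-f, by linear_combination h1⟩
    by_contra hg0
    have := natDegree_le_of_dvd (hr.dvd_of_dvd_mul_right h2) hg0
    omega
  by_cases hAe : A.natDegree = e
  · exact ⟨k + 1, by omega, A, B, hAe, hBd, hAH', hBH, hAξ, hBξ, hindep hA hB hrel hdA hAe⟩
  by_cases hBe : B.natDegree = e
  · exact ⟨k + 1, by omega, B, A, hBe, hAd, hBH, hAH', hBξ, hAξ,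
      hindep hB hA hrel.symm hdB hBe⟩
  exfalso
  -- It remains to exclude degrees below `e`. For `e = 2`, two linear polynomials would satisfy `1 ≤
  -- 4 k |A(ξ)|`, against `|A(ξ)| k ^ 2 ≤ c` and `k > 8 c`.
  rcases he with rfl | rfl
  · omega
  have hdet := linear_det_ne_zero_of_isRelPrime (by omega) (by omega) hrel hnc
  have h1 := one_le_of_linear_det_ne_zero (by omega) (by omega) hdet ξ
  obtain ⟨l, rfl⟩ := natDegree_eq_zero.mp hL
  have hl : l ≠ 0 := by rintro rfl; simp at hL0
  have hl1 := one_le_abs_intCast hl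
  have e1 : |aeval ξ A'| ≤ |aeval ξ A| := by
    rw [← hA, abs_aeval_C_mul]
    exact le_mul_of_one_le_left (abs_nonneg _) hl1
  have e2 : |aeval ξ B'| ≤ |aeval ξ A| := by
    refine le_trans ?_ hlt.le
    rw [← hB, abs_aeval_C_mul]
    exact le_mul_of_one_le_left (abs_nonneg _) hl1
  have e3 : naiveHeight A' ≤ 2 * k := by
    have : naiveHeight A' ≤ naiveHeight A := by
      rw [← hA, naiveHeight_C_mul]
      exact le_mul_of_one_le_left (naiveHeight_nonneg _) hl1
    linarith
  have e4 : naiveHeight B' ≤ 2 * k := by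
    have : naiveHeight B' ≤ naiveHeight B := by
      rw [← hB, naiveHeight_C_mul]
      exact le_mul_of_one_le_left (naiveHeight_nonneg _) hl1
    push_cast at hBH
    linarith
  have hNk : (N : ℝ) ≤ k := by exact_mod_cast (by omega : N ≤ k)
  have e5 : 1 ≤ 4 * (|aeval ξ A| * k) := by
    calc 1 ≤ naiveHeight A' * |aeval ξ B'| + naiveHeight B' * |aeval ξ A'| := h1
      _ ≤ 2 * k * |aeval ξ A| + 2 * k * |aeval ξ A| := by gcongr
      _ = _ := by ring
  have e6 : |aeval ξ A| * (k : ℝ) ^ 2 = |aeval ξ A| * k * k := by ring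
  nlinarith

/-! ### Eisenstein polynomials with a root near ξ -/

/-- Otherwise the product of all primes up to `Y ^ η` divides `D`, so `2 ^ π(Y ^ η) ≤ n! Y ^ n`; but
`π(Y ^ η) ≥ Y ^ (η / 2)` outgrows `log Y`. -/
theorem eventually_exists_prime_not_dvd (n : ℕ) {η : ℝ} (hη : 0 < η) :
    ∀ᶠ Y : ℝ in atTop, ∀ D : ℤ, D ≠ 0 → |(D : ℝ)| ≤ n.factorial * Y ^ n →
      ∃ p : ℕ, p.Prime ∧ (p : ℝ) ≤ Y ^ η ∧ ¬ (p : ℤ) ∣ D := by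
  have hη2 : 0 < η / 2 := by positivity
  have hlog2 : 0 < Real.log 2 := Real.log_pos (by norm_num)
  have hlo := (isLittleO_log_rpow_atTop hη2).bound
    (show 0 < Real.log 2 / (2 * (n + 1)) by positivity)
  filter_upwards [hlo, eventually_gt_atTop 1,
    (tendsto_rpow_atTop hη).eventually eventually_rpow_half_le_primeCounting,
    (tendsto_rpow_atTop hη2).eventually_gt_atTop (2 * Real.log n.factorial / Real.log 2)]
    with Y h1 h2 h3 h4 D hD hDY
  by_contra! hcon
  have hY : 0 < Y := by linarith
  have hlogY : 0 < Real.log Y := Real.log_pos h2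
  have hdvd : ∏ p ∈ Nat.primesLE ⌊Y ^ η⌋₊, p ∣ D.natAbs := by
    refine Finset.prod_primes_dvd _ (fun p hp ↦ (Nat.prime_of_mem_primesLE hp).prime) ?_
    intro p hp
    obtain ⟨hp1, hp2⟩ := Nat.mem_primesLE.mp hp
    exact Int.natCast_dvd.mp (hcon p hp2 ((Nat.le_floor_iff (by positivity)).mp hp1))
  have hcard : 2 ^ Nat.primeCounting ⌊Y ^ η⌋₊ ≤ D.natAbs := by
    refine le_trans ?_ (Nat.le_of_dvd (by omega) hdvd)
    rw [← Nat.primesLE_card_eq_primeCounting]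
    exact Finset.pow_card_le_prod _ _ _ fun p hp ↦ (Nat.prime_of_mem_primesLE hp).two_le
  have hcard' : (2 : ℝ) ^ Nat.primeCounting ⌊Y ^ η⌋₊ ≤ n.factorial * Y ^ n := by
    refine le_trans ?_ hDY
    rw [← Int.cast_abs, ← Nat.cast_natAbs]
    exact_mod_cast hcard
  have h5 := Real.log_le_log (by positivity) hcard'
  rw [Real.log_pow, Real.log_mul (by positivity) (by positivity), Real.log_pow] at h5
  rw [Real.norm_of_nonneg hlogY.le, Real.norm_of_nonneg (by positivity), div_mul_eq_mul_div,
    le_div_iff₀ (by positivity)] at h1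
  rw [← Real.rpow_mul hY.le, show η * (1 / 2) = η / 2 by ring] at h3
  rw [div_lt_iff₀ hlog2] at h4
  have h6 : Y ^ (η / 2) * Real.log 2 ≤ Nat.primeCounting ⌊Y ^ η⌋₊ * Real.log 2 := by gcongr
  nlinarith

/-- Rounding in a residue class: an integer combination of the rows of `M` which is congruent to
`t` modulo `q` and close to the real vector `g`. -/
theorem exists_vecMul_congr_near {n : ℕ} (M : Matrix (Fin n) (Fin n) ℤ) {q : ℕ} (hq : 0 < q)
    (hdet : M.det ≠ 0) (hcop : IsCoprime (q : ℤ) M.det) (t : Fin n → ℤ) (g : Fin n → ℝ) :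
    ∃ s : Fin n → ℤ, ∃ ε : Fin n → ℝ, (∀ i, |ε i| ≤ q) ∧ (∀ j, (q : ℤ) ∣ s j - t j) ∧
      ∀ j, (s j : ℝ) = g j + ∑ i, ε i * M i j := by
  obtain ⟨u, v, huv⟩ := hcop
  have hq0 : (0 : ℝ) < q := by exact_mod_cast hq
  -- Since `u q + v det M = 1`, the combination with coefficients `z` equals `v det M • t`,
  -- congruent to `t` modulo `q`. Adding multiples of `q` to `z` preserves this and lets it approach
  -- the real coordinates `θ` of `g`.
  set z : Fin n → ℤ := Matrix.vecMul (v • t) M.adjugate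
  have hz : ∀ j, Matrix.vecMul z M j = v * M.det * t j := by
    intro j
    simp only [z]
    rw [Matrix.vecMul_vecMul, Matrix.adjugate_mul, Matrix.vecMul_smul, Matrix.vecMul_one]
    simp only [Pi.smul_apply, smul_eq_mul]
    ring
  set Mr : Matrix (Fin n) (Fin n) ℝ := M.map (Int.castRingHom ℝ)
  have hMr : IsUnit Mr.det := by
    have : Mr.det = (M.det : ℝ) := (RingHom.map_det (Int.castRingHom ℝ) M).symm
    rw [this]
    exact IsUnit.mk0 _ (by exact_mod_cast hdet)
  set θ : Fin n → ℝ := Matrix.vecMul g Mr⁻¹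
  have hθ : Matrix.vecMul θ Mr = g := by
    simp only [θ]
    rw [Matrix.vecMul_vecMul, Matrix.nonsing_inv_mul _ hMr, Matrix.vecMul_one]
  set r : Fin n → ℤ := fun i ↦ round ((θ i - z i) / q)
  set y : Fin n → ℤ := fun i ↦ z i + q * r i
  refine ⟨Matrix.vecMul y M, fun i ↦ y i - θ i, fun i ↦ ?_, fun j ↦ ?_, fun j ↦ ?_⟩
  · have h1 := abs_sub_round ((θ i - z i) / q)
    have h2 : (y i : ℝ) - θ i = -(q * ((θ i - z i) / q - r i)) := by
      simp only [y]; push_cast; field_simp; ring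
    change |(y i : ℝ) - θ i| ≤ q
    rw [h2, abs_neg, abs_mul, abs_of_pos hq0]
    have h3 : |(θ i - z i) / q - r i| ≤ 1 := by simp only [r]; linarith
    nlinarith
  · have hy : y = z + (q : ℤ) • r := by ext i; simp [y]
    rw [hy, Matrix.add_vecMul, Matrix.smul_vecMul, Pi.add_apply, hz, Pi.smul_apply, smul_eq_mul]
    refine ⟨Matrix.vecMul r M j - u * t j, ?_⟩
    linear_combination (t j) * huv
  · have h1 : g j = ∑ i, θ i * M i j := by
      rw [← hθ]
      simp [Matrix.vecMul, dotProduct, Mr]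
    rw [h1, ← Finset.sum_add_distrib]
    simp only [Matrix.vecMul, dotProduct]
    push_cast
    exact Finset.sum_congr rfl fun i _ ↦ by ring

theorem aeval_ofFn {n : ℕ} (s : Fin n → ℤ) (x : ℝ) :
    aeval x (ofFn n s) = ∑ j : Fin n, (s j : ℝ) * x ^ (j : ℕ) := by
  rw [ofFn_eq_sum_monomial, map_sum]
  simp [aeval_monomial]

theorem aeval_eq_sum_fin {n : ℕ} {P : ℤ[X]} (hP : P.natDegree < n) (x : ℝ) :
    aeval x P = ∑ j : Fin n, (P.coeff j : ℝ) * x ^ (j : ℕ) := by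
  rw [aeval_eq_sum_range' hP, ← Fin.sum_univ_eq_sum_range (fun j ↦ P.coeff j • x ^ j)]
  simp

theorem irreducible_of_eisenstein {R : ℤ[X]} (hR : R.Monic) {p : ℕ} (hp : p.Prime)
    (h0 : 0 < R.natDegree) (hdvd : ∀ j < R.natDegree, (p : ℤ) ∣ R.coeff j)
    (hc : ((p ^ 2 : ℕ) : ℤ) ∣ R.coeff 0 - p) : Irreducible R := by
  have hp' := Nat.prime_iff_prime_int.mp hp
  have hprime : (Ideal.span {(p : ℤ)}).IsPrime :=
    (Ideal.span_singleton_prime hp'.ne_zero).mpr hp'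
  have heis : R.IsEisensteinAt (Ideal.span {(p : ℤ)}) := by
    refine ⟨?_, fun {j} hj ↦ Ideal.mem_span_singleton.mpr (hdvd j hj), ?_⟩
    · rw [hR.leadingCoeff, Ideal.mem_span_singleton]
      exact fun h ↦ hp'.not_isUnit (isUnit_of_dvd_one h)
    · rw [Ideal.span_singleton_pow, Ideal.mem_span_singleton]
      intro h
      push_cast at hc
      have h1 : (p : ℤ) ^ 2 ∣ p := by simpa using dvd_sub h hc
      rw [sq] at h1
      have h2 : (p : ℤ) * p ∣ p * 1 := by simpa using h1
      exact hp'.not_isUnit (isUnit_of_dvd_one (Int.dvd_of_mul_dvd_mul_left hp'.ne_zero h2))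
  exact heis.irreducible hprime hR.isPrimitive h0

/-- The target `T ^ n - ξ ^ n + K (T - ξ)` vanishes at `ξ` and is steep there. Its lower
coefficients are approximated by an integer combination of the `P i` congruent to `(p, 0, …, 0)`
modulo `p ^ 2`, so Eisenstein's criterion applies. The error at `ξ` is a combination of the small
values `P i (ξ)` with coefficients at most `p ^ 2`. -/
theorem exists_eisenstein_near {n : ℕ} (hn : 2 ≤ n) (ξ : ℝ) : ∃ c : ℝ, 1 ≤ c ∧
    ∀ (P : Fin n → ℤ[X]) (Y δ : ℝ) (p : ℕ), 1 ≤ Y → (∀ i, (P i).natDegree < n) →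
      (∀ i, naiveHeight (P i) ≤ Y) → (∀ i, |aeval ξ (P i)| ≤ δ) → p.Prime →
      (Matrix.of fun i j : Fin n ↦ (P i).coeff j).det ≠ 0 →
      ¬ (p : ℤ) ∣ (Matrix.of fun i j : Fin n ↦ (P i).coeff j).det →
      ∃ R : ℤ[X], Irreducible R ∧ R.Monic ∧ R.natDegree = n ∧
        naiveHeight R ≤ c * ((p : ℝ) ^ 2 * Y) ∧ |aeval ξ R| ≤ c * ((p : ℝ) ^ 2 * δ) ∧
        ∀ a b : ℝ, |a - ξ| ≤ 1 → |b - ξ| ≤ 1 → a ≤ b → Y * (b - a) ≤ aeval b R - aeval a R := by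
  set τ : ℝ := |ξ| + 1 with hτ
  have hτ1 : 1 ≤ τ := by rw [hτ]; linarith [abs_nonneg ξ]
  set c₁ : ℝ := n * τ ^ n + n ^ 3 * τ ^ n + 1 with hc₁
  have hc₁0 : 0 < c₁ := by positivity
  have hτn : 1 ≤ τ ^ n := one_le_pow₀ hτ1
  have hn1 : (1 : ℝ) ≤ n := by exact_mod_cast (by omega : 1 ≤ n)
  refine ⟨τ ^ n + c₁ * τ + n, by nlinarith [mul_pos hc₁0 (by linarith : 0 < τ)], ?_⟩
  intro P Y δ p hY hPd hPH hPδ hp hdet hpdet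
  set M : Matrix (Fin n) (Fin n) ℤ := Matrix.of fun i j : Fin n ↦ (P i).coeff j with hM
  have hp1 : (1 : ℝ) ≤ p := by exact_mod_cast hp.one_lt.le
  set q : ℝ := (p : ℝ) ^ 2 with hq
  have hq1 : 1 ≤ q := one_le_pow₀ hp1
  have hqY : 1 ≤ q * Y := by nlinarith
  have hcop : IsCoprime ((p ^ 2 : ℕ) : ℤ) M.det := by
    push_cast
    exact (((Nat.prime_iff_prime_int.mp hp).coprime_iff_not_dvd).mpr hpdet).pow_left
  -- The first term outweighs the slope of `x ^ n` on the interval of radius `1` about `ξ`, the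
  -- second that of the rounding error; the third is the slope `Y` left over.
  set K : ℝ := n * τ ^ n + n ^ 3 * τ ^ n * (q * Y) + Y with hK
  have hK0 : 0 ≤ K := by positivity
  have hKle : K ≤ c₁ * (q * Y) := by
    have h1 : (n : ℝ) * τ ^ n ≤ n * τ ^ n * (q * Y) := le_mul_of_one_le_right (by positivity) hqY
    have h2 : Y ≤ q * Y := le_mul_of_one_le_left (by linarith) hq1
    rw [hK, hc₁, add_mul, add_mul, one_mul]
    linarith
  set g : Fin n → ℝ := fun j ↦
    if (j : ℕ) = 0 then -ξ ^ n - K * ξ else if (j : ℕ) = 1 then K else 0 with hg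
  have hgsum : ∀ x : ℝ, ∑ j : Fin n, g j * x ^ (j : ℕ) = -ξ ^ n + K * (x - ξ) := by
    intro x
    obtain ⟨k, rfl⟩ : ∃ k, n = k + 2 := ⟨n - 2, by omega⟩
    rw [Fin.sum_univ_succ, Fin.sum_univ_succ]
    simp [hg]
    ring
  have hgle : ∀ j, |g j| ≤ τ ^ n + K * τ := by
    intro j
    have h1 : |ξ| ^ n ≤ τ ^ n := by gcongr; linarith
    have h2 : K * |ξ| ≤ K * τ := by gcongr; linarith
    have h3 : K ≤ K * τ := le_mul_of_one_le_right hK0 hτ1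
    simp only [hg]
    split_ifs
    · refine (abs_sub _ _).trans ?_
      rw [abs_neg, abs_pow, abs_mul, abs_of_nonneg hK0]
      linarith
    · rw [abs_of_nonneg hK0]; linarith
    · rw [abs_zero]; positivity
  obtain ⟨s, ε, hε, hs1, hs2⟩ := exists_vecMul_congr_near M (pow_pos hp.pos 2) hdet hcop
    (fun j ↦ if (j : ℕ) = 0 then (p : ℤ) else 0) g
  have hεq : ∀ i, |ε i| ≤ q := fun i ↦ by simpa [hq] using hε i
  have hd : ∀ j, |∑ i, ε i * (M i j : ℝ)| ≤ n * (q * Y) := by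
    intro j
    refine (Finset.abs_sum_le_sum_abs _ _).trans ?_
    have : ∀ i ∈ Finset.univ, |ε i * (M i j : ℝ)| ≤ q * Y := fun i _ ↦ by
      rw [abs_mul]
      exact mul_le_mul (hεq i) ((abs_coeff_le_naiveHeight (P i) j).trans (hPH i)) (abs_nonneg _)
        (by linarith)
    refine (Finset.sum_le_sum this).trans_eq ?_
    simp
  have hRdeg : (ofFn n s).degree < n := ofFn_degree_lt s
  have hRm : (X ^ n + ofFn n s).Monic := monic_X_pow_add hRdeg
  have hRd : (X ^ n + ofFn n s).natDegree = n := natDegree_eq_of_degree_eq_some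
    (by rw [degree_add_eq_left_of_degree_lt (by rwa [degree_X_pow]), degree_X_pow])
  have hRc : ∀ j (hj : j < n), (X ^ n + ofFn n s).coeff j = s ⟨j, hj⟩ := by
    intro j hj
    rw [coeff_add, coeff_X_pow, if_neg (by omega), zero_add, ofFn_coeff_eq_val_of_lt s hj]
  have hRx : ∀ x : ℝ, aeval x (X ^ n + ofFn n s) = x ^ n + (-ξ ^ n + K * (x - ξ)) +
      ∑ j : Fin n, (∑ i, ε i * (M i j : ℝ)) * x ^ (j : ℕ) := by
    intro x
    rw [map_add, aeval_ofFn, map_pow, aeval_X, ← hgsum x, add_assoc, ← Finset.sum_add_distrib]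
    congr 1
    exact Finset.sum_congr rfl fun j _ ↦ by rw [hs2 j]; ring
  refine ⟨X ^ n + ofFn n s, irreducible_of_eisenstein hRm hp (by omega) ?_ ?_, hRm, hRd, ?_, ?_, ?_⟩
  · intro j hj
    rw [hRd] at hj
    rw [hRc j hj]
    have h1 := (Dvd.intro _ (by push_cast; exact (sq (p : ℤ)).symm) :
      (p : ℤ) ∣ ((p ^ 2 : ℕ) : ℤ)).trans (hs1 ⟨j, hj⟩)
    refine (dvd_sub_left ?_).mp h1
    split_ifs
    · exact dvd_rfl
    · exact dvd_zero _
  · rw [hRc 0 (by omega)]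
    simpa using hs1 ⟨0, by omega⟩
  · refine naiveHeight_le_of_coeff fun j ↦ ?_
    have hbound : τ ^ n + K * τ + n * (q * Y) ≤ (τ ^ n + c₁ * τ + n) * (q * Y) := by
      have h1 : τ ^ n ≤ τ ^ n * (q * Y) := le_mul_of_one_le_right (by positivity) hqY
      have h2 : K * τ ≤ c₁ * (q * Y) * τ := by gcongr
      linarith
    refine le_trans ?_ hbound
    rcases lt_trichotomy j n with hj | rfl | hj
    · rw [hRc j hj, hs2]
      exact (abs_add_le _ _).trans (add_le_add (hgle _) (hd _))
    · have : (X ^ j + ofFn j s).coeff j = 1 := by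
        have := hRm.coeff_natDegree
        rwa [hRd] at this
      rw [this]
      have : 0 ≤ K * τ + j * (q * Y) := by positivity
      simp only [Int.cast_one, abs_one]
      linarith
    · rw [coeff_eq_zero_of_natDegree_lt (by omega)]
      simp only [Int.cast_zero, abs_zero]
      positivity
  · rw [hRx, sub_self, mul_zero, add_zero, add_neg_cancel, zero_add]
    have h1 : ∑ j : Fin n, (∑ i, ε i * (M i j : ℝ)) * ξ ^ (j : ℕ) =
        ∑ i, ε i * aeval ξ (P i) := by
      simp_rw [Finset.sum_mul]
      rw [Finset.sum_comm]
      refine Finset.sum_congr rfl fun i _ ↦ ?_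
      rw [aeval_eq_sum_fin (hPd i), Finset.mul_sum]
      exact Finset.sum_congr rfl fun j _ ↦ by rw [hM, Matrix.of_apply]; ring
    rw [h1]
    have hδ0 : 0 ≤ δ := (abs_nonneg _).trans (hPδ ⟨0, by omega⟩)
    calc |∑ i, ε i * aeval ξ (P i)| ≤ ∑ i : Fin n, |ε i * aeval ξ (P i)| :=
          Finset.abs_sum_le_sum_abs _ _
      _ ≤ ∑ _i : Fin n, q * δ := Finset.sum_le_sum fun i _ ↦ by
          rw [abs_mul]
          exact mul_le_mul (hεq i) (hPδ i) (abs_nonneg _) (by linarith)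
      _ = n * (q * δ) := by simp
      _ ≤ _ := by
          gcongr
          have : 0 < c₁ * τ := by positivity
          linarith
  · intro a b ha hb hab
    have habs : ∀ x : ℝ, |x - ξ| ≤ 1 → |x| ≤ τ := fun x hx ↦ by
      have := abs_add_le (x - ξ) ξ
      rw [sub_add_cancel] at this
      rw [hτ]; linarith
    have hpow : ∀ j ≤ n, |b ^ j - a ^ j| ≤ n * τ ^ n * (b - a) := by
      intro j hj
      refine (abs_pow_sub_pow_le b a j).trans ?_
      have h1 : max |b| |a| ^ (j - 1) ≤ τ ^ n :=
        (pow_le_pow_left₀ (by positivity) (max_le (habs b hb) (habs a ha)) _).trans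
          (pow_le_pow_right₀ hτ1 (by omega))
      have h2 : (j : ℝ) ≤ n := by exact_mod_cast hj
      rw [abs_of_nonneg (by linarith)]
      calc (b - a) * j * max |b| |a| ^ (j - 1) ≤ (b - a) * n * τ ^ n := by
            have : 0 ≤ b - a := by linarith
            gcongr
        _ = _ := by ring
    have hsum : |∑ j : Fin n, (∑ i, ε i * (M i j : ℝ)) * (b ^ (j : ℕ) - a ^ (j : ℕ))| ≤
        n ^ 3 * τ ^ n * (q * Y) * (b - a) := by
      refine (Finset.abs_sum_le_sum_abs _ _).trans ?_
      have : ∀ j ∈ Finset.univ, |(∑ i, ε i * (M i (j : Fin n) : ℝ)) *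
          (b ^ (j : ℕ) - a ^ (j : ℕ))| ≤ n * (q * Y) * (n * τ ^ n * (b - a)) := fun j _ ↦ by
        rw [abs_mul]
        exact mul_le_mul (hd j) (hpow j j.2.le) (abs_nonneg _) (by positivity)
      refine (Finset.sum_le_sum this).trans_eq ?_
      simp only [Finset.sum_const, Finset.card_univ, Fintype.card_fin, nsmul_eq_mul]
      ring
    have hdiff : aeval b (X ^ n + ofFn n s) - aeval a (X ^ n + ofFn n s) = (b ^ n - a ^ n) +
        K * (b - a) +
        ∑ j : Fin n, (∑ i, ε i * (M i j : ℝ)) * (b ^ (j : ℕ) - a ^ (j : ℕ)) := by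
      rw [hRx, hRx]
      simp only [mul_sub, Finset.sum_sub_distrib]
      ring
    have h1 := (abs_le.mp (hpow n le_rfl)).1
    have h2 := (abs_le.mp hsum).1
    rw [hdiff, hK]
    linarith

theorem minpoly_eq_of_irreducible_of_monic {R : ℤ[X]} (hR : Irreducible R) (hm : R.Monic)
    {α : ℝ} (h : aeval α R = 0) : minpoly ℤ α = R := by
  have hint : IsIntegral ℤ α := ⟨R, hm, h⟩
  exact eq_of_monic_of_associated (minpoly.monic hint) hm
    ((minpoly.irreducible hint).associated_of_dvd hR (minpoly.isIntegrallyClosed_dvd hint h))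

/-- The polynomials `A, TA, …, T^(n-e-1) A, B, TB, …, T^(e-1) B`. -/
noncomputable def shiftFamily (e n : ℕ) (A B : ℤ[X]) (i : Fin n) : ℤ[X] :=
  if (i : ℕ) < n - e then A * X ^ (i : ℕ) else B * X ^ ((i : ℕ) - (n - e))

section shiftFamily

variable {e n : ℕ} {A B : ℤ[X]}

theorem natDegree_shiftFamily_lt (hen : 2 * e ≤ n) (hA : A.natDegree ≤ e)
    (hB : B.natDegree ≤ e) (i : Fin n) : (shiftFamily e n A B i).natDegree < n := by
  unfold shiftFamily
  split_ifs with h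
  · refine (natDegree_mul_le.trans (add_le_add hA (natDegree_X_pow_le _))).trans_lt ?_
    omega
  · refine (natDegree_mul_le.trans (add_le_add hB (natDegree_X_pow_le _))).trans_lt ?_
    have := i.2
    omega

theorem naiveHeight_mul_X_pow_le (P : ℤ[X]) (k : ℕ) : naiveHeight (P * X ^ k) ≤ naiveHeight P := by
  refine naiveHeight_le_of_coeff fun j ↦ ?_
  rw [coeff_mul_X_pow']
  split_ifs
  · exact abs_coeff_le_naiveHeight P _
  · simpa using naiveHeight_nonneg P

theorem naiveHeight_shiftFamily_le {Y : ℝ} (hA : naiveHeight A ≤ Y) (hB : naiveHeight B ≤ Y)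
    (i : Fin n) : naiveHeight (shiftFamily e n A B i) ≤ Y := by
  unfold shiftFamily
  split_ifs
  · exact (naiveHeight_mul_X_pow_le _ _).trans hA
  · exact (naiveHeight_mul_X_pow_le _ _).trans hB

theorem abs_aeval_shiftFamily_le {ξ δ : ℝ} (hA : |aeval ξ A| ≤ δ) (hB : |aeval ξ B| ≤ δ)
    (i : Fin n) : |aeval ξ (shiftFamily e n A B i)| ≤ max 1 |ξ| ^ n * δ := by
  have hpow : ∀ k ≤ n, |ξ| ^ k ≤ max 1 |ξ| ^ n := fun k hk ↦
    (pow_le_pow_left₀ (abs_nonneg _) (le_max_right _ _) k).trans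
      (pow_le_pow_right₀ (le_max_left _ _) hk)
  have hi := i.2
  unfold shiftFamily
  split_ifs
  all_goals
    rw [map_mul, map_pow, aeval_X, abs_mul, abs_pow, mul_comm]
    refine mul_le_mul (hpow _ (by omega)) ?_ (abs_nonneg _) (by positivity)
    assumption

/-- A linear relation between the rows reads `f A + g B = 0` with `deg g < e`, so `g = 0`, then `f =
0`, as for a Sylvester determinant. -/
theorem det_shiftFamily_ne_zero (he : 1 ≤ e) (hen : 2 * e ≤ n) (hA : A.natDegree = e)
    (hB : B.natDegree ≤ e)
    (hind : ∀ f g : ℤ[X], f * A + g * B = 0 → g.natDegree < e → g = 0) :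
    (Matrix.of fun i j : Fin n ↦ (shiftFamily e n A B i).coeff j).det ≠ 0 := by
  intro hdet
  obtain ⟨y, hy0, hy⟩ := Matrix.exists_vecMul_eq_zero_iff.mpr hdet
  set f : ℤ[X] := ∑ i : Fin n, if (i : ℕ) < n - e then C (y i) * X ^ (i : ℕ) else 0 with hf
  set g : ℤ[X] := ∑ i : Fin n, if (i : ℕ) < n - e then 0 else C (y i) * X ^ ((i : ℕ) - (n - e))
    with hg
  have hsum : f * A + g * B = ∑ i, C (y i) * shiftFamily e n A B i := by
    rw [hf, hg, Finset.sum_mul, Finset.sum_mul, ← Finset.sum_add_distrib]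
    refine Finset.sum_congr rfl fun i _ ↦ ?_
    unfold shiftFamily
    split_ifs <;> ring
  have hzero : f * A + g * B = 0 := by
    rw [hsum]
    ext j
    rw [finsetSum_coeff, coeff_zero]
    by_cases hj : j < n
    · have := congrFun hy ⟨j, hj⟩
      simpa [Matrix.vecMul, dotProduct, coeff_C_mul] using this
    · refine Finset.sum_eq_zero fun i _ ↦ ?_
      rw [coeff_C_mul, coeff_eq_zero_of_natDegree_lt
        ((natDegree_shiftFamily_lt hen hA.le hB i).trans_le (not_lt.mp hj)), mul_zero]
  have hgdeg : g.natDegree < e := by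
    have : g.natDegree ≤ e - 1 := by
      refine natDegree_sum_le_of_forall_le _ _ fun i _ ↦ ?_
      split_ifs
      · simp
      · refine (natDegree_C_mul_X_pow_le _ _).trans ?_
        have := i.2
        omega
    omega
  have hg0 := hind f g hzero hgdeg
  have hf0 : f = 0 := by
    rw [hg0, zero_mul, add_zero] at hzero
    refine (mul_eq_zero.mp hzero).resolve_right ?_
    rintro rfl
    simp at hA
    omega
  refine hy0 (funext fun i ↦ ?_)
  by_cases hi : (i : ℕ) < n - e
  · have h1 : f.coeff i = y i := by
      rw [hf, finsetSum_coeff, Finset.sum_eq_single i]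
      · rw [if_pos hi, coeff_C_mul_X_pow, if_pos rfl]
      · intro k _ hk
        split_ifs
        · rw [coeff_C_mul_X_pow, if_neg fun h ↦ hk (Fin.ext h.symm)]
        · simp
      · simp
    rw [← h1, hf0, coeff_zero, Pi.zero_apply]
  · have h1 : g.coeff ((i : ℕ) - (n - e)) = y i := by
      rw [hg, finsetSum_coeff, Finset.sum_eq_single i]
      · rw [if_neg hi, coeff_C_mul_X_pow, if_pos rfl]
      · intro k _ hk
        split_ifs with hk'
        · simp
        · rw [coeff_C_mul_X_pow, if_neg fun h ↦ hk (Fin.ext (by omega))]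
      · simp
    rw [← h1, hg0, coeff_zero, Pi.zero_apply]

theorem abs_det_shiftFamily_le {Y : ℝ} (hA : naiveHeight A ≤ Y) (hB : naiveHeight B ≤ Y) :
    |((Matrix.of fun i j : Fin n ↦ (shiftFamily e n A B i).coeff j).det : ℝ)| ≤
      n.factorial * Y ^ n := by
  set M := Matrix.of fun i j : Fin n ↦ (shiftFamily e n A B i).coeff j with hM
  have h1 : (M.det : ℝ) = (M.map (Int.castRingHom ℝ)).det := RingHom.map_det (Int.castRingHom ℝ) M
  rw [h1]
  have := Matrix.det_le (A := M.map (Int.castRingHom ℝ)) (abv := AbsoluteValue.abs) (x := Y)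
    fun i j ↦ by
      simpa [hM] using (abs_coeff_le_naiveHeight _ _).trans (naiveHeight_shiftFamily_le hA hB i)
  simpa using this

end shiftFamily

theorem exists_root_of_steep {R : ℤ[X]} {ξ Y : ℝ} (hY : 0 < Y)
    (hR : ∀ a b : ℝ, |a - ξ| ≤ 1 → |b - ξ| ≤ 1 → a ≤ b → Y * (b - a) ≤ aeval b R - aeval a R)
    (h : |aeval ξ R| ≤ Y) : ∃ α : ℝ, aeval α R = 0 ∧ |ξ - α| ≤ |aeval ξ R| / Y := by
  set ρ := |aeval ξ R| / Y with hρ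
  have hρ0 : 0 ≤ ρ := by positivity
  have hρ1 : ρ ≤ 1 := (div_le_one hY).mpr h
  have hYρ : Y * ρ = |aeval ξ R| := by rw [hρ]; field_simp
  have h1 := hR (ξ - ρ) ξ (by rw [abs_le]; constructor <;> linarith) (by simp) (by linarith)
  have h2 := hR ξ (ξ + ρ) (by simp) (by rw [abs_le]; constructor <;> linarith) (by linarith)
  rw [sub_sub_cancel, hYρ] at h1
  rw [add_sub_cancel_left, hYρ] at h2
  obtain ⟨α, hα, hα0⟩ : (0 : ℝ) ∈ (fun x : ℝ ↦ aeval x R) '' Set.Icc (ξ - ρ) (ξ + ρ) :=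
    intermediate_value_Icc (by linarith) R.continuous_aeval.continuousOn
    ⟨by linarith [le_abs_self (aeval ξ R)], by linarith [neg_abs_le (aeval ξ R)]⟩
  refine ⟨α, hα0, ?_⟩
  rw [abs_le]
  constructor <;> linarith [hα.1, hα.2]

theorem le_rpow_neg_of_le {H Y x c₁ c₂ a b s : ℝ} (hH : 0 < H) (hY : 0 < Y) (hc₁ : 0 < c₁)
    (hs : 0 ≤ s) (hHY : H ≤ c₁ * Y ^ a) (hx : x ≤ c₂ * Y ^ (-b))
    (hc : c₂ * c₁ ^ s ≤ Y ^ (b - a * s)) : x ≤ H ^ (-s) := by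
  have h1 : H ^ s ≤ c₁ ^ s * Y ^ (a * s) := by
    refine (Real.rpow_le_rpow hH.le hHY hs).trans_eq ?_
    rw [Real.mul_rpow hc₁.le (by positivity), ← Real.rpow_mul hY.le]
  refine hx.trans ?_
  have h2 : (c₁ ^ s * Y ^ (a * s))⁻¹ ≤ H ^ (-s) := by
    rw [Real.rpow_neg hH.le]
    exact inv_anti₀ (by positivity) h1
  refine le_trans ?_ h2
  rw [← one_div, le_div_iff₀ (by positivity)]
  calc c₂ * Y ^ (-b) * (c₁ ^ s * Y ^ (a * s)) = c₂ * c₁ ^ s * Y ^ (-(b - a * s)) := by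
        rw [show -(b - a * s) = -b + a * s by ring, Real.rpow_add hY]
        ring
    _ ≤ Y ^ (b - a * s) * Y ^ (-(b - a * s)) := by gcongr
    _ = 1 := by rw [← Real.rpow_add hY, add_neg_cancel, Real.rpow_zero]

/-- For `e ∈ {1, 2}` and `2e ≤ n`, irreducible monic polynomials of degree `n` which are small at
`ξ` with exponent close to `e`, and which have a correspondingly close real root. -/
theorem exists_irreducible_monic_near {e n : ℕ} (he : e = 1 ∨ e = 2) (hen : 2 * e ≤ n) {ξ : ℝ}
    (hξ : Transcendental ℚ ξ) {w : ℝ} (hw0 : 0 ≤ w) (hw : w < e) {ε : ℝ} (hε : 0 < ε) :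
    ∃ R : ℤ[X], Irreducible R ∧ R.Monic ∧ R.natDegree = n ∧
      |aeval ξ R| ≤ naiveHeight R ^ (-w) ∧ |aeval ξ R| < ε ∧
      ∃ α : ℝ, aeval α R = 0 ∧ |ξ - α| ≤ naiveHeight R ^ (-(w + 1)) ∧ |ξ - α| < ε := by
  have he1 : 1 ≤ e := by omega
  -- Heights are `O(Y ^ (1 + 2η))` and values at `ξ` are `O(Y ^ (-(e - 2η)))`. This `η` keeps `e - w
  -- - 2η (w + 1)` and `e - w - 2η (w + 2)` positive, as required for the value and for the root.
  set η : ℝ := (e - w) / (4 * (w + 2)) with hη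
  have hη0 : 0 < η := div_pos (by linarith) (by linarith)
  have hηw : 2 * η * (w + 2) = (e - w) / 2 := by rw [hη]; field_simp; ring
  obtain ⟨c, hc0, hc⟩ := exists_independent_pair he hξ
  obtain ⟨c₁, hc₁, hR⟩ := exists_eisenstein_near (n := n) (by omega) ξ
  set c₂ : ℝ := c₁ * (max 1 |ξ| ^ n * c) with hc₂
  have hc₁0 : 0 < c₁ := by linarith
  have hc₂0 : 0 < c₂ := by positivity
  have hb : 0 < (e : ℝ) - 2 * η := by nlinarith
  obtain ⟨B, hB⟩ := ((eventually_ge_atTop (1 : ℝ)).and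
    ((eventually_exists_prime_not_dvd n hη0).and
    (((tendsto_rpow_atTop (show 0 < (e : ℝ) - 2 * η - (1 + 2 * η) * w by nlinarith)
      ).eventually_ge_atTop (c₂ * c₁ ^ w)).and
    (((tendsto_rpow_atTop (show 0 < (e : ℝ) - 2 * η + 1 - (1 + 2 * η) * (w + 1) by nlinarith)
      ).eventually_ge_atTop (c₂ * c₁ ^ (w + 1))).and
    ((tendsto_rpow_atTop hb).eventually_gt_atTop (c₂ / min 1 ε)))))).exists_forall_of_atTop
  obtain ⟨Y, hY, A, B', hA, hB', hAY, hBY, hAξ, hBξ, hind⟩ := hc ⌈B⌉₊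
  obtain ⟨hY1, hprime, h1, h2, h3⟩ := hB Y ((Nat.le_ceil B).trans (by exact_mod_cast hY))
  have hY0 : (0 : ℝ) < Y := by linarith
  have hdet := det_shiftFamily_ne_zero he1 hen hA hB' hind
  obtain ⟨p, hp, hpY, hpD⟩ := hprime _ hdet (abs_det_shiftFamily_le hAY hBY)
  have hsmall : ∀ {x : ℝ}, x * (Y : ℝ) ^ e ≤ c → x ≤ c * (Y : ℝ) ^ (-(e : ℝ)) := fun {x} hx ↦ by
    rw [Real.rpow_neg hY0.le, Real.rpow_natCast, ← div_eq_mul_inv]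
    exact (le_div_iff₀ (by positivity)).mpr hx
  obtain ⟨R, hRi, hRm, hRd, hRH, hRξ, hRs⟩ := hR (shiftFamily e n A B') Y
    (max 1 |ξ| ^ n * (c * (Y : ℝ) ^ (-(e : ℝ)))) p hY1
    (natDegree_shiftFamily_lt hen hA.le hB') (naiveHeight_shiftFamily_le hAY hBY)
    (abs_aeval_shiftFamily_le (hsmall hAξ) (hsmall hBξ)) hp hdet hpD
  have hp2 : (p : ℝ) ^ 2 ≤ (Y : ℝ) ^ (2 * η) := by
    rw [mul_comm, Real.rpow_mul hY0.le, Real.rpow_two]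
    gcongr
  have hH0 : 0 < naiveHeight R := by linarith [one_le_naiveHeight hRm.ne_zero]
  have hH : naiveHeight R ≤ c₁ * (Y : ℝ) ^ (1 + 2 * η) := by
    refine hRH.trans ?_
    rw [add_comm, Real.rpow_add hY0, Real.rpow_one]
    gcongr
  have hξR : |aeval ξ R| ≤ c₂ * (Y : ℝ) ^ (-((e : ℝ) - 2 * η)) := by
    refine hRξ.trans ?_
    rw [show -((e : ℝ) - 2 * η) = 2 * η + -(e : ℝ) by ring, Real.rpow_add hY0, hc₂]
    calc c₁ * ((p : ℝ) ^ 2 * (max 1 |ξ| ^ n * (c * (Y : ℝ) ^ (-(e : ℝ)))))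
        ≤ c₁ * ((Y : ℝ) ^ (2 * η) * (max 1 |ξ| ^ n * (c * (Y : ℝ) ^ (-(e : ℝ))))) := by gcongr
      _ = _ := by ring
  have hmin : |aeval ξ R| < min 1 ε := by
    refine hξR.trans_lt ?_
    rw [Real.rpow_neg hY0.le, ← div_eq_mul_inv, div_lt_comm₀ (by positivity) (by positivity)]
    exact h3
  obtain ⟨α, hα, hαξ⟩ := exists_root_of_steep hY0 hRs
    ((hmin.le.trans (min_le_left _ _)).trans hY1)
  refine ⟨R, hRi, hRm, hRd, le_rpow_neg_of_le hH0 hY0 hc₁0 hw0 hH hξR h1,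
    hmin.trans_le (min_le_right _ _), α, hα,
    le_rpow_neg_of_le hH0 hY0 hc₁0 (by linarith) hH ?_ h2,
    (hαξ.trans (div_le_self (abs_nonneg _) hY1)).trans_lt (hmin.trans_le (min_le_right _ _))⟩
  refine hαξ.trans ?_
  rw [neg_add, Real.rpow_add hY0, Real.rpow_neg_one, ← mul_assoc, div_eq_mul_inv]
  gcongr

/-! ### Assembling the bounds -/

theorem sub_ne_zero_of_isIntegral {ξ α : ℝ} (hξ : Transcendental ℚ ξ) (hα : IsIntegral ℤ α) :
    ξ - α ≠ 0 := by
  rw [sub_ne_zero]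
  rintro rfl
  exact hξ ((hα.tower_top (A := ℚ)).isAlgebraic)

theorem natCast_le_intExponent {e n : ℕ} (he : e = 1 ∨ e = 2) (hen : 2 * e ≤ n) {ξ : ℝ}
    (hξ : Transcendental ℚ ξ) : ((e : ℝ) : EReal) ≤ intExponent n ξ := by
  refine coe_le_intExponent fun w hw ε hε ↦ ?_
  obtain ⟨R, h1, h2, h3, h4, h5, -⟩ := exists_irreducible_monic_near he hen hξ (le_max_right w 0)
    (max_lt hw (by rcases he with rfl | rfl <;> norm_num)) hε
  exact ⟨R, h1, h2, h3, abs_pos.mpr (aeval_ne_zero_of_transcendental hξ h2.ne_zero),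
    h4.trans (Real.rpow_le_rpow_of_exponent_le (one_le_naiveHeight h2.ne_zero)
      (by linarith [le_max_left w 0])), h5⟩

theorem natCast_le_starIntExponent {e n : ℕ} (he : e = 1 ∨ e = 2) (hen : 2 * e ≤ n) {ξ : ℝ}
    (hξ : Transcendental ℚ ξ) : ((e : ℝ) : EReal) ≤ starIntExponent n ξ := by
  refine coe_le_starIntExponent fun w hw ε hε ↦ ?_
  obtain ⟨R, h1, h2, h3, -, -, α, h4, h5, h6⟩ := exists_irreducible_monic_near he hen hξ
    (le_max_right w 0) (max_lt hw (by rcases he with rfl | rfl <;> norm_num)) hε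
  have hmin := minpoly_eq_of_irreducible_of_monic h1 h2 h4
  have hint : IsIntegral ℤ α := ⟨R, h2, h4⟩
  refine ⟨α, hint, by rw [hmin, h3], abs_pos.mpr (sub_ne_zero_of_isIntegral hξ hint), ?_, h6⟩
  rw [hmin]
  exact h5.trans (Real.rpow_le_rpow_of_exponent_le (one_le_naiveHeight h2.ne_zero)
      (by linarith [le_max_left w 0]))

theorem coe_le_intExponent_of_pos {m n : ℕ} (hm : 1 ≤ m) (hmn : m ≤ n) {ξ : ℝ}
    (hξ : Transcendental ℚ ξ) {V : ℝ} (hV : 0 < V) (h₁ : (V : EReal) ≤ intExponent m ξ)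
    (h₂ : (V : EReal) ≤ uniformExponent (n - 1) ξ) : (V : EReal) ≤ intExponent n ξ := by
  refine coe_le_intExponent fun w hw ε hε ↦ ?_
  set s := max w 0
  have hsV : s < V := max_lt hw hV
  have hs0 : 0 ≤ s := le_max_right _ _
  set v := (s + V) / 2 with hv
  obtain ⟨C, hC, hpair⟩ := exists_smallIrreducible_pair hm hmn hξ hV h₁ h₂
    (show v < V by linarith)
  obtain ⟨B, hB⟩ := (((tendsto_rpow_atTop (show 0 < v - 1 * s by linarith)).eventually_ge_atTop
    (1 * C ^ s)).and ((tendsto_rpow_neg_atTop (show 0 < v by linarith)).eventually_lt_const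
      hε)).exists_forall_of_atTop
  obtain ⟨H, hBH, hH1, R, -, -, ⟨h1, h2, h3, -, h5, h6⟩, -⟩ := hpair B
  obtain ⟨hB1, hB2⟩ := hB H hBH
  have hR := one_le_naiveHeight h2.ne_zero
  refine ⟨R, h1, h2, h3, abs_pos.mpr (aeval_ne_zero_of_transcendental hξ h2.ne_zero), ?_,
    h6.trans_lt hB2⟩
  refine (le_rpow_neg_of_le (H := naiveHeight R) (Y := H) (c₁ := C) (a := 1) (by linarith)
    (by linarith) (by linarith) hs0 (by rwa [Real.rpow_one]) (by rwa [one_mul]) hB1).trans ?_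
  exact Real.rpow_le_rpow_of_exponent_le hR (by linarith [le_max_left w 0])

theorem min_le_intExponent {m n : ℕ} (hm : 1 ≤ m) (hmn : m ≤ n) {ξ : ℝ}
    (hξ : Transcendental ℚ ξ) :
    min (intExponent m ξ) (uniformExponent (n - 1) ξ) ≤ intExponent n ξ := by
  rcases (hm.trans hmn).eq_or_lt with rfl | hn
  · obtain rfl : m = 1 := by omega
    exact min_le_left _ _
  by_contra! hlt
  obtain ⟨V, hV1, hV2⟩ := EReal.lt_iff_exists_real_btwn.mp hlt
  refine absurd ?_ (not_le.mpr hV1)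
  -- The pencil argument needs `V > 0`; for other `V` and `n ≥ 2` the Eisenstein bound `1` is
  -- enough.
  rcases le_or_gt V 0 with hV | hV
  · refine le_trans ?_ (natCast_le_intExponent (e := 1) (Or.inl rfl) (by omega) hξ)
    exact EReal.coe_le_coe_iff.mpr (by push_cast; linarith)
  · exact coe_le_intExponent_of_pos hm hmn hξ hV (hV2.le.trans (min_le_left _ _))
      (hV2.le.trans (min_le_right _ _))

theorem coe_le_starIntExponent_of_lt {m n : ℕ} (hm : 1 ≤ m) (hmn : m ≤ n) {ξ : ℝ}
    (hξ : Transcendental ℚ ξ) {V : ℝ} (hV : (n : ℝ) - 1 < V)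
    (h₁ : (V : EReal) ≤ intExponent m ξ) (h₂ : (V : EReal) ≤ uniformExponent (n - 1) ξ) :
    ((3 / 2 * V - n + 1 / 2 : ℝ) : EReal) ≤ starIntExponent n ξ := by
  have hn : (1 : ℝ) ≤ n := by exact_mod_cast hm.trans hmn
  refine coe_le_starIntExponent fun w hw ε hε ↦ ?_
  set s := max (w + 1) 0
  have hs0 : 0 ≤ s := le_max_right _ _
  have hsD : s < 3 / 2 * (V + 1) - n := max_lt (by linarith) (by linarith)
  set d := (s + (3 / 2 * (V + 1) - n)) / 2 with hd
  -- The second lower bound on `v` is `2 d < 3 (v + 1) - 2 n` solved for `v`.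
  obtain ⟨v, hv, hvV⟩ := exists_between (max_lt hV (by linarith : (d + n) * (2 / 3) - 1 < V))
  obtain ⟨hv1, hv2⟩ := max_lt_iff.mp hv
  obtain ⟨C, hC, hpair⟩ := exists_smallIrreducible_pair hm hmn hξ (by linarith) h₁ h₂ hvV
  obtain ⟨H₀, hroot⟩ := exists_close_real_root (hm.trans hmn) (d := d) hξ hC hv1 (by linarith)
    (by linarith)
  obtain ⟨B, hB⟩ := ((eventually_ge_atTop H₀).and
    (((tendsto_rpow_atTop (show 0 < d - 1 * s by linarith)).eventually_ge_atTop
    (1 * C ^ s)).and ((tendsto_rpow_neg_atTop (show 0 < d by linarith)).eventually_lt_const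
      hε))).exists_forall_of_atTop
  obtain ⟨H, hBH, hH1, R, S, hRS, hR, hS⟩ := hpair B
  obtain ⟨hB0, hB1, hB2⟩ := hB H hBH
  obtain ⟨α, hα, hor⟩ := hroot H hB0 R S hRS hR hS
  obtain ⟨T, ⟨h1, h2, h3, -, h5, -⟩, hT⟩ :
      ∃ T : ℤ[X], SmallIrreducible n ξ v C H T ∧ aeval α T = 0 :=
    hor.elim (fun h ↦ ⟨R, hR, h⟩) fun h ↦ ⟨S, hS, h⟩
  have hmin := minpoly_eq_of_irreducible_of_monic h1 h2 hT
  have hint : IsIntegral ℤ α := ⟨T, h2, hT⟩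
  have hT1 := one_le_naiveHeight h2.ne_zero
  refine ⟨α, hint, by rw [hmin, h3], abs_pos.mpr (sub_ne_zero_of_isIntegral hξ hint), ?_,
    hα.trans_lt hB2⟩
  rw [hmin]
  refine (le_rpow_neg_of_le (H := naiveHeight T) (Y := H) (c₁ := C) (a := 1) (by linarith)
    (by linarith) (by linarith) hs0 (by rwa [Real.rpow_one]) (by rwa [one_mul]) hB1).trans ?_
  exact Real.rpow_le_rpow_of_exponent_le hT1 (by linarith [le_max_left (w + 1) 0])

/-- A monic linear polynomial `X + a` of large height has value at `ξ` comparable to `|a|`, hence to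
its height. -/
theorem intExponent_one_le (ξ : ℝ) : intExponent 1 ξ ≤ ((-1 : ℝ) : EReal) := by
  refine iSup₂_le fun w hw ↦ EReal.coe_le_coe_iff.mpr ?_
  by_contra! hlt
  set s := max (-w) 0
  have hs1 : s < 1 := max_lt (by linarith) one_pos
  have hs0 : 0 ≤ s := le_max_right _ _
  obtain ⟨B, hB⟩ := ((tendsto_rpow_atTop (sub_pos.mpr hs1)).eventually_ge_atTop
    (|ξ| + 3)).exists_forall_of_atTop
  refine hw ((finite_naiveHeight_le 1 B).subset ?_)
  rintro P ⟨-, hP2, hP3, -, hP5⟩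
  refine ⟨hP3.le, ?_⟩
  by_contra! hPB
  have hH := one_le_naiveHeight hP2.ne_zero
  have h1 := hB _ hPB.le
  have h2 : |aeval ξ P| ≤ naiveHeight P ^ s :=
    hP5.trans (Real.rpow_le_rpow_of_exponent_le hH (le_max_left _ _))
  have hlin : P = X + C (P.coeff 0) := by
    conv_lhs => rw [eq_X_add_C_of_natDegree_le_one hP3.le]
    have : P.coeff 1 = 1 := by rw [← hP3]; exact hP2
    rw [this, C_1, one_mul]
  have h3 : |(P.coeff 0 : ℝ)| ≤ |aeval ξ P| + |ξ| := by
    have : aeval ξ P = ξ + P.coeff 0 := by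
      conv_lhs => rw [hlin]
      simp
    rw [this]
    have := abs_sub (ξ + P.coeff 0) ξ
    rwa [add_sub_cancel_left] at this
  have h4 : naiveHeight P ≤ 1 + |(P.coeff 0 : ℝ)| := by
    refine naiveHeight_le_of_coeff fun j ↦ ?_
    rcases j with _ | _ | j
    · linarith
    · rw [zero_add, show P.coeff 1 = 1 by rw [← hP3]; exact hP2]
      simp
    · rw [coeff_eq_zero_of_natDegree_lt (by omega)]
      simp only [Int.cast_zero, abs_zero]
      positivity
  have h5 : 1 ≤ naiveHeight P ^ s := Real.one_le_rpow hH hs0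
  have h6 : naiveHeight P = naiveHeight P ^ s * naiveHeight P ^ (1 - s) := by
    rw [← Real.rpow_add (by linarith), add_sub_cancel, Real.rpow_one]
  nlinarith [abs_nonneg ξ]

/-- Large integers `a` already suffice: `|ξ - a|` is comparable to `a = a ^ (-(-2) - 1)`. -/
theorem neg_two_le_starIntExponent_one {ξ : ℝ} (hξ : Transcendental ℚ ξ) :
    ((-2 : ℝ) : EReal) ≤ starIntExponent 1 ξ := by
  refine coe_le_supExponent_of_forall_lt fun w hw ↦ ?_
  obtain ⟨B, hB⟩ := ((tendsto_rpow_atTop (show 0 < -w - 2 by linarith)).eventually_ge_atTop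
    (|ξ| + 1)).exists_forall_of_atTop
  refine Set.infinite_of_injective_forall_mem (f := fun k : ℕ ↦ ((k + 1 + ⌈B⌉₊ : ℕ) : ℝ))
    (fun a b hab ↦ by simpa using hab) fun k ↦ ?_
  set a : ℕ := k + 1 + ⌈B⌉₊ with ha
  have hroot : aeval (a : ℝ) (X - C (a : ℤ)) = 0 := by simp
  have hmin := minpoly_eq_of_irreducible_of_monic (irreducible_X_sub_C (a : ℤ))
    (monic_X_sub_C _) hroot
  have hint : IsIntegral ℤ (a : ℝ) := ⟨_, monic_X_sub_C (a : ℤ), hroot⟩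
  refine ⟨hint, by rw [hmin, natDegree_X_sub_C],
    abs_pos.mpr (sub_ne_zero_of_isIntegral hξ hint), ?_⟩
  have ha1 : (1 : ℝ) ≤ a := by exact_mod_cast (by omega : 1 ≤ a)
  have haB : B ≤ a := (Nat.le_ceil B).trans (by exact_mod_cast (by omega : ⌈B⌉₊ ≤ a))
  have h1 := hB a haB
  have hH : (a : ℝ) ≤ naiveHeight (X - C (a : ℤ)) := by
    have := abs_coeff_le_naiveHeight (X - C (a : ℤ)) 0
    simpa using this
  rw [hmin]
  calc |ξ - a| ≤ |ξ| + a := (abs_sub _ _).trans_eq (by rw [Nat.abs_cast])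
    _ ≤ a * (|ξ| + 1) := by nlinarith [abs_nonneg ξ]
    _ ≤ a * (a : ℝ) ^ (-w - 2) := by gcongr
    _ = (a : ℝ) ^ (-w - 1) := by
        rw [show -w - 1 = 1 + (-w - 2) by ring, Real.rpow_add (by linarith), Real.rpow_one]
    _ ≤ _ := Real.rpow_le_rpow (by linarith) hH (by linarith)

/-- Reduces an inequality in `EReal` to real `V ≤ W`; if `W = ⊤`, arbitrarily large `V` force `S =
⊤`. -/
theorem affine_le_of_forall_coe {W S : EReal} {a b : ℝ} (ha : (a : EReal) < W)
    (h : ∀ V : ℝ, a < V → (V : EReal) ≤ W → ((3 / 2 * V - b + 1 / 2 : ℝ) : EReal) ≤ S) :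
    ((3 / 2 : ℝ) : EReal) * W - (b : EReal) + ((1 / 2 : ℝ) : EReal) ≤ S := by
  induction W with
  | bot => simp at ha
  | coe V => exact_mod_cast h V (by exact_mod_cast ha) le_rfl
  | top =>
    have : S = ⊤ := by
      refine EReal.eq_top_iff_forall_lt S |>.mpr fun y ↦ ?_
      refine lt_of_lt_of_le ?_ (h (max a ((y + b) * (2 / 3)) + 1) ?_ le_top)
      · refine EReal.coe_lt_coe_iff.mpr ?_
        linarith [le_max_right a ((y + b) * (2 / 3))]
      · linarith [le_max_left a ((y + b) * (2 / 3))]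
    rw [this]
    exact le_top

theorem affine_le_of_le {W S : EReal} {a b c e : ℝ} (ha : (a : EReal) < W) (hc : W ≤ (c : EReal))
    (he : (e : EReal) ≤ S) (h : 3 / 2 * c - b + 1 / 2 ≤ e) :
    ((3 / 2 : ℝ) : EReal) * W - (b : EReal) + ((1 / 2 : ℝ) : EReal) ≤ S :=
  affine_le_of_forall_coe ha fun V _ hV ↦ le_trans (EReal.coe_le_coe_iff.mpr (by
    have := EReal.coe_le_coe_iff.mp (hV.trans hc)
    linarith)) he

theorem affine_le_starIntExponent {m n : ℕ} (hm : 1 ≤ m) (hmn : m ≤ n) {ξ : ℝ}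
    (hξ : Transcendental ℚ ξ)
    (h : ((2 * n - 7 : ℝ) : EReal) < min (intExponent m ξ) (uniformExponent (n - 1) ξ)) :
    ((3 / 2 : ℝ) : EReal) * min (intExponent m ξ) (uniformExponent (n - 1) ξ)
        - ((n : ℝ) : EReal) + ((1 / 2 : ℝ) : EReal) ≤ starIntExponent n ξ := by
  rcases (hm.trans hmn).eq_or_lt with rfl | hn
  · obtain rfl : m = 1 := by omega
    exact affine_le_of_le h ((min_le_left _ _).trans (intExponent_one_le ξ))
      (neg_two_le_starIntExponent_one hξ) (by norm_num)
  rcases lt_or_ge (((n : ℝ) - 1 : ℝ) : EReal)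
    (min (intExponent m ξ) (uniformExponent (n - 1) ξ)) with hW | hW
  · exact affine_le_of_forall_coe hW fun V hV hVW ↦ coe_le_starIntExponent_of_lt hm hmn hξ hV
      (hVW.trans (min_le_left _ _)) (hVW.trans (min_le_right _ _))
  -- Now `2n - 7 < W ≤ n - 1`, and the bound to prove is at most `n / 2 - 1`: at most `1` for `n ≤
  -- 4` and `3 / 2` for `n = 5`.
  have hn6 : n < 6 := by
    have := EReal.coe_lt_coe_iff.mp (h.trans_le hW)
    exact_mod_cast (by linarith : (n : ℝ) < 6)
  rcases lt_or_ge n 5 with hn5 | hn5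
  · refine affine_le_of_le h hW (natCast_le_starIntExponent (e := 1) (Or.inl rfl) (by omega) hξ) ?_
    have : (n : ℝ) ≤ 4 := by exact_mod_cast (by omega : n ≤ 4)
    push_cast
    linarith
  · refine affine_le_of_le h hW (natCast_le_starIntExponent (e := 2) (Or.inr rfl) (by omega) hξ) ?_
    have : (n : ℝ) ≤ 5 := by exact_mod_cast (by omega : n ≤ 5)
    push_cast
    linarith

theorem theorem1p4 (m n : ℕ) (hm : 1 ≤ m) (hmn : m ≤ n) (ξ : ℝ) (hξ : Transcendental ℚ ξ)
    (h : ((2 * n - 7 : ℝ) : EReal) < min (intExponent m ξ) (uniformExponent (n - 1) ξ)) :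
    ((3 / 2 : ℝ) : EReal) * min (intExponent m ξ) (uniformExponent (n - 1) ξ)
        - ((n : ℝ) : EReal) + ((1 / 2 : ℝ) : EReal) ≤ starIntExponent n ξ ∧
    min (intExponent m ξ) (uniformExponent (n - 1) ξ) ≤ intExponent n ξ ∧
    (2 ≤ n → min (intExponent (n - 1) ξ) ((n - 1 : ℝ) : EReal) ≤ intExponent n ξ) := by
  refine ⟨affine_le_starIntExponent hm hmn hξ h, min_le_intExponent hm hmn hξ, fun hn ↦ ?_⟩
  refine le_trans (min_le_min_left _ ?_) (min_le_intExponent (m := n - 1) (by omega) (by omega) hξ)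
  have := coe_le_uniformExponent (n - 1) hξ
  rwa [Nat.cast_sub (by omega), Nat.cast_one] at this
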